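/- Let $m,n$ be positive integers with $n\ge 5$, $(n,6)=1$, $(m,3)=1$ and $(m,n)=1$, and let $p$ be a prime with $p\nmid mn$. Let $\mathcal C$ be the smooth projective model over $\mathbb Z_{(p)}$ of the affine curve $y^m=t^n+1$, that is, the normalization of $\mathbb P^1_{\mathbb Z_{(p)}}$ (with coordinate $t$) in this affine curve, and let $C_p=\mathcal C\otimes\mathbb F_p$. Let $\pi:\mathcal C\to\mathbb P^1_{\mathbb Z_{(p)}}$ be $(y,t)\mapsto t$, let $F:\mathbb P^1_{\mathbb Z_{(p)}}\to\mathbb P^1_{\mathbb Z_{(p)}}$ be $t\mapsto t^p$, let $\Gamma_{F\circ\pi}\subset\mathcal C\times\mathbb P^1$ be the graph of $F\circ\pi$, and put $\mathcal D=(\mathrm{id}\times\pi)^*\Gamma_{F\circ\pi}\subset\mathcal C\times\mathcal C$, with special fiber $D_p\subset C_p\times C_p$. Let $\varphi$ be the Frobenius endomorphism of $C_p$ (the identity on the underlying space, $a\mapsto a^p$ on functions). Let $\kappa=\mathbb F_p(\xi)$, where $\xi$ is a primitive $m$-th root of unity, and denote also by $\xi$ the automorphism of $C_p\otimes\kappa$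 over $\kappa$ given on the affine curve by $(y,t)\mapsto(\xi y,t)$, and by $\varphi$ the base change of $\varphi$ to $\kappa$. Then the graphs $\Gamma_{\xi^j\circ\varphi}\subset (C_p\otimes\kappa)\times_\kappa(C_p\otimes\kappa)$ are effective Cartier divisors and $$D_p\otimes_{\mathbb F_p}\kappa=\sum_{j=0}^{m-1}\Gamma_{\xi^j\circ\varphi}$$ as divisors, i.e. the ideal sheaf of the left-hand side is the product of the ideal sheaves of the graphs on the right. In particular, over $\mathbb F_p$, the graph $\Gamma_\varphi\subset C_p\times C_p$ is a closed subscheme of $D_p$ and its support is an irreducible component of $D_p$. -/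

import Mathlib

open CategoryTheory CategoryTheory.Limits AlgebraicGeometry Polynomial
open scoped LaurentPolynomial

noncomputable section

namespace SuperellipticFrobenius

section ProjectiveLine

variable (R : Type) [CommRing R]

/-- The inclusion `R[t] → R[t, t⁻¹]`. -/
def toLaurentZero : R[X] →+* R[T;T⁻¹] := Polynomial.toLaurent

/-- The map `R[s] → R[t, t⁻¹]`, `s ↦ t⁻¹`. -/
def toLaurentInfty : R[X] →+* R[T;T⁻¹] :=
  (LaurentPolynomial.invert (R := R) : R[T;T⁻¹] →+* R[T;T⁻¹]).comp Polynomial.toLaurent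

instance : IsOpenImmersion (Spec.map (CommRingCat.ofHom (toLaurentZero R))) := by
  let _ : Algebra R[X] R[T;T⁻¹] := (toLaurentZero R).toAlgebra
  have : IsLocalization.Away (X : R[X]) R[T;T⁻¹] := LaurentPolynomial.isLocalization
  exact IsOpenImmersion.of_isLocalization (X : R[X])

instance : IsOpenImmersion (Spec.map (CommRingCat.ofHom (toLaurentInfty R))) := by
  have h : Spec.map (CommRingCat.ofHom (toLaurentInfty R)) =
      (Scheme.Spec.mapIso
        (LaurentPolynomial.invert (R := R)).toRingEquiv.toCommRingCatIso.op).hom ≫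
        Spec.map (CommRingCat.ofHom (toLaurentZero R)) := by
    simp only [Functor.mapIso_hom, Scheme.Spec_map, Iso.op_hom, Quiver.Hom.unop_op,
      ← Spec.map_comp]
    rfl
  rw [h]
  infer_instance

instance : ∀ {i j : WalkingSpan} (h : i ⟶ j), IsOpenImmersion
    ((span (Spec.map (CommRingCat.ofHom (toLaurentZero R)))
      (Spec.map (CommRingCat.ofHom (toLaurentInfty R)))).map h)
  | _, _, .id i => by
    have h : (span (Spec.map (CommRingCat.ofHom (toLaurentZero R)))
        (Spec.map (CommRingCat.ofHom (toLaurentInfty R)))).map (WidePushoutShape.Hom.id i) =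
        𝟙 _ := CategoryTheory.Functor.map_id _ i
    rw [h]
    infer_instance
  | _, _, .init .left => by
    change IsOpenImmersion (Spec.map (CommRingCat.ofHom (toLaurentZero R)))
    infer_instance
  | _, _, .init .right => by
    change IsOpenImmersion (Spec.map (CommRingCat.ofHom (toLaurentInfty R)))
    infer_instance

instance : HasPushout (Spec.map (CommRingCat.ofHom (toLaurentZero R)))
    (Spec.map (CommRingCat.ofHom (toLaurentInfty R))) :=
  inferInstanceAs (HasColimit (span _ _))

/-- The projective line over `R`: two affine lines, with coordinates `t` and `s`, glued along
`s = t⁻¹`. -/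
def projLine : Scheme :=
  pushout (Spec.map (CommRingCat.ofHom (toLaurentZero R)))
    (Spec.map (CommRingCat.ofHom (toLaurentInfty R)))

/-- The chart with coordinate `t`. -/
def chartZero : Spec (.of R[X]) ⟶ projLine R := pushout.inl _ _

/-- The chart with coordinate `s = t⁻¹`. -/
def chartInfty : Spec (.of R[X]) ⟶ projLine R := pushout.inr _ _

lemma chart_condition :
    Spec.map (CommRingCat.ofHom (toLaurentZero R)) ≫ chartZero R =
      Spec.map (CommRingCat.ofHom (toLaurentInfty R)) ≫ chartInfty R :=
  pushout.condition

/-- A morphism out of the projective line, given on the two charts. -/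
def projLineDesc {Z : Scheme} (u v : Spec (.of R[X]) ⟶ Z)
    (h : Spec.map (CommRingCat.ofHom (toLaurentZero R)) ≫ u =
      Spec.map (CommRingCat.ofHom (toLaurentInfty R)) ≫ v) : projLine R ⟶ Z :=
  pushout.desc u v h

lemma chartZero_desc {Z : Scheme} (u v : Spec (.of R[X]) ⟶ Z) (h) :
    chartZero R ≫ projLineDesc R u v h = u :=
  pushout.inl_desc _ _ _

lemma chartInfty_desc {Z : Scheme} (u v : Spec (.of R[X]) ⟶ Z) (h) :
    chartInfty R ≫ projLineDesc R u v h = v :=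
  pushout.inr_desc _ _ _

lemma projLine_hom_ext {Z : Scheme} {u v : projLine R ⟶ Z}
    (h₀ : chartZero R ≫ u = chartZero R ≫ v)
    (h₁ : chartInfty R ≫ u = chartInfty R ≫ v) : u = v :=
  pushout.hom_ext h₀ h₁

/-- The structure morphism of the projective line over `R`. -/
def projLineStr : projLine R ⟶ Spec (.of R) :=
  projLineDesc R (Spec.map (CommRingCat.ofHom C)) (Spec.map (CommRingCat.ofHom C)) (by
    rw [← Spec.map_comp, ← Spec.map_comp, ← CommRingCat.ofHom_comp, ← CommRingCat.ofHom_comp]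
    congr 2
    ext a
    simp [toLaurentZero, toLaurentInfty])

/-- The projective line as an `R`-scheme. -/
def projLineOver : Over (Spec (.of R)) := Over.mk (projLineStr R)

/-- The endomorphism `T ↦ T ^ p` of `R[T, T⁻¹]`. -/
def laurentPow (p : ℕ) : R[T;T⁻¹] →+* R[T;T⁻¹] :=
  AddMonoidAlgebra.mapDomainRingHom R (p • AddMonoidHom.id ℤ)

lemma laurentPow_C (p : ℕ) (a : R) :
    laurentPow R p (LaurentPolynomial.C a) = LaurentPolynomial.C a := by
  change AddMonoidAlgebra.mapDomain _ (AddMonoidAlgebra.single (0 : ℤ) a) = _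
  rw [AddMonoidAlgebra.mapDomain_single, map_zero]
  rfl

lemma laurentPow_T (p : ℕ) (k : ℤ) :
    laurentPow R p (LaurentPolynomial.T k) = LaurentPolynomial.T (p * k) := by
  change AddMonoidAlgebra.mapDomain _ (AddMonoidAlgebra.single k (1 : R)) = _
  rw [AddMonoidAlgebra.mapDomain_single]
  simp only [AddMonoidHom.smul_apply, AddMonoidHom.id_apply, nsmul_eq_mul]
  rfl

/-- The endomorphism `X ↦ X ^ p` of `R[X]`. -/
def polyPow (p : ℕ) : R[X] →+* R[X] := eval₂RingHom C (X ^ p)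

lemma polyPow_comp_C (p : ℕ) : (polyPow R p).comp C = C := by
  ext a
  simp [polyPow]

/-- The morphism `F : t ↦ t ^ p` of the projective line; it is `s ↦ s ^ p` in the coordinate
`s = t⁻¹`. -/
def powHom (p : ℕ) : projLine R ⟶ projLine R :=
  projLineDesc R
    (Spec.map (CommRingCat.ofHom (polyPow R p)) ≫ chartZero R)
    (Spec.map (CommRingCat.ofHom (polyPow R p)) ≫ chartInfty R) (by
      have h0 : (toLaurentZero R).comp (polyPow R p) =
          (laurentPow R p).comp (toLaurentZero R) := by
        refine Polynomial.ringHom_ext (fun a => ?_) ?_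
        · simp [toLaurentZero, polyPow, laurentPow_C]
        · simp [toLaurentZero, polyPow, laurentPow_T]
      have h1 : (toLaurentInfty R).comp (polyPow R p) =
          (laurentPow R p).comp (toLaurentInfty R) := by
        refine Polynomial.ringHom_ext (fun a => ?_) ?_
        · simp [toLaurentInfty, polyPow, laurentPow_C]
        · simp [toLaurentInfty, polyPow, laurentPow_T]
      rw [← Category.assoc, ← Category.assoc, ← Spec.map_comp, ← Spec.map_comp,
        ← CommRingCat.ofHom_comp, ← CommRingCat.ofHom_comp, h0, h1, CommRingCat.ofHom_comp,
        CommRingCat.ofHom_comp, Spec.map_comp, Spec.map_comp, Category.assoc, Category.assoc,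
        chart_condition])

/-- The endomorphism `F : t ↦ t ^ p` of the projective line, as an `R`-morphism. -/
def powMap (p : ℕ) : projLineOver R ⟶ projLineOver R :=
  Over.homMk (powHom R p) (by
    change powHom R p ≫ projLineStr R = projLineStr R
    apply projLine_hom_ext
    · rw [powHom, ← Category.assoc, chartZero_desc, Category.assoc, projLineStr, chartZero_desc,
        ← Spec.map_comp, ← CommRingCat.ofHom_comp, polyPow_comp_C]
    · rw [powHom, ← Category.assoc, chartInfty_desc, Category.assoc, projLineStr,
        chartInfty_desc, ← Spec.map_comp, ← CommRingCat.ofHom_comp, polyPow_comp_C])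

end ProjectiveLine

section Curve

/-- The coordinate ring `R[t][y] / (y ^ m - (t ^ n + 1))`. -/
abbrev CoordRing (R : Type) [CommRing R] (m n : ℕ) : Type :=
  AdjoinRoot (X ^ m - C (X ^ n + 1) : R[X][X])

/-- The affine curve `y ^ m = t ^ n + 1` over `R`. -/
def affineCurve (R : Type) [CommRing R] (m n : ℕ) : Over (Spec (.of R)) :=
  Over.mk (Spec.map (CommRingCat.ofHom
    ((AdjoinRoot.of (X ^ m - C (X ^ n + 1) : R[X][X])).comp (C : R →+* R[X]))))

/-- The map induced on coordinate rings by a ring homomorphism `R → S`. -/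
def coordRingMap {R S : Type} [CommRing R] [CommRing S] (g : R →+* S) (m n : ℕ) :
    CoordRing R m n →+* CoordRing S m n :=
  AdjoinRoot.map (mapRingHom g) _ _ (by simp)

/-- The morphism of affine curves induced by a ring homomorphism `R → S`. -/
def affineBaseChange {R S : Type} [CommRing R] [CommRing S] (g : R →+* S) (m n : ℕ) :
    (affineCurve S m n).left ⟶ (affineCurve R m n).left :=
  Spec.map (CommRingCat.ofHom (coordRingMap g m n))

lemma affineBaseChange_hom {R S : Type} [CommRing R] [CommRing S] (g : R →+* S) (m n : ℕ) :
    affineBaseChange g m n ≫ (affineCurve R m n).hom =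
      (affineCurve S m n).hom ≫ Spec.map (CommRingCat.ofHom g) := by
  change Spec.map _ ≫ Spec.map _ = Spec.map _ ≫ Spec.map _
  rw [← Spec.map_comp, ← Spec.map_comp, ← CommRingCat.ofHom_comp, ← CommRingCat.ofHom_comp]
  congr 2
  ext a
  simp [coordRingMap]

/-- The endomorphism `t ↦ t`, `y ↦ ζ y` of the coordinate ring, where `ζ ^ m = 1`. -/
def coordRingRot {R : Type} [CommRing R] {m : ℕ} (n : ℕ) {ζ : R} (hζ : ζ ^ m = 1) :
    CoordRing R m n →+* CoordRing R m n :=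
  AdjoinRoot.lift (AdjoinRoot.of _) (AdjoinRoot.of _ (C ζ) * AdjoinRoot.root _) (by
    have h : AdjoinRoot.root (X ^ m - C (X ^ n + 1) : R[X][X]) ^ m =
        AdjoinRoot.of (X ^ m - C (X ^ n + 1) : R[X][X]) (X ^ n + 1) := by
      have := AdjoinRoot.eval₂_root (X ^ m - C (X ^ n + 1) : R[X][X])
      rw [eval₂_sub, eval₂_pow, eval₂_X, eval₂_C] at this
      exact sub_eq_zero.mp this
    rw [eval₂_sub, eval₂_pow, eval₂_X, eval₂_C, mul_pow, h, ← map_pow, ← C_pow, hζ]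
    simp)

/-- The morphism `(y, t) ↦ (ζ y, t)` of the affine curve. -/
def affineRot {R : Type} [CommRing R] {m : ℕ} (n : ℕ) {ζ : R} (hζ : ζ ^ m = 1) :
    affineCurve R m n ⟶ affineCurve R m n :=
  Over.homMk (Spec.map (CommRingCat.ofHom (coordRingRot n hζ))) (by
    change Spec.map _ ≫ Spec.map _ = Spec.map _
    rw [← Spec.map_comp, ← CommRingCat.ofHom_comp]
    congr 2
    ext a
    simp [coordRingRot])

/-- The map `(y, t) ↦ t` from the affine curve to the projective line. -/
def affineToProjLine (R : Type) [CommRing R] (m n : ℕ) :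
    Spec (.of (CoordRing R m n)) ⟶ projLine R :=
  Spec.map (CommRingCat.ofHom (AdjoinRoot.of (X ^ m - C (X ^ n + 1) : R[X][X]))) ≫ chartZero R

lemma affineToProjLine_str (R : Type) [CommRing R] (m n : ℕ) :
    affineToProjLine R m n ≫ projLineStr R = (affineCurve R m n).hom := by
  rw [affineToProjLine, Category.assoc, projLineStr, chartZero_desc, ← Spec.map_comp,
    ← CommRingCat.ofHom_comp]
  rfl

variable (R : Type) [CommRing R] [IsNoetherianRing R] (m n : ℕ)

instance : IsNoetherianRing (CoordRing R m n) :=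
  inferInstanceAs (IsNoetherianRing (R[X][X] ⧸ _))

instance : QuasiCompact (affineToProjLine R m n) := by
  have : IsNoetherian (Spec (.of (CoordRing R m n))) := inferInstance
  infer_instance

/-- The complete curve over `R`: the normalization of the projective line over `R` in the affine
curve `y ^ m = t ^ n + 1`. Over a normal domain in which `m n` is invertible this is the smooth
projective model of the affine curve. -/
def curve : Over (Spec (.of R)) :=
  Over.mk ((affineToProjLine R m n).fromNormalization ≫ projLineStr R)

/-- The map `π : (y, t) ↦ t` from the complete curve to the projective line. -/
def curveToProjLine : curve R m n ⟶ projLineOver R :=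
  Over.homMk (affineToProjLine R m n).fromNormalization rfl

/-- The inclusion of the affine curve into the complete curve. -/
def affineToCurve : affineCurve R m n ⟶ curve R m n :=
  Over.homMk (affineToProjLine R m n).toNormalization (by
    change (affineToProjLine R m n).toNormalization ≫
      ((affineToProjLine R m n).fromNormalization ≫ projLineStr R : _ ⟶ _) = _
    exact (Category.assoc _ _ _).symm.trans
      ((congrArg (· ≫ projLineStr R)
        (affineToProjLine R m n).toNormalization_fromNormalization).trans
        (affineToProjLine_str R m n)))

end Curve

section Divisors

variable {S S' : Scheme.{0}}

/-- The ideal sheaf on `X ×_S Y` of the graph of an `S`-morphism `X ⟶ Y`. -/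
def graphIdeal {X Y : Over S} (g : X ⟶ Y) : (pullback X.hom Y.hom).IdealSheafData :=
  (pullback.lift (𝟙 X.left) g.left (by simp) : X.left ⟶ pullback X.hom Y.hom).ker

/-- The projection `X_{S'} ×_{S'} Y_{S'} ⟶ X ×_S Y`, where `X_{S'}` and `Y_{S'}` are the
base changes of `X` and `Y` along `h : S' ⟶ S`. -/
def prodProj (h : S' ⟶ S) (X Y : Over S) :
    pullback ((Over.pullback h).obj X).hom ((Over.pullback h).obj Y).hom ⟶
      pullback X.hom Y.hom :=
  pullback.map _ _ _ _ (pullback.fst X.hom h) (pullback.fst Y.hom h) h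
    pullback.condition.symm pullback.condition.symm

/-- The morphism `id × g : X ×_S Y ⟶ X ×_S Z`. -/
def idProd (X : Over S) {Y Z : Over S} (g : Y ⟶ Z) :
    pullback X.hom Y.hom ⟶ pullback X.hom Z.hom :=
  pullback.map _ _ _ _ (𝟙 X.left) g.left (𝟙 S) (by simp) (by simp)

/-- The closed subscheme defined by the ideal sheaf `I` is an effective Cartier divisor. Under this
description, the sum of effective Cartier divisors is the product of their ideal sheaves. -/
def IsEffectiveCartier {X : Scheme.{0}} (I : X.IdealSheafData) : Prop :=
  ∀ x : X, ∃ U : X.affineOpens, x ∈ U.1 ∧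
    ∃ f ∈ nonZeroDivisors Γ(X, U.1), I.ideal U = Ideal.span {f}

end Divisors

section Frobenius

/-- The ring endomorphism `a ↦ a ^ p` of a commutative ring in which the prime `p` is zero. -/
def powRingHom (p : ℕ) [Fact p.Prime] (A : Type) [CommRing A] (h : (p : A) = 0) : A →+* A where
  toFun a := a ^ p
  map_one' := one_pow p
  map_mul' a b := mul_pow a b p
  map_zero' := zero_pow (Fact.out : p.Prime).ne_zero
  map_add' a b := by
    obtain ⟨r, hr⟩ := exists_add_pow_prime_eq (Fact.out : p.Prime) a b
    rw [hr, h]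
    ring

variable (p : ℕ) [Fact p.Prime]

lemma natCast_section_eq_zero (X : Over (Spec (.of (ZMod p)))) (U : X.left.Opens) :
    (p : Γ(X.left, U)) = 0 := by
  let g : ZMod p →+* Γ(X.left, U) := (X.left.presheaf.map (homOfLE le_top).op).hom.comp
    (X.hom.appTop.hom.comp (Scheme.ΓSpecIso (.of (ZMod p))).inv.hom)
  rw [← map_natCast g p, CharP.cast_eq_zero, map_zero]

/-- The Frobenius endomorphism of a scheme over `ZMod p`: the identity on the underlying space, and
`a ↦ a ^ p` on sections. -/
def frobeniusHom (X : Over (Spec (.of (ZMod p)))) : X.left ⟶ X.left where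
  base := 𝟙 _
  c :=
    { app := fun U => CommRingCat.ofHom
        (powRingHom p Γ(X.left, U.unop) (natCast_section_eq_zero p X U.unop))
      naturality := fun U V i => by
        ext a
        exact (map_pow (X.left.presheaf.map i).hom a p).symm }
  prop x := by
    refine ⟨fun a ha => ?_⟩
    obtain ⟨U, hxU, b, rfl⟩ := X.left.presheaf.exists_germ_eq a
    have h := PresheafedSpace.stalkMap_germ_apply (C := CommRingCat)
      (X := X.left.toPresheafedSpace) (Y := X.left.toPresheafedSpace)
      { base := 𝟙 _
        c :=
          { app := fun U => CommRingCat.ofHom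
              (powRingHom p Γ(X.left, U.unop) (natCast_section_eq_zero p X U.unop))
            naturality := fun U V i => by
              ext a
              exact (map_pow (X.left.presheaf.map i).hom a p).symm } } U x hxU b
    have h' : IsUnit ((X.left.presheaf.germ U x hxU).hom (b ^ p)) := by
      refine Eq.mp (congrArg IsUnit h) ha
    rw [map_pow] at h'
    exact (isUnit_pow_iff (Fact.out : p.Prime).ne_zero).mp h'

lemma frobeniusHom_app (X : Over (Spec (.of (ZMod p)))) (U : X.left.Opens) (a : Γ(X.left, U)) :
    (frobeniusHom p X).app U a = a ^ p := rfl

/-- The Frobenius endomorphism as a morphism over `ZMod p`. -/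
def frobenius (X : Over (Spec (.of (ZMod p)))) : X ⟶ X :=
  Over.homMk (frobeniusHom p X) (by
    apply ext_of_isAffine
    ext a
    obtain ⟨b, rfl⟩ : ∃ b, (Scheme.ΓSpecIso (.of (ZMod p))).inv.hom b = a :=
      ⟨(Scheme.ΓSpecIso (.of (ZMod p))).hom.hom a, by simp⟩
    change (X.hom.appTop.hom ((Scheme.ΓSpecIso (.of (ZMod p))).inv.hom b)) ^ p = _
    rw [← map_pow, ← map_pow, ZMod.pow_card])

end Frobenius

section Setting

variable (p : ℕ) [Fact p.Prime]

instance isPrime_span : (Ideal.span {(p : ℤ)}).IsPrime :=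
  (Ideal.span_singleton_prime (by exact_mod_cast (Fact.out : p.Prime).ne_zero)).mpr
    (Nat.prime_iff_prime_int.mp Fact.out)

/-- The localization of `ℤ` at the prime ideal `(p)`. -/
abbrev ZLoc : Type := Localization.AtPrime (Ideal.span {(p : ℤ)})

instance : IsNoetherianRing (ZLoc p) :=
  IsLocalization.isNoetherianRing (Ideal.span {(p : ℤ)}).primeCompl _ inferInstance

/-- The reduction map from the localization of `ℤ` at `(p)` to `ZMod p`. -/
def reduction : ZLoc p →+* ZMod p :=
  IsLocalization.lift (M := (Ideal.span {(p : ℤ)}).primeCompl) (g := Int.castRingHom (ZMod p))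
    (fun y => by
      rw [isUnit_iff_ne_zero, eq_intCast, Ne, ZMod.intCast_zmod_eq_zero_iff_dvd]
      exact fun h => y.2 (Ideal.mem_span_singleton.mpr h))

/-- The inclusion of the closed point into the spectrum of the localization of `ℤ` at `(p)`. -/
def closedPt : Spec (.of (ZMod p)) ⟶ Spec (.of (ZLoc p)) :=
  Spec.map (CommRingCat.ofHom (reduction p))

/-- The morphism `Spec κ ⟶ Spec (ZMod p)` for an extension `κ` of `ZMod p`. -/
def fieldExt (κ : Type) [Field κ] [Algebra (ZMod p) κ] :
    Spec (.of κ) ⟶ Spec (.of (ZMod p)) :=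
  Spec.map (CommRingCat.ofHom (algebraMap (ZMod p) κ))

variable (m n : ℕ)

/-- The special fibre `C_p` of the curve. -/
def specialFiber : Over (Spec (.of (ZMod p))) :=
  (Over.pullback (closedPt p)).obj (curve (ZLoc p) m n)

/-- The divisor `𝒟 = (id × π)^* Γ_{F ∘ π}` on the self-product of the curve, as an ideal sheaf. -/
def modelDivisor :
    (pullback (curve (ZLoc p) m n).hom (curve (ZLoc p) m n).hom).IdealSheafData :=
  (graphIdeal (curveToProjLine (ZLoc p) m n ≫ powMap (ZLoc p) p)).comap
    (idProd (curve (ZLoc p) m n) (curveToProjLine (ZLoc p) m n))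

/-- The special fibre `D_p` of `𝒟`, on `C_p × C_p`. -/
def specialDivisor :
    (pullback (specialFiber p m n).hom (specialFiber p m n).hom).IdealSheafData :=
  (modelDivisor p m n).comap (prodProj (closedPt p) (curve (ZLoc p) m n) (curve (ZLoc p) m n))

variable (κ : Type) [Field κ] [Algebra (ZMod p) κ]

/-- The curve `C_p ⊗ κ`. -/
def geomFiber : Over (Spec (.of κ)) :=
  (Over.pullback (fieldExt p κ)).obj (specialFiber p m n)

/-- The divisor `D_p ⊗ κ` on `(C_p ⊗ κ) × (C_p ⊗ κ)`. -/
def geomDivisor :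
    (pullback (geomFiber p m n κ).hom (geomFiber p m n κ).hom).IdealSheafData :=
  (specialDivisor p m n).comap (prodProj (fieldExt p κ) (specialFiber p m n) (specialFiber p m n))

/-- The Frobenius endomorphism `φ` of `C_p`, base changed to `κ`. -/
def geomFrobenius : geomFiber p m n κ ⟶ geomFiber p m n κ :=
  (Over.pullback (fieldExt p κ)).map (frobenius p (specialFiber p m n))

/-- The inclusion of the affine curve `y ^ m = t ^ n + 1` over `κ` into `C_p ⊗ κ`. -/
def affineToGeomFiber : affineCurve κ m n ⟶ geomFiber p m n κ :=
  Over.homMk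
    (pullback.lift
      (pullback.lift
        (affineBaseChange ((algebraMap (ZMod p) κ).comp (reduction p)) m n ≫
          (affineToCurve (ZLoc p) m n).left)
        ((affineCurve κ m n).hom ≫ fieldExt p κ) (by
          rw [Category.assoc, Over.w, affineBaseChange_hom, CommRingCat.ofHom_comp, Spec.map_comp,
            Category.assoc]
          rfl))
      (affineCurve κ m n).hom (pullback.lift_snd _ _ _)) (pullback.lift_snd _ _ _)

variable {κ}

/-- The automorphism `σ` of `C_p ⊗ κ` is the one given by `(y, t) ↦ (ζ y, t)` on the affine curve.
There is exactly one such `σ`, since the affine curve is dense. -/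
def IsRotation {ζ : κ} (hζ : ζ ^ m = 1) (σ : Aut (geomFiber p m n κ)) : Prop :=
  affineToGeomFiber p m n κ ≫ σ.hom = affineRot n hζ ≫ affineToGeomFiber p m n κ

end Setting

end SuperellipticFrobenius

namespace SuperellipticFrobenius

/-! Choose `a`, `b` with `m * b = n * a + 1`. Near `t = ∞` put `z = t⁻¹` and `x = y ^ a * z ^ b`;
then `x ^ m = z * (z ^ n + 1) ^ a`. The curve is thus covered by two charts of one shape, `x ^ m =
h(z)` with `g(z)` inverted, where `h`, `g` are integer polynomials: `h = z ^ n + 1`, `g = 1` at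
finite distance, and `h = z * (z ^ n + 1) ^ a`, `g = z ^ n + 1` at infinity (`exists_curveAtlas`).
That the second chart belongs to the normalization rests on its ring being integrally closed in its
localization at `x`, because `x` is a nonzerodivisor with reduced quotient. Rings of this shape
commute with base change, so the same charts cover `C_p` and `C_p ⊗ κ`.

A point of the product lies on the divisor when `F ∘ π` of its first component is `π` of the second.
On the product of a chart with itself this is the equation `d = 0` with `d = z₂ - z₁ ^ p`. The graph
of `ξ ^ j ∘ φ` is cut out by `d` and `f_j = x₂ - η ^ j * x₁ ^ p`, where `η` is `ξ` on the finite
chart and `ξ ^ a` at infinity, again primitive since `a` is prime to `m`. In characteristic `p`, `∏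
f_j = x₂ ^ m - x₁ ^ (p * m) = h(z₂) - h(z₁ ^ p) = d * u`, with `u ≡ h'(z₁ ^ p)` modulo `d`. Look
near a prime containing `d`. If `u` is invertible there, each `f_j` divides `d`, the graph ideals
are the `(f_j)`, and their product is `(d)`. If not, exactly one `f_j` is a nonunit: two of them
would force `x₁`, hence `h(z₁ ^ p)`, to vanish together with `h'(z₁ ^ p)`, whereas `h` has only
simple zeros where `g ≠ 0`. Then `d` divides that `f_j`, one graph ideal is `(d)` and the others are
trivial (`exists_away_principal`, `exists_away_graph`). The two products of a chart with itself
suffice, since `F` maps infinity, and nothing else, to infinity.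

For the last claim, the affine curve is irreducible by Eisenstein and dense in `C_p`, so the graph
of `φ` is irreducible. Where the cofactor of `x₂ - x₁ ^ p` in `x₂ ^ m - x₁ ^ (p * m)` does not
vanish, the divisor is contained in the graph. This open set meets the graph above `(t, y) = (0,
1)`, where the cofactor is `m ≠ 0`. No root of unity enters, so the argument runs over the prime
field. -/

/-- The value at `a` of a polynomial with integer coefficients. -/
def intEval {A : Type} [CommRing A] (q : ℤ[X]) (a : A) : A := q.eval₂ (Int.castRingHom A) a

/-- The equations of the charts have integer coefficients precisely for this: they are respected by
every ring map, in particular by base change and by the Frobenius. -/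
lemma map_intEval {A B : Type} [CommRing A] [CommRing B] (φ : A →+* B) (q : ℤ[X]) (a : A) :
    φ (intEval q a) = intEval q (φ a) := by
  rw [intEval, hom_eval₂, intEval]
  congr 1
  exact RingHom.ext_int _ _

lemma eval₂_map_int {S A : Type} [CommRing S] [CommRing A] (φ : S →+* A) (a : A) (q : ℤ[X]) :
    eval₂ φ a (q.map (Int.castRingHom S)) = intEval q a := by
  rw [eval₂_map, intEval]
  congr 1
  exact RingHom.ext_int _ _

/-! ### Rings of the curves `x ^ m = h(z)` with `g(z)` inverted -/

section ChartRing

variable (S : Type) [CommRing S] (m : ℕ) (h g : ℤ[X])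

/-- The ring `S[z][x] / (x ^ m - h(z))`. -/
abbrev PlaneRing : Type :=
  AdjoinRoot (X ^ m - C (h.map (Int.castRingHom S)) : S[X][X])

/-- The element `g(z)` of `S[z][x] / (x ^ m - h(z))`. -/
def planeElem : PlaneRing S m h :=
  AdjoinRoot.of (X ^ m - C (h.map (Int.castRingHom S)) : S[X][X]) (g.map (Int.castRingHom S))

/-- The ring `S[z][x] / (x ^ m - h(z))`, localized at `g(z)`. -/
def ChartRing : Type := Localization.Away (planeElem S m h g)

namespace ChartRing

instance : CommRing (ChartRing S m h g) :=
  inferInstanceAs (CommRing (Localization.Away (planeElem S m h g)))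

/-- The localization map from the plane curve ring. -/
def ofPlane : PlaneRing S m h →+* ChartRing S m h g :=
  algebraMap (PlaneRing S m h) (Localization.Away (planeElem S m h g))

/-- The map from the coefficient polynomial ring. -/
def ofPoly : S[X] →+* ChartRing S m h g := (ofPlane S m h g).comp (AdjoinRoot.of _)

/-- The structure map. -/
def base : S →+* ChartRing S m h g := (ofPoly S m h g).comp C

/-- The coordinate `z`. -/
def z : ChartRing S m h g := ofPoly S m h g X

/-- The coordinate `x`. -/
def x : ChartRing S m h g := ofPlane S m h g (AdjoinRoot.root _)

lemma ofPoly_map (q : ℤ[X]) :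
    ofPoly S m h g (q.map (Int.castRingHom S)) = intEval q (z S m h g) := by
  rw [← eval₂_C_X (p := q.map (Int.castRingHom S)), eval₂_map_int, map_intEval, z]

lemma isUnit_g : IsUnit (intEval g (z S m h g)) := by
  rw [← ofPoly_map]
  exact IsLocalization.Away.algebraMap_isUnit (S := Localization.Away (planeElem S m h g))
    (planeElem S m h g)

lemma x_pow : x S m h g ^ m = intEval h (z S m h g) := by
  have := AdjoinRoot.eval₂_root (X ^ m - C (h.map (Int.castRingHom S)) : S[X][X])
  rw [eval₂_sub, eval₂_pow, eval₂_X, eval₂_C, sub_eq_zero] at this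
  rw [← ofPoly_map, x, ← map_pow, this]
  rfl

variable {S m h g}

section lift

variable {A : Type} [CommRing A] (φ : S →+* A) (a b : A) (hu : IsUnit (intEval g a))
    (hr : b ^ m = intEval h a)

/-- The universal property of the plane curve ring. -/
def planeLift : PlaneRing S m h →+* A :=
  AdjoinRoot.lift (eval₂RingHom φ a) b (by
    rw [eval₂_sub, eval₂_pow, eval₂_X, eval₂_C, coe_eval₂RingHom, eval₂_map_int, hr, sub_self])

lemma isUnit_planeLift (hu : IsUnit (intEval g a)) (hr : b ^ m = intEval h a) :
    IsUnit (planeLift φ a b hr (planeElem S m h g)) := by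
  rwa [planeElem, planeLift, AdjoinRoot.lift_of, coe_eval₂RingHom, eval₂_map_int]

/-- The universal property of the chart ring. -/
def lift : ChartRing S m h g →+* A :=
  IsLocalization.Away.lift (S := Localization.Away (planeElem S m h g)) (planeElem S m h g)
    (isUnit_planeLift φ a b hu hr)

lemma lift_ofPlane (q : PlaneRing S m h) :
    lift φ a b hu hr (ofPlane S m h g q) = planeLift φ a b hr q :=
  IsLocalization.Away.lift_eq (S := Localization.Away (planeElem S m h g)) (planeElem S m h g) _ q

@[simp]
lemma lift_base (s : S) : lift φ a b hu hr (base S m h g s) = φ s := by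
  rw [base, ofPoly, RingHom.comp_apply, RingHom.comp_apply, lift_ofPlane, planeLift,
    AdjoinRoot.lift_of]
  simp

@[simp]
lemma lift_z : lift φ a b hu hr (z S m h g) = a := by
  rw [z, ofPoly, RingHom.comp_apply, lift_ofPlane, planeLift, AdjoinRoot.lift_of]
  simp

@[simp]
lemma lift_x : lift φ a b hu hr (x S m h g) = b := by
  rw [x, lift_ofPlane, planeLift, AdjoinRoot.lift_root]

@[simp]
lemma lift_comp_base : (lift φ a b hu hr).comp (base S m h g) = φ :=
  RingHom.ext (lift_base φ a b hu hr)

end lift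

lemma hom_ext {A : Type} [CommRing A] {φ ψ : ChartRing S m h g →+* A}
    (hb : φ.comp (base S m h g) = ψ.comp (base S m h g))
    (hz : φ (z S m h g) = ψ (z S m h g)) (hx : φ (x S m h g) = ψ (x S m h g)) : φ = ψ := by
  refine IsLocalization.ringHom_ext (S := Localization.Away (planeElem S m h g)) (Submonoid.powers
    (planeElem S m h g)) ?_
  refine Ideal.Quotient.ringHom_ext (Polynomial.ringHom_ext' (Polynomial.ringHom_ext' hb hz) hx)

section map

variable {S' : Type} [CommRing S'] (ψ : S →+* S')

/-- Functoriality of the chart ring in the base. -/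
def map (m : ℕ) (h g : ℤ[X]) : ChartRing S m h g →+* ChartRing S' m h g :=
  lift ((base S' m h g).comp ψ) (z S' m h g) (x S' m h g) (isUnit_g S' m h g)
    (x_pow S' m h g)

@[simp] lemma map_base (s : S) : map ψ m h g (base S m h g s) = base S' m h g (ψ s) :=
  lift_base ..

@[simp] lemma map_z : map ψ m h g (z S m h g) = z S' m h g := lift_z ..

@[simp] lemma map_x : map ψ m h g (x S m h g) = x S' m h g := lift_x ..

lemma map_comp_base : (map ψ m h g).comp (base S m h g) = (base S' m h g).comp ψ :=
  lift_comp_base ..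

/-- Both sides have the same universal property. The case of an arbitrary `ψ` gives the charts of a
base change; the case where `ψ` is the structure map of a chart gives products of charts. -/
lemma isPushout_map :
    IsPushout (CommRingCat.ofHom (base S m h g)) (CommRingCat.ofHom ψ)
      (CommRingCat.ofHom (map ψ m h g)) (CommRingCat.ofHom (base S' m h g)) where
  w := by
    rw [← CommRingCat.ofHom_comp, ← CommRingCat.ofHom_comp, map_comp_base]
  isColimit' := ⟨PushoutCocone.IsColimit.mk _
    (fun s => CommRingCat.ofHom (lift s.inr.hom (s.inl.hom (z S m h g)) (s.inl.hom (x S m h g))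
      (by rw [← map_intEval]; exact (isUnit_g S m h g).map _)
      (by rw [← map_pow, x_pow, map_intEval])))
    (fun s => by
      ext1
      refine hom_ext ?_ (by simp) (by simp)
      have := congrArg CommRingCat.Hom.hom s.condition
      simp only [CommRingCat.hom_comp, CommRingCat.hom_ofHom] at this ⊢
      rw [this, RingHom.comp_assoc, map_comp_base, ← RingHom.comp_assoc, lift_comp_base])
    (fun s => by
      ext1
      simp)
    (fun s f h₁ h₂ => by
      ext1
      refine hom_ext ?_ ?_ ?_
      · rw [← h₂]; simp
      · rw [← h₁]; simp
      · rw [← h₁]; simp)⟩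

end map

instance : Algebra (PlaneRing S m h) (ChartRing S m h g) :=
  inferInstanceAs (Algebra _ (Localization.Away (planeElem S m h g)))

instance : IsLocalization.Away (planeElem S m h g) (ChartRing S m h g) :=
  inferInstanceAs (IsLocalization.Away _ (Localization.Away (planeElem S m h g)))

instance : Algebra S[X] (ChartRing S m h g) := (ofPoly S m h g).toAlgebra

instance : IsScalarTower S[X] (PlaneRing S m h) (ChartRing S m h g) := .of_algebraMap_eq' rfl

lemma monic_relation (hm : m ≠ 0) : (X ^ m - C (h.map (Int.castRingHom S)) : S[X][X]).Monic :=
  monic_X_pow_sub_C _ hm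

/-- The relation is monic in `x`, so the plane ring is free over `S[z]`, and a localization of it is
flat. -/
lemma flat_poly (hm : m ≠ 0) : Module.Flat S[X] (ChartRing S m h g) := by
  have : Module.Free S[X] (PlaneRing S m h) := (monic_relation hm).free_adjoinRoot
  have : Module.Flat (PlaneRing S m h) (ChartRing S m h g) := IsLocalization.flat _
    (Submonoid.powers (planeElem S m h g))
  exact Module.Flat.trans S[X] (PlaneRing S m h) _

lemma ofPoly_mem_nonZeroDivisors (hm : m ≠ 0) {q : S[X]} (hq : q ∈ nonZeroDivisors S[X]) :
    ofPoly S m h g q ∈ nonZeroDivisors (ChartRing S m h g) := by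
  have := flat_poly (S := S) (h := h) (g := g) hm
  rw [mem_nonZeroDivisors_iff_right] at hq
  have h1 : IsSMulRegular S[X] q := fun a b hab => by
    have : (a - b) * q = 0 := by
      simp only [smul_eq_mul] at hab
      linear_combination hab
    exact sub_eq_zero.mp (hq _ this)
  have h2 : IsSMulRegular (ChartRing S m h g) q := h1.of_flat
  rw [mem_nonZeroDivisors_iff_right]
  intro y hy
  refine h2 ?_
  change ofPoly S m h g q * y = ofPoly S m h g q * 0
  rw [mul_comm, hy, mul_zero]

/-- With a chart ring in the role of `S` and `c = z ^ p`, the element is the local equation `z₂ - z₁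
^ p` of the divisor. -/
lemma z_sub_base_mem_nonZeroDivisors (hm : m ≠ 0) (c : S) :
    z S m h g - base S m h g c ∈ nonZeroDivisors (ChartRing S m h g) := by
  have := ofPoly_mem_nonZeroDivisors (h := h) (g := g) hm
    (monic_X_sub_C c).mem_nonZeroDivisors
  rwa [map_sub] at this

end ChartRing

end ChartRing

/-! ### Ideal sheaves tested on ring-valued points -/

section IdealSheaf

variable {X Y : Scheme.{0}}

/-- The affine open subset which is the image of an affine open chart. -/
def chartOpen {B : CommRingCat.{0}} (f : Spec B ⟶ X) [IsOpenImmersion f] : X.affineOpens :=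
  ⟨f ''ᵁ ⊤, (isAffineOpen_top (Spec B)).image_of_isOpenImmersion f⟩

/-- The sections over the image of an affine open chart. -/
def chartIso {B : CommRingCat.{0}} (f : Spec B ⟶ X) [IsOpenImmersion f] :
    B ≅ Γ(X, (chartOpen f).1) :=
  (Scheme.ΓSpecIso B).symm ≪≫ (f.appIso ⊤).symm

lemma ker_SpecMap_le_iff {B C : CommRingCat.{0}} (φ : B ⟶ C) (K : (Spec B).IdealSheafData) :
    K ≤ (Spec.map φ).ker ↔
      (K.ideal ⟨⊤, isAffineOpen_top (Spec B)⟩).comap (Scheme.ΓSpecIso B).inv.hom ≤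
        RingHom.ker φ.hom := by
  have h1 : K ≤ (Spec.map φ).ker ↔ K.ideal ⟨⊤, isAffineOpen_top (Spec B)⟩ ≤
      (Spec.map φ).ker.ideal ⟨⊤, isAffineOpen_top (Spec B)⟩ :=
    ⟨fun h => h _, fun h => Scheme.IdealSheafData.le_of_isAffine h⟩
  rw [h1, Scheme.Hom.ker_apply]
  have h2 : ∀ b : B, (Spec.map φ).app ⊤ ((Scheme.ΓSpecIso B).inv b) =
      (Scheme.ΓSpecIso C).inv (φ b) := fun b =>
    (congr($(Scheme.ΓSpecIso_inv_naturality φ) b)).symm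
  have h3 : ∀ c : C, (Scheme.ΓSpecIso C).inv c = 0 ↔ c = 0 := fun c =>
    map_eq_zero_iff _ (ConcreteCategory.bijective_of_isIso (Scheme.ΓSpecIso C).inv).1
  constructor
  · intro h b hb
    have := h hb
    rw [RingHom.mem_ker] at this ⊢
    exact (h3 _).mp ((h2 b).symm.trans this)
  · intro h s hs
    obtain ⟨b, rfl⟩ := (ConcreteCategory.bijective_of_isIso (Scheme.ΓSpecIso B).inv).2 s
    have := h (show b ∈ _ from hs)
    rw [RingHom.mem_ker] at this ⊢
    exact (h2 b).trans ((h3 _).mpr this)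

lemma le_ker_comp_iff {T : Scheme.{0}} (f : T ⟶ X) (g : X ⟶ Y) (I : Y.IdealSheafData) :
    I ≤ (f ≫ g).ker ↔ I.comap g ≤ f.ker := by
  rw [Scheme.Hom.ker_comp, Scheme.IdealSheafData.le_map_iff_comap_le]

/-- An ideal `J` of `B` describes the ideal sheaf `I` on the chart `f` when it has the same
vanishing condition on points with values in rings. -/
def IsChartIdeal {B : CommRingCat.{0}} (f : Spec B ⟶ X) (I : X.IdealSheafData) (J : Ideal B) :
    Prop :=
  ∀ (C : CommRingCat.{0}) (φ : B ⟶ C), I ≤ (Spec.map φ ≫ f).ker ↔ J ≤ RingHom.ker φ.hom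

/-- An ideal is determined by the ring maps that kill it: testing the vanishing condition on the two
quotient maps `B → B ⧸ K` and `B → B ⧸ J` gives the two inclusions. -/
lemma IsChartIdeal.ideal_eq {B : CommRingCat.{0}} {f : Spec B ⟶ X} [IsOpenImmersion f]
    {I : X.IdealSheafData} {J : Ideal B} (hJ : IsChartIdeal f I J) :
    I.ideal (chartOpen f) = J.map (chartIso f).hom.hom := by
  set K : Ideal B := (I.ideal (chartOpen f)).comap (chartIso f).hom.hom with hK
  have key : ∀ (C : CommRingCat.{0}) (φ : B ⟶ C),
      I ≤ (Spec.map φ ≫ f).ker ↔ K ≤ RingHom.ker φ.hom := by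
    intro C φ
    rw [le_ker_comp_iff, ker_SpecMap_le_iff, Scheme.IdealSheafData.ideal_comap_of_isOpenImmersion]
    rfl
  have hJK : J = K := by
    apply le_antisymm
    · have := (hJ (.of (B ⧸ K)) (CommRingCat.ofHom (Ideal.Quotient.mk K))).mp
        ((key _ _).mpr (by simp))
      simpa using this
    · have := (key (.of (B ⧸ J)) (CommRingCat.ofHom (Ideal.Quotient.mk J))).mp
        ((hJ _ _).mpr (by simp))
      simpa using this
  rw [hJK, hK, Ideal.map_comap_of_surjective]
  exact (ConcreteCategory.bijective_of_isIso (chartIso f).hom).2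

lemma IsChartIdeal.localize {B B' : CommRingCat.{0}} {f : Spec B ⟶ X}
    {I : X.IdealSheafData} {J : Ideal B} (hJ : IsChartIdeal f I J) (ψ : B ⟶ B') :
    IsChartIdeal (Spec.map ψ ≫ f) I (J.map ψ.hom) := by
  intro C φ
  rw [← Category.assoc, ← Spec.map_comp, hJ, Ideal.map_le_iff_le_comap, RingHom.comap_ker]
  rfl

lemma le_ker_of_comp_subschemeι {T : Scheme.{0}} (I : X.IdealSheafData) (g : T ⟶ I.subscheme) :
    I ≤ (g ≫ I.subschemeι).ker := by
  conv_lhs => rw [← I.ker_subschemeι]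
  exact Scheme.Hom.le_ker_comp _ _

/-- A point of the support lifts to the closed subscheme, and its residue field there supplies a
test map through `y`. Conversely, `B ⧸ y.asIdeal` is a test ring whose zero ideal maps to `y`. -/
lemma IsChartIdeal.mem_support_iff {B : CommRingCat.{0}} {f : Spec B ⟶ X}
    {I : X.IdealSheafData} {J : Ideal B} (hJ : IsChartIdeal f I J) (y : Spec B) :
    f y ∈ I.support ↔ J ≤ y.asIdeal := by
  constructor
  · intro hy
    have hy' : y ∈ (I.comap f).support := by
      rw [Scheme.IdealSheafData.support_comap]
      exact hy
    have hy'' : y ∈ Set.range (I.comap f).subschemeι := by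
      rw [Scheme.IdealSheafData.range_subschemeι]
      exact hy'
    obtain ⟨w, hw⟩ := hy''
    set q := (I.comap f).subscheme.fromSpecResidueField w ≫ (I.comap f).subschemeι with hq
    have h1 : I ≤ (Spec.map (Spec.preimage q) ≫ f).ker := by
      rw [Spec.map_preimage, le_ker_comp_iff]
      exact le_ker_of_comp_subschemeι _ _
    have h2 := (hJ _ _).mp h1
    let pt : Spec ((I.comap f).subscheme.residueField w) := IsLocalRing.closedPoint _
    have h3 : y = Spec.map (Spec.preimage q) pt := by
      rw [Spec.map_preimage, hq, Scheme.Hom.comp_apply,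
        Scheme.fromSpecResidueField_apply, hw]
    intro b hb
    rw [h3]
    change (Spec.preimage q).hom b ∈ pt.asIdeal
    rw [h2 hb]
    exact Ideal.zero_mem _
  · intro hy
    have h1 : I ≤ (Spec.map (CommRingCat.ofHom (Ideal.Quotient.mk y.asIdeal)) ≫ f).ker :=
      (hJ _ _).mpr (by simpa using hy)
    have : y.asIdeal.IsPrime := PrimeSpectrum.isPrime y
    let pt : Spec (.of (B ⧸ y.asIdeal)) :=
      (⟨⊥, Ideal.isPrime_bot⟩ : PrimeSpectrum (B ⧸ y.asIdeal))
    have h2 : Spec.map (CommRingCat.ofHom (Ideal.Quotient.mk y.asIdeal)) pt = y := by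
      apply PrimeSpectrum.ext
      change Ideal.comap (Ideal.Quotient.mk y.asIdeal) ⊥ = y.asIdeal
      rw [← RingHom.ker_eq_comap_bot, Ideal.mk_ker]
    have h3 := Scheme.IdealSheafData.support_antitone h1
      (Scheme.Hom.range_subset_ker_support _ ⟨pt, rfl⟩)
    rwa [Scheme.Hom.comp_apply, h2] at h3

end IdealSheaf

/-! ### Graphs of morphisms -/

section Graph

variable {S : Scheme.{0}}

/-- The graph morphism is a section of the first projection, which is separated, so it is a closed
immersion; containment of ideals then means factoring through the graph. -/
lemma graphIdeal_le_ker_iff {X Y : Over S} [IsSeparated Y.hom] (g : X ⟶ Y) {T : Scheme.{0}}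
    (f : T ⟶ pullback X.hom Y.hom) :
    graphIdeal g ≤ f.ker ↔
      f ≫ pullback.snd X.hom Y.hom = f ≫ pullback.fst X.hom Y.hom ≫ g.left := by
  let γ : X.left ⟶ pullback X.hom Y.hom := pullback.lift (𝟙 X.left) g.left (by simp)
  have hγ₁ : γ ≫ pullback.fst X.hom Y.hom = 𝟙 _ := pullback.lift_fst _ _ _
  have hγ₂ : γ ≫ pullback.snd X.hom Y.hom = g.left := pullback.lift_snd _ _ _
  have : IsClosedImmersion γ := by
    have : IsClosedImmersion (γ ≫ pullback.fst X.hom Y.hom) := by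
      rw [hγ₁]
      infer_instance
    exact .of_comp γ (pullback.fst X.hom Y.hom)
  constructor
  · intro h
    rw [← IsClosedImmersion.lift_fac γ f h]
    simp only [Category.assoc]
    rw [hγ₂, reassoc_of% hγ₁]
  · intro h
    have : f = (f ≫ pullback.fst X.hom Y.hom) ≫ γ := by
      apply pullback.hom_ext
      · rw [Category.assoc, hγ₁, Category.comp_id]
      · rw [Category.assoc, hγ₂, h, Category.assoc]
    rw [this]
    exact Scheme.Hom.le_ker_comp _ _

end Graph

/-! ### The two charts of the projective line -/

section ProjectiveLineCharts

variable (R : Type) [CommRing R]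

instance : IsOpenImmersion (chartZero R) :=
  inferInstanceAs (IsOpenImmersion (colimit.ι (span (Spec.map (CommRingCat.ofHom (toLaurentZero R)))
    (Spec.map (CommRingCat.ofHom (toLaurentInfty R)))) WalkingSpan.left))

instance : IsOpenImmersion (chartInfty R) :=
  inferInstanceAs (IsOpenImmersion (colimit.ι (span (Spec.map (CommRingCat.ofHom (toLaurentZero R)))
    (Spec.map (CommRingCat.ofHom (toLaurentInfty R)))) WalkingSpan.right))

lemma exists_chart_eq (y : projLine R) :
    (∃ q, chartZero R q = y) ∨ ∃ q, chartInfty R q = y := by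
  obtain ⟨i, q, rfl⟩ := Scheme.IsLocallyDirected.ι_jointly_surjective
    (span (Spec.map (CommRingCat.ofHom (toLaurentZero R)))
      (Spec.map (CommRingCat.ofHom (toLaurentInfty R)))) y
  match i, q with
  | .left, q => exact .inl ⟨q, rfl⟩
  | .right, q => exact .inr ⟨q, rfl⟩
  | .zero, q =>
    refine .inl ⟨Spec.map (CommRingCat.ofHom (toLaurentZero R)) q, ?_⟩
    rw [← colimit.w _ WalkingSpan.Hom.fst]
    rfl

lemma chartZero_eq_chartInfty_iff (q q' : Spec (.of R[X])) :
    chartZero R q = chartInfty R q' ↔ ∃ r, Spec.map (CommRingCat.ofHom (toLaurentZero R)) r = q ∧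
      Spec.map (CommRingCat.ofHom (toLaurentInfty R)) r = q' := by
  refine (Scheme.IsLocallyDirected.ι_eq_ι_iff (span (Spec.map (CommRingCat.ofHom (toLaurentZero R)))
      (Spec.map (CommRingCat.ofHom (toLaurentInfty R))))
      (i := WalkingSpan.left) (j := WalkingSpan.right)).trans ⟨?_, ?_⟩
  · rintro ⟨k, fi, fj, r, h⟩
    rcases k with _ | (_ | _)
    · obtain rfl : fi = WalkingSpan.Hom.fst := Subsingleton.elim _ _
      obtain rfl : fj = WalkingSpan.Hom.snd := Subsingleton.elim _ _
      exact ⟨r, h⟩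
    · exact nomatch (fj : WidePushoutShape.Hom _ _)
    · exact nomatch (fi : WidePushoutShape.Hom _ _)
  · rintro ⟨r, h⟩
    exact ⟨WalkingSpan.zero, WalkingSpan.Hom.fst, WalkingSpan.Hom.snd, r, h⟩

lemma isPullback_chart :
    IsPullback (Spec.map (CommRingCat.ofHom (toLaurentZero R)))
      (Spec.map (CommRingCat.ofHom (toLaurentInfty R))) (chartZero R) (chartInfty R) := by
  refine IsOpenImmersion.isPullback _ _ _ _ (chart_condition R).symm ?_
  ext q'
  constructor
  · rintro ⟨q, hq⟩
    obtain ⟨r, -, hr⟩ := (chartZero_eq_chartInfty_iff R q q').mp hq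
    exact ⟨r, hr⟩
  · rintro ⟨r, hr⟩
    exact ⟨_, (chartZero_eq_chartInfty_iff R _ q').mpr ⟨r, rfl, hr⟩⟩

lemma toLaurentZero_X_mul : toLaurentZero R X * toLaurentInfty R X = 1 := by
  have h₀ : toLaurentZero R X = LaurentPolynomial.T 1 := Polynomial.toLaurent_X
  have h₁ : toLaurentInfty R X = LaurentPolynomial.T (-1) := by
    rw [toLaurentInfty, RingHom.comp_apply, Polynomial.toLaurent_X]
    exact LaurentPolynomial.invert_T 1
  rw [h₀, h₁, ← LaurentPolynomial.T_add]
  exact LaurentPolynomial.T_zero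

variable {R} in
-- The overlap of the charts is the spectrum of the Laurent polynomials, so a point common to both
-- charts is a ring map sending `T` to a unit, whose inverse is the other coordinate.
lemma chart_overlap_iff {A : CommRingCat.{0}} (φ₀ φ₁ : R[X] →+* A) :
    Spec.map (CommRingCat.ofHom φ₀) ≫ chartZero R = Spec.map (CommRingCat.ofHom φ₁) ≫ chartInfty R ↔
      φ₀.comp C = φ₁.comp C ∧ φ₀ X * φ₁ X = 1 := by
  constructor
  · intro h
    obtain ⟨ψ, hψ⟩ := Spec.map_surjective ((isPullback_chart R).lift _ _ h)
    have h₀ := (isPullback_chart R).lift_fst _ _ h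
    have h₁ := (isPullback_chart R).lift_snd _ _ h
    rw [← hψ, ← Spec.map_comp] at h₀ h₁
    have h₀' : ψ.hom.comp (toLaurentZero R) = φ₀ :=
      congrArg CommRingCat.Hom.hom (Spec.map_injective h₀)
    have h₁' : ψ.hom.comp (toLaurentInfty R) = φ₁ :=
      congrArg CommRingCat.Hom.hom (Spec.map_injective h₁)
    subst h₀' h₁'
    constructor
    · ext a
      simp [toLaurentZero, toLaurentInfty]
    · rw [RingHom.comp_apply, RingHom.comp_apply, ← map_mul, toLaurentZero_X_mul, map_one]
  · rintro ⟨hC, hX⟩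
    let _ : Algebra R[X] R[T;T⁻¹] := (toLaurentZero R).toAlgebra
    have : IsLocalization.Away (X : R[X]) R[T;T⁻¹] := LaurentPolynomial.isLocalization
    let ψ : R[T;T⁻¹] →+* A := IsLocalization.Away.lift (X : R[X]) (g := φ₀) (.of_mul_eq_one _ hX)
    have h₀ : ψ.comp (toLaurentZero R) = φ₀ :=
      IsLocalization.Away.lift_comp (X : R[X]) (g := φ₀) (.of_mul_eq_one _ hX)
    have h₁ : ψ.comp (toLaurentInfty R) = φ₁ := by
      refine Polynomial.ringHom_ext' ?_ ?_
      · rw [← hC, ← h₀]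
        ext a
        simp [toLaurentZero, toLaurentInfty]
      · have h2 : ψ (toLaurentZero R X) * ψ (toLaurentInfty R X) = 1 := by
          rw [← map_mul, toLaurentZero_X_mul, map_one]
        have h3 : ψ (toLaurentZero R X) = φ₀ X := congr($h₀ X)
        rw [h3] at h2
        rw [RingHom.comp_apply]
        linear_combination φ₁ X * h2 - ψ (toLaurentInfty R X) * hX
    rw [← h₀, ← h₁, CommRingCat.ofHom_comp, CommRingCat.ofHom_comp, Spec.map_comp, Spec.map_comp,
      Category.assoc, Category.assoc, chart_condition]

lemma mem_range_toLaurentZero_iff (q : Spec (.of R[X])) :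
    (∃ r, Spec.map (CommRingCat.ofHom (toLaurentZero R)) r = q) ↔ X ∉ q.asIdeal := by
  let _ : Algebra R[X] R[T;T⁻¹] := (toLaurentZero R).toAlgebra
  have : IsLocalization.Away (X : R[X]) R[T;T⁻¹] := LaurentPolynomial.isLocalization
  have := PrimeSpectrum.localization_away_comap_range R[T;T⁻¹] (X : R[X])
  exact Set.ext_iff.mp this q

lemma mem_range_toLaurentInfty_iff (q : Spec (.of R[X])) :
    (∃ r, Spec.map (CommRingCat.ofHom (toLaurentInfty R)) r = q) ↔ X ∉ q.asIdeal := by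
  have h : ∀ r : Spec (.of R[T;T⁻¹]), Spec.map (CommRingCat.ofHom (toLaurentInfty R)) r =
      Spec.map (CommRingCat.ofHom (toLaurentZero R))
        (Spec.map (CommRingCat.ofHom
          ((LaurentPolynomial.invert (R := R) : R[T;T⁻¹] →+* R[T;T⁻¹]))) r) := by
    intro r
    rw [← Scheme.Hom.comp_apply, ← Spec.map_comp]
    rfl
  rw [← mem_range_toLaurentZero_iff]
  constructor
  · rintro ⟨r, rfl⟩
    exact ⟨_, (h r).symm⟩
  · rintro ⟨r, rfl⟩
    refine ⟨Spec.map (CommRingCat.ofHom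
      ((LaurentPolynomial.invert (R := R) : R[T;T⁻¹] →+* R[T;T⁻¹]))) r, ?_⟩
    rw [← Scheme.Hom.comp_apply, ← Spec.map_comp, ← CommRingCat.ofHom_comp]
    have : ((LaurentPolynomial.invert (R := R) : R[T;T⁻¹] →+* R[T;T⁻¹])).comp
        (toLaurentInfty R) = toLaurentZero R :=
      RingHom.ext fun a => LaurentPolynomial.invert.left_inv (Polynomial.toLaurent a)
    rw [this]

lemma chartInfty_mem_range_iff (q : Spec (.of R[X])) :
    chartInfty R q ∈ Set.range (chartZero R) ↔ X ∉ q.asIdeal := by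
  rw [← mem_range_toLaurentInfty_iff]
  constructor
  · rintro ⟨q', h⟩
    obtain ⟨r, -, hr⟩ := (chartZero_eq_chartInfty_iff R q' q).mp h
    exact ⟨r, hr⟩
  · rintro ⟨r, hr⟩
    exact ⟨_, (chartZero_eq_chartInfty_iff R _ q).mpr ⟨r, rfl, hr⟩⟩

lemma chartZero_powHom (p : ℕ) : chartZero R ≫ powHom R p =
    Spec.map (CommRingCat.ofHom (polyPow R p)) ≫ chartZero R :=
  chartZero_desc ..

lemma chartInfty_powHom (p : ℕ) : chartInfty R ≫ powHom R p =
    Spec.map (CommRingCat.ofHom (polyPow R p)) ≫ chartInfty R :=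
  chartInfty_desc ..

/-- Infinity is the zero locus of `s`, and a prime contains `s ^ p` exactly when it contains `s`.
This later confines the divisor to the products of a chart with itself. -/
lemma powHom_mem_range_chartZero_iff (p : ℕ) (hp : p ≠ 0) (y : projLine R) :
    powHom R p y ∈ Set.range (chartZero R) ↔ y ∈ Set.range (chartZero R) := by
  rcases exists_chart_eq R y with ⟨q, rfl⟩ | ⟨q, rfl⟩
  · rw [← Scheme.Hom.comp_apply, chartZero_powHom]
    exact iff_of_true ⟨_, rfl⟩ ⟨_, rfl⟩
  · rw [← Scheme.Hom.comp_apply, chartInfty_powHom, Scheme.Hom.comp_apply,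
      chartInfty_mem_range_iff, chartInfty_mem_range_iff, not_iff_not]
    change polyPow R p X ∈ q.asIdeal ↔ _
    have : q.asIdeal.IsPrime := PrimeSpectrum.isPrime q
    rw [polyPow, coe_eval₂RingHom, eval₂_X]
    exact Ideal.IsPrime.pow_mem_iff_mem this p (Nat.pos_of_ne_zero hp)

/-- The two standard charts of the projective line. -/
def lineChart : Bool → (Spec (.of R[X]) ⟶ projLine R)
  | false => chartZero R
  | true => chartInfty R

instance (k : Bool) : IsOpenImmersion (lineChart R k) := by
  cases k <;> dsimp only [lineChart] <;> infer_instance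

lemma lineChart_powHom (p : ℕ) (k : Bool) : lineChart R k ≫ powHom R p =
    Spec.map (CommRingCat.ofHom (polyPow R p)) ≫ lineChart R k := by
  cases k
  exacts [chartZero_powHom R p, chartInfty_powHom R p]

lemma lineChart_str (k : Bool) :
    lineChart R k ≫ projLineStr R = Spec.map (CommRingCat.ofHom C) := by
  cases k
  exacts [chartZero_desc .., chartInfty_desc ..]

/-- The standard affine cover of the projective line. -/
def lineCover : (projLine R).OpenCover :=
  Scheme.Cover.mkOfCovers Bool (fun _ => Spec (.of R[X])) (lineChart R) (fun y => by
    rcases exists_chart_eq R y with ⟨q, h⟩ | ⟨q, h⟩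
    exacts [⟨false, q, h⟩, ⟨true, q, h⟩])

end ProjectiveLineCharts

/-! ### Separatedness of the projective line -/

lemma isClosedImmersion_lift_Spec {A B L : CommRingCat.{0}} {Z : Scheme.{0}} [IsAffine Z]
    (α : A ⟶ L) (β : B ⟶ L) (f : Spec A ⟶ Z) (g : Spec B ⟶ Z)
    (w : Spec.map α ≫ f = Spec.map β ≫ g)
    (h : ∀ s : Subring L, α.hom.range ≤ s → β.hom.range ≤ s → s = ⊤) :
    IsClosedImmersion (pullback.lift (Spec.map α) (Spec.map β) w) := by
  apply IsClosedImmersion.of_surjective_of_isAffine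
  set l := pullback.lift (Spec.map α) (Spec.map β) w
  let e := (l.appTop ≫ (Scheme.ΓSpecIso L).hom).hom
  have he : e.range = ⊤ := by
    apply h
    · rintro _ ⟨a, rfl⟩
      refine ⟨(pullback.fst f g).appTop ((Scheme.ΓSpecIso A).inv a), ?_⟩
      have : (pullback.fst f g).appTop ≫ l.appTop = (Spec.map α).appTop := by
        rw [← Scheme.Hom.comp_appTop, pullback.lift_fst]
      have h2 : (Scheme.ΓSpecIso A).inv ≫ (pullback.fst f g).appTop ≫ l.appTop ≫
          (Scheme.ΓSpecIso L).hom = α := by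
        rw [reassoc_of% this, Scheme.ΓSpecIso_naturality, Iso.inv_hom_id_assoc]
      exact congr($h2 a)
    · rintro _ ⟨a, rfl⟩
      refine ⟨(pullback.snd f g).appTop ((Scheme.ΓSpecIso B).inv a), ?_⟩
      have : (pullback.snd f g).appTop ≫ l.appTop = (Spec.map β).appTop := by
        rw [← Scheme.Hom.comp_appTop, pullback.lift_snd]
      have h2 : (Scheme.ΓSpecIso B).inv ≫ (pullback.snd f g).appTop ≫ l.appTop ≫
          (Scheme.ΓSpecIso L).hom = β := by
        rw [reassoc_of% this, Scheme.ΓSpecIso_naturality, Iso.inv_hom_id_assoc]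
      exact congr($h2 a)
  intro y
  obtain ⟨x, hx⟩ := RingHom.range_eq_top.mp he ((Scheme.ΓSpecIso L).hom y)
  exact ⟨x, (ConcreteCategory.bijective_of_isIso (Scheme.ΓSpecIso L).hom).1 hx⟩

lemma range_chart_inter (R : Type) [CommRing R] :
    Set.range (chartZero R) ∩ Set.range (chartInfty R) =
      Set.range (Spec.map (CommRingCat.ofHom (toLaurentZero R)) ≫ chartZero R) := by
  ext y
  constructor
  · rintro ⟨⟨q, rfl⟩, q', h⟩
    obtain ⟨r, hr, -⟩ := (chartZero_eq_chartInfty_iff R q q').mp h.symm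
    exact ⟨r, by rw [Scheme.Hom.comp_apply, hr]⟩
  · rintro ⟨r, rfl⟩
    exact ⟨⟨_, (Scheme.Hom.comp_apply ..).symm⟩, ⟨_, by rw [chart_condition, Scheme.Hom.comp_apply]⟩⟩

/-- Over a product of two open charts the diagonal becomes the intersection of the charts mapping to
their product; `L` is that intersection, by `hr`. -/
lemma isClosedImmersion_pullback_diagonal {P S A B L : Scheme.{0}} {str : P ⟶ S} (i : A ⟶ P)
    (j : B ⟶ P) [IsOpenImmersion i] [IsOpenImmersion j] (α : L ⟶ A) (β : L ⟶ B)
    [IsOpenImmersion α] (w : α ≫ i = β ≫ j)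
    (hr : Set.range i ∩ Set.range j ⊆ Set.range (α ≫ i))
    (l : L ⟶ pullback (i ≫ str) (j ≫ str)) [IsClosedImmersion l]
    (hl₁ : l ≫ pullback.fst _ _ = α) (hl₂ : l ≫ pullback.snd _ _ = β) :
    IsClosedImmersion (pullback.snd (pullback.diagonal str)
      (pullback.map (i ≫ str) (j ≫ str) str str i j (𝟙 S) (by simp) (by simp))) := by
  have hm₁ : pullback.map (i ≫ str) (j ≫ str) str str i j (𝟙 S) (by simp) (by simp) ≫
      pullback.fst _ _ = pullback.fst _ _ ≫ i := pullback.lift_fst _ _ _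
  have hm₂ : pullback.map (i ≫ str) (j ≫ str) str str i j (𝟙 S) (by simp) (by simp) ≫
      pullback.snd _ _ = pullback.snd _ _ ≫ j := pullback.lift_snd _ _ _
  have H : IsPullback (α ≫ i) l (pullback.diagonal str)
      (pullback.map (i ≫ str) (j ≫ str) str str i j (𝟙 S) (by simp) (by simp)) := by
    refine (IsOpenImmersion.isPullback _ _ _ _ ?_ ?_).flip
    · apply pullback.hom_ext
      · simp [hm₁, reassoc_of% hl₁]
      · simp [hm₂, reassoc_of% hl₂, w]
    · apply le_antisymm
      · intro y hy
        apply hr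
        have : pullback.diagonal str y ∈ Set.range (pullback.map (i ≫ str) (j ≫ str) str str i j
          (𝟙 S) (by simp) (by simp)) := hy
        rw [Scheme.Pullback.range_map] at this
        refine ⟨?_, ?_⟩
        · have h1 := this.1
          rw [Set.mem_preimage, ← Scheme.Hom.comp_apply, pullback.diagonal_fst] at h1
          exact h1
        · have h1 := this.2
          rw [Set.mem_preimage, ← Scheme.Hom.comp_apply, pullback.diagonal_snd] at h1
          exact h1
      · rintro _ ⟨l, rfl⟩
        change pullback.diagonal str _ ∈ Set.range (pullback.map (i ≫ str) (j ≫ str) str str i j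
          (𝟙 S) (by simp) (by simp))
        rw [Scheme.Pullback.range_map]
        refine ⟨?_, ?_⟩
        · rw [Set.mem_preimage, ← Scheme.Hom.comp_apply, pullback.diagonal_fst]
          exact ⟨α l, (Scheme.Hom.comp_apply ..).symm⟩
        · rw [Set.mem_preimage, ← Scheme.Hom.comp_apply, pullback.diagonal_snd, w]
          exact ⟨β l, (Scheme.Hom.comp_apply ..).symm⟩
  rw [← H.isoPullback_inv_snd]
  infer_instance

lemma toLaurent_subring_eq_top (R : Type) [CommRing R] (s : Subring R[T;T⁻¹])
    (h₀ : (toLaurentZero R).range ≤ s) (h₁ : (toLaurentInfty R).range ≤ s) : s = ⊤ := by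
  rw [eq_top_iff]
  intro f _
  have hT : ∀ k : ℕ, (LaurentPolynomial.T k : R[T;T⁻¹]) ∈ s := fun k =>
    h₀ ⟨X ^ k, by simp [toLaurentZero]⟩
  have hT' : ∀ k : ℕ, (LaurentPolynomial.T (-k) : R[T;T⁻¹]) ∈ s := fun k =>
    h₁ ⟨X ^ k, by simp [toLaurentInfty]⟩
  have hC : ∀ a : R, (LaurentPolynomial.C a : R[T;T⁻¹]) ∈ s := fun a =>
    h₀ ⟨C a, by simp [toLaurentZero]⟩
  induction f using LaurentPolynomial.induction_on' with
  | add p q hp hq => exact s.add_mem (hp trivial) (hq trivial)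
  | C_mul_T k a =>
    obtain ⟨j, rfl | rfl⟩ := k.eq_nat_or_neg
    exacts [s.mul_mem (hC a) (hT j), s.mul_mem (hC a) (hT' j)]

/-- The diagonal is tested on the four products of charts. For a chart with itself this is
separatedness of an affine scheme; for the two mixed products it holds because `R[t]` and `R[t⁻¹]`
together generate `R[t, t⁻¹]`. -/
instance (R : Type) [CommRing R] : IsSeparated (projLineStr R) := by
  refine ⟨IsZariskiLocalAtTarget.of_openCover (Scheme.Pullback.openCoverOfLeftRight
    (lineCover R) (lineCover R) _ _) ?_⟩
  have hid : ∀ k, IsClosedImmersion (pullback.snd (pullback.diagonal (projLineStr R))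
      (pullback.map (lineChart R k ≫ projLineStr R) (lineChart R k ≫ projLineStr R)
        (projLineStr R) (projLineStr R) (lineChart R k) (lineChart R k) (𝟙 _)
        (by simp) (by simp))) := fun k => by
    have := isClosedImmersion_lift_Spec (𝟙 _) (𝟙 _) (lineChart R k ≫ projLineStr R)
      (lineChart R k ≫ projLineStr R) rfl fun s hs _ => by
        rw [eq_top_iff]
        exact fun a _ => hs ⟨a, rfl⟩
    exact isClosedImmersion_pullback_diagonal (lineChart R k) (lineChart R k)
      (Spec.map (𝟙 _)) (Spec.map (𝟙 _)) rfl (by simp) _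
      (pullback.lift_fst _ _ _) (pullback.lift_snd _ _ _)
  rintro ⟨_ | _, _ | _⟩
  · exact hid false
  · have := isClosedImmersion_lift_Spec (CommRingCat.ofHom (toLaurentZero R))
      (CommRingCat.ofHom (toLaurentInfty R)) (chartZero R ≫ projLineStr R)
      (chartInfty R ≫ projLineStr R) (by rw [← Category.assoc, chart_condition, Category.assoc])
      (toLaurent_subring_eq_top R)
    exact isClosedImmersion_pullback_diagonal (chartZero R) (chartInfty R) _ _ (chart_condition R)
      (range_chart_inter R).le _ (pullback.lift_fst _ _ _) (pullback.lift_snd _ _ _)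
  · have := isClosedImmersion_lift_Spec (CommRingCat.ofHom (toLaurentInfty R))
      (CommRingCat.ofHom (toLaurentZero R)) (chartInfty R ≫ projLineStr R)
      (chartZero R ≫ projLineStr R) (by rw [← Category.assoc, ← chart_condition, Category.assoc])
      (fun s h₀ h₁ => toLaurent_subring_eq_top R s h₁ h₀)
    exact isClosedImmersion_pullback_diagonal (chartInfty R) (chartZero R) _ _
      (chart_condition R).symm
      (by rw [← chart_condition, Set.inter_comm]; exact (range_chart_inter R).le) _
      (pullback.lift_fst _ _ _) (pullback.lift_snd _ _ _)
  · exact hid true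

/-! ### Recognizing an affine chart of a normalization -/

section Normalization

lemma isIso_appLE_of_eq_image {X Z : Scheme.{0}} (u : Z ⟶ X) [IsOpenImmersion u] {V : X.Opens}
    (hV : V = u ''ᵁ ⊤) (e : ⊤ ≤ u ⁻¹ᵁ V) : IsIso (u.appLE V ⊤ e) := by
  subst hV
  rw [← Scheme.Hom.appIso_hom']
  infer_instance

lemma specMap_appLE_top_fromSpec {X : Scheme.{0}} {L : CommRingCat.{0}} (u : Spec L ⟶ X)
    {V : X.Opens} (hV : IsAffineOpen V) (e : ⊤ ≤ u ⁻¹ᵁ V) :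
    Spec.map (u.appLE V ⊤ e ≫ (Scheme.ΓSpecIso L).hom) ≫ hV.fromSpec = u := by
  rw [Spec.map_comp, Category.assoc,
    IsAffineOpen.SpecMap_appLE_fromSpec u hV (isAffineOpen_top (Spec L)),
    IsAffineOpen.fromSpec_top, ← Category.assoc]
  have : Spec.map (Scheme.ΓSpecIso L).hom ≫ (Spec L).isoSpec.inv = 𝟙 _ := by
    rw [Iso.comp_inv_eq, Category.id_comp]
    exact (Scheme.isoSpec_Spec_hom L).symm
  rw [this, Category.id_comp]

/-- Over an affine open of `Y` the normalization is the spectrum of the integral closure of the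
sections below in the sections above. If `A` embeds in `L` with image that integral closure, then
`Spec A` is this open piece. -/
lemma exists_normalization_chart {X Y : Scheme.{0}} (f : X ⟶ Y) [QuasiCompact f]
    [QuasiSeparated f] {L B A : CommRingCat.{0}} (u : Spec L ⟶ X) [IsOpenImmersion u]
    (v : Spec B ⟶ Y) [IsOpenImmersion v] (β : B ⟶ A) (α : A ⟶ L)
    (w : u ≫ f = Spec.map (β ≫ α) ≫ v) (hr : f ⁻¹ᵁ v ''ᵁ ⊤ = u ''ᵁ ⊤)
    (hα : Function.Injective α)
    (hint : ∀ y : L, (β ≫ α).hom.IsIntegralElem y ↔ y ∈ α.hom.range) :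
    ∃ (i : Spec A ⟶ f.normalization) (_ : IsOpenImmersion i),
      i ≫ f.fromNormalization = Spec.map β ≫ v ∧
      Spec.map α ≫ i = u ≫ f.toNormalization ∧
      i.opensRange = f.fromNormalization ⁻¹ᵁ v ''ᵁ ⊤ := by
  have hU : IsAffineOpen (v ''ᵁ ⊤) := (isAffineOpen_top (Spec B)).image_of_isOpenImmersion v
  have hW : IsAffineOpen (f.fromNormalization ⁻¹ᵁ v ''ᵁ ⊤) := hU.preimage _
  have eV : f.toNormalization ⁻¹ᵁ f.fromNormalization ⁻¹ᵁ v ''ᵁ ⊤ = f ⁻¹ᵁ v ''ᵁ ⊤ := by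
    rw [← Scheme.Hom.comp_preimage, Scheme.Hom.toNormalization_fromNormalization]
  have eu : (⊤ : (Spec L).Opens) ≤ u ⁻¹ᵁ f ⁻¹ᵁ v ''ᵁ ⊤ := by
    rw [hr, Scheme.Hom.preimage_image_eq]
  have ev : (⊤ : (Spec B).Opens) ≤ v ⁻¹ᵁ v ''ᵁ ⊤ := by
    rw [Scheme.Hom.preimage_image_eq]
  have := isIso_appLE_of_eq_image u hr eu
  have := isIso_appLE_of_eq_image v rfl ev
  let lam := u.appLE (f ⁻¹ᵁ v ''ᵁ ⊤) ⊤ eu ≫ (Scheme.ΓSpecIso L).hom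
  let δ := v.appLE (v ''ᵁ ⊤) ⊤ ev ≫ (Scheme.ΓSpecIso B).hom
  let ψ := f.toNormalization.appLE _ _ eV.ge ≫ lam
  have hfd : f.app (v ''ᵁ ⊤) ≫ lam = δ ≫ β ≫ α := by
    have h1 : f.app (v ''ᵁ ⊤) ≫ u.appLE (f ⁻¹ᵁ v ''ᵁ ⊤) ⊤ eu =
        v.appLE (v ''ᵁ ⊤) ⊤ ev ≫ (Spec.map (β ≫ α)).appTop := by
      refine (Scheme.Hom.comp_appLE u f (v ''ᵁ ⊤) ⊤ eu).symm.trans (Eq.trans ?_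
        (Scheme.Hom.appLE_comp_appLE (Spec.map (β ≫ α)) v (v ''ᵁ ⊤) ⊤ ⊤ ev le_rfl).symm)
      congr 1
    simp only [lam, δ, reassoc_of% h1, Category.assoc]
    rw [Scheme.ΓSpecIso_naturality]
  -- The sections of the normalization embed in `L` with image the integral closure, which `hint`
  -- identifies with the image of `A`.
  have hψ : Function.Injective ψ ∧ ψ.hom.range = α.hom.range := by
    have hval := f.normalizationObjIso_hom_val hU
    let _ := (f.app (v ''ᵁ ⊤)).hom.toAlgebra
    have hlam : Function.Bijective lam := ConcreteCategory.bijective_of_isIso lam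
    have hobj : Function.Bijective (f.normalizationObjIso hU).hom :=
      ConcreteCategory.bijective_of_isIso _
    have hψ' : ψ = (f.normalizationObjIso hU).hom ≫ CommRingCat.ofHom (Subalgebra.val
        (integralClosure Γ(Y, v ''ᵁ ⊤) Γ(X, f ⁻¹ᵁ v ''ᵁ ⊤))).toRingHom ≫ lam := by
      rw [reassoc_of% hval]
    have happ : ∀ a, ψ a = lam ((f.normalizationObjIso hU).hom a :
        integralClosure Γ(Y, v ''ᵁ ⊤) Γ(X, f ⁻¹ᵁ v ''ᵁ ⊤)).1 := fun a => by rw [hψ']; rfl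
    have key : ∀ y, (f.app (v ''ᵁ ⊤)).hom.IsIntegralElem y ↔ lam y ∈ α.hom.range := by
      intro y
      rw [← hint, ← RingHom.IsIntegralElem.map_iff (g := lam.hom) hlam.1]
      have h1 : lam.hom.comp (f.app (v ''ᵁ ⊤)).hom = (β ≫ α).hom.comp δ.hom :=
        congrArg CommRingCat.Hom.hom hfd
      rw [h1]
      -- Integrality over `B` and over the sections on the image of `v` agree because `δ` is an
      -- isomorphism.
      refine ⟨fun h => h.of_comp, fun h => ?_⟩
      have h2 : (β ≫ α).hom = ((β ≫ α).hom.comp δ.hom).comp (inv δ).hom :=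
        congrArg CommRingCat.Hom.hom (IsIso.inv_hom_id_assoc δ (β ≫ α)).symm
      rw [h2] at h
      exact h.of_comp
    refine ⟨fun a b hab => ?_, ?_⟩
    · rw [happ, happ] at hab
      exact hobj.1 (Subtype.ext (hlam.1 hab))
    · ext y
      constructor
      · rintro ⟨a, rfl⟩
        change ψ a ∈ _
        rw [happ]
        exact (key _).mp ((f.normalizationObjIso hU).hom a :
          integralClosure Γ(Y, v ''ᵁ ⊤) Γ(X, f ⁻¹ᵁ v ''ᵁ ⊤)).2
      · intro hy
        obtain ⟨y, rfl⟩ := hlam.2 y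
        obtain ⟨a, ha⟩ := hobj.2 ⟨y, (key y).mpr hy⟩
        exact ⟨a, (happ a).trans (by rw [ha])⟩
  -- Two rings embedded in `L` with the same image are isomorphic compatibly with the embeddings.
  obtain ⟨ψ', hψ'⟩ : ∃ ψ' : Γ(f.normalization, f.fromNormalization ⁻¹ᵁ v ''ᵁ ⊤) ⟶ A,
      IsIso ψ' ∧ ψ' ≫ α = ψ := by
    let eα : A ≃+* α.hom.range := RingEquiv.ofBijective α.hom.rangeRestrict
      ⟨fun a b hab => hα congr(($hab : L)), α.hom.rangeRestrict_surjective⟩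
    let ρ : Γ(f.normalization, f.fromNormalization ⁻¹ᵁ v ''ᵁ ⊤) →+* α.hom.range :=
      ψ.hom.codRestrict _ fun a => by
        rw [← hψ.2]
        exact ⟨a, rfl⟩
    let eψ : Γ(f.normalization, f.fromNormalization ⁻¹ᵁ v ''ᵁ ⊤) ≃+* α.hom.range :=
      RingEquiv.ofBijective ρ ⟨fun a b hab => hψ.1 congr(($hab : L)), fun y => by
        obtain ⟨a, ha⟩ : y.1 ∈ ψ.hom.range := by
          rw [hψ.2]
          exact y.2
        exact ⟨a, Subtype.ext ha⟩⟩
    refine ⟨(eψ.trans eα.symm).toCommRingCatIso.hom, inferInstance, ?_⟩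
    ext a
    change α (eα.symm (eψ a)) = ψ a
    have : eα (eα.symm (eψ a)) = eψ a := eα.apply_symm_apply _
    exact congrArg Subtype.val this
  obtain ⟨_, hψα⟩ := hψ'
  refine ⟨Spec.map ψ' ≫ hW.fromSpec, inferInstance, ?_, ?_, ?_⟩
  · have h1 : f.fromNormalization.app (v ''ᵁ ⊤) ≫ ψ' = δ ≫ β := by
      have : Mono α := ConcreteCategory.mono_of_injective _ hα
      rw [← cancel_mono α, Category.assoc, hψα, Category.assoc, ← hfd]
      simp only [ψ]
      rw [Scheme.Hom.app_eq_appLE, Scheme.Hom.appLE_comp_appLE_assoc, Scheme.Hom.app_eq_appLE]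
      congr 2
      exact f.toNormalization_fromNormalization
    have h2 : hW.fromSpec ≫ f.fromNormalization =
        Spec.map (f.fromNormalization.app (v ''ᵁ ⊤)) ≫ hU.fromSpec := by
      rw [Scheme.Hom.app_eq_appLE, IsAffineOpen.SpecMap_appLE_fromSpec _ hU hW]
    rw [Category.assoc, h2, ← Category.assoc, ← Spec.map_comp, h1, Spec.map_comp, Category.assoc,
      specMap_appLE_top_fromSpec]
  · rw [← Category.assoc, ← Spec.map_comp, hψα]
    simp only [ψ, lam]
    rw [Scheme.Hom.appLE_comp_appLE_assoc, specMap_appLE_top_fromSpec]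
  · rw [Scheme.Hom.opensRange_comp_of_isIso, IsAffineOpen.opensRange_fromSpec]

end Normalization

/-! ### The equations of the two charts of the curve -/

lemma intEval_X {A : Type} [CommRing A] (a : A) : intEval X a = a := by simp [intEval]

lemma intEval_one {A : Type} [CommRing A] (a : A) : intEval 1 a = 1 := by simp [intEval]

lemma intEval_add {A : Type} [CommRing A] (q r : ℤ[X]) (a : A) :
    intEval (q + r) a = intEval q a + intEval r a := eval₂_add _ _

lemma intEval_mul {A : Type} [CommRing A] (q r : ℤ[X]) (a : A) :
    intEval (q * r) a = intEval q a * intEval r a := eval₂_mul _ _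

lemma intEval_pow {A : Type} [CommRing A] (q : ℤ[X]) (k : ℕ) (a : A) :
    intEval (q ^ k) a = intEval q a ^ k := eval₂_pow _ _ _

/-- The right hand sides of the equations of the two charts. -/
def chartH (n a : ℕ) : Bool → ℤ[X]
  | false => X ^ n + 1
  | true => X * (X ^ n + 1) ^ a

/-- The functions inverted on the two charts. -/
def chartG (n : ℕ) : Bool → ℤ[X]
  | false => 1
  | true => X ^ n + 1

lemma intEval_chartH_false {A : Type} [CommRing A] (n a : ℕ) (c : A) :
    intEval (chartH n a false) c = c ^ n + 1 := by
  simp [chartH, intEval_add, intEval_pow, intEval_X, intEval_one]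

lemma intEval_chartH_true {A : Type} [CommRing A] (n a : ℕ) (c : A) :
    intEval (chartH n a true) c = c * (c ^ n + 1) ^ a := by
  simp [chartH, intEval_add, intEval_mul, intEval_pow, intEval_X, intEval_one]

lemma intEval_chartG_false {A : Type} [CommRing A] (n : ℕ) (c : A) :
    intEval (chartG n false) c = 1 := intEval_one c

lemma intEval_chartG_true {A : Type} [CommRing A] (n : ℕ) (c : A) :
    intEval (chartG n true) c = c ^ n + 1 := by
  simp [chartG, intEval_add, intEval_pow, intEval_X, intEval_one]

/-- The coordinate rings of the two charts. -/
abbrev CurveChart (S : Type) [CommRing S] (m n a : ℕ) (k : Bool) : Type :=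
  ChartRing S m (chartH n a k) (chartG n k)

/-! ### The chart at infinity is integrally closed in the overlap -/

section IntegrallyClosed

/-- Write `x ^ (k + 1) * y = f`. Scaling the integral equation of `y` shows that `x` divides a power
of `f`, hence `f` itself by `hrad`, so one factor `x` cancels. Descent on the exponent removes the
denominator. Only radicality of `x` is used, not normality of `A`. -/
lemma mem_range_of_isIntegralElem_away {A L : Type} [CommRing A] [CommRing L] [Algebra A L]
    (x : A) [IsLocalization.Away x L] (hx : x ∈ nonZeroDivisors A)
    (hrad : ∀ (y : A) (N : ℕ), x ∣ y ^ N → x ∣ y) (y : L)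
    (hy : (algebraMap A L).IsIntegralElem y) : y ∈ (algebraMap A L).range := by
  have hinj : Function.Injective (algebraMap A L) :=
    IsLocalization.injective L (Submonoid.powers_le.mpr hx)
  have hxu : IsUnit (algebraMap A L x) := IsLocalization.Away.algebraMap_isUnit x
  obtain ⟨P, hP, hPy⟩ := hy
  have key : ∀ (k : ℕ) (f : A), algebraMap A L x ^ k * y = algebraMap A L f →
      y ∈ (algebraMap A L).range := by
    intro k
    induction k with
    | zero => exact fun f hf => ⟨f, by rw [← hf, pow_zero, one_mul]⟩
    | succ k ih =>
      intro f hf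
      -- After this scaling all coefficients but the leading one are divisible by `x`, so modulo `x`
      -- the equation reads `f ^ P.natDegree = 0`.
      have hroot : eval f (P.scaleRoots (x ^ (k + 1))) = 0 := by
        apply hinj
        have := Polynomial.scaleRoots_eval₂_eq_zero (algebraMap A L) (s := x ^ (k + 1)) hPy
        rwa [map_pow, hf, Polynomial.eval₂_at_apply, ← map_zero (algebraMap A L)] at this
      have hdvd : x ∣ f ^ P.natDegree := by
        -- When `x` is a unit the quotient is zero and the leading coefficient `1` dies in it, so
        -- that case is treated apart.
        rcases subsingleton_or_nontrivial (A ⧸ Ideal.span {x}) with hs | hs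
        · rw [← Ideal.mem_span_singleton, (Ideal.Quotient.subsingleton_iff).mp hs]
          trivial
        · rw [← Ideal.mem_span_singleton, ← Ideal.Quotient.eq_zero_iff_mem]
          have h1 := congrArg (Ideal.Quotient.mk (Ideal.span {x})) hroot
          have h2 : Ideal.Quotient.mk (Ideal.span {x}) x = 0 :=
            Ideal.Quotient.eq_zero_iff_mem.mpr (Ideal.mem_span_singleton_self x)
          rw [map_zero, ← Polynomial.eval₂_at_apply, ← Polynomial.eval_map,
            Polynomial.map_scaleRoots _ _ _ (by rw [hP.leadingCoeff, map_one]; exact one_ne_zero),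
            map_pow, h2, zero_pow (Nat.succ_ne_zero k), Polynomial.scaleRoots_zero,
            (hP.map _).leadingCoeff, one_smul, eval_pow, eval_X, hP.natDegree_map] at h1
          rw [map_pow, h1]
      obtain ⟨f', rfl⟩ := hrad f _ hdvd
      refine ih f' (hxu.mul_left_cancel ?_)
      rw [← map_mul, ← hf]
      ring
  obtain ⟨⟨f, s, ⟨k, rfl⟩⟩, hf⟩ := IsLocalization.surj (Submonoid.powers x) y
  refine key k f ?_
  rw [← hf, mul_comm]
  simp

namespace ChartRing

variable (R : Type) [CommRing R] (m n a : ℕ)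

/-- The integral closure `K` of `B` contains the coefficients, `z` and `x`, and `g(z)` has an
inverse in `K` coming from `B`. The universal property of the chart ring therefore maps it into `K`
over itself, so `K` is everything. -/
lemma ofPoly_isIntegral (h g : ℤ[X]) (hm : m ≠ 0) {B : Type} [CommRing B]
    (β : B →+* ChartRing R m h g) (hβ : (ofPoly R m h g).range ≤ β.range)
    (hg : ∃ c, β c * intEval g (z R m h g) = 1) (y : ChartRing R m h g) :
    β.IsIntegralElem y := by
  let _ := β.toAlgebra
  let K := integralClosure B (ChartRing R m h g)
  have hmem : ∀ y ∈ (ofPoly R m h g).range, y ∈ K := fun y hy => by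
    obtain ⟨c, rfl⟩ := hβ hy
    exact K.algebraMap_mem c
  have hx : x R m h g ∈ K := by
    refine IsIntegral.of_pow (Nat.pos_of_ne_zero hm) ?_
    rw [x_pow, ← ofPoly_map]
    exact hmem _ ⟨_, rfl⟩
  let φ : R →+* K := (base R m h g).codRestrict K fun r => hmem _ ⟨C r, rfl⟩
  let z' : K := ⟨z R m h g, hmem _ ⟨X, rfl⟩⟩
  let x' : K := ⟨x R m h g, hx⟩
  have hu : IsUnit (intEval g z') := by
    obtain ⟨c, hc⟩ := hg
    refine .of_mul_eq_one (algebraMap B K c) (Subtype.ext ?_)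
    have : K.val.toRingHom (intEval g z') = intEval g (z R m h g) := map_intEval _ _ _
    change K.val.toRingHom (intEval g z') * β c = 1
    rw [this, mul_comm, hc]
  have hr : x' ^ m = intEval h z' := by
    apply Subtype.ext
    have : K.val.toRingHom (intEval h z') = intEval h (z R m h g) := map_intEval _ _ _
    exact (x_pow R m h g).trans this.symm
  have hid : K.val.toRingHom.comp (lift φ z' x' hu hr) = RingHom.id _ := by
    refine hom_ext ?_ ?_ ?_
    · rw [RingHom.comp_assoc, lift_comp_base]
      rfl
    · rw [RingHom.comp_apply, lift_z]
      rfl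
    · rw [RingHom.comp_apply, lift_x]
      rfl
  have := (lift φ z' x' hu hr y).2
  have h2 : ((lift φ z' x' hu hr y : K) : ChartRing R m h g) = y := congr($hid y)
  rwa [h2] at this

variable {m n} (hm : m ≠ 0) (hn : n ≠ 0)

/-- Evaluation at the point at infinity. -/
def evalInfty : CurveChart R m n a true →+* R :=
  lift (RingHom.id R) 0 0
    (by rw [intEval_chartG_true, zero_pow hn, zero_add]; exact isUnit_one)
    (by rw [intEval_chartH_true, zero_pow hm, zero_mul])

/-- Up to the unit `(z ^ n + 1) ^ a`, the equation reads `z = x ^ m`: the curve is totally ramified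
at infinity, with parameter `x`. -/
lemma x_dvd_z (hm : m ≠ 0) :
    x R m (chartH n a true) (chartG n true) ∣ z R m (chartH n a true) (chartG n true) := by
  have h1 := isUnit_g R m (chartH n a true) (chartG n true)
  have h2 := x_pow R m (chartH n a true) (chartG n true)
  rw [intEval_chartG_true] at h1
  rw [intEval_chartH_true] at h2
  rw [← (h1.pow a).dvd_mul_right, ← h2]
  exact dvd_pow_self _ hm

/-- Modulo `x` the coordinate `z` dies as well, so the quotient by `x` is `R`, the section at
infinity. -/
lemma x_dvd_sub_evalInfty (y : CurveChart R m n a true) :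
    x R m (chartH n a true) (chartG n true) ∣ y - base _ _ _ _ (evalInfty R a hm hn y) := by
  let I := Ideal.span {x R m (chartH n a true) (chartG n true)}
  have h : (Ideal.Quotient.mk I) =
      ((Ideal.Quotient.mk I).comp (base _ _ _ _)).comp (evalInfty R a hm hn) := by
    refine hom_ext ?_ ?_ ?_
    · rw [RingHom.comp_assoc, evalInfty, lift_comp_base]
      rfl
    · rw [RingHom.comp_apply, evalInfty, lift_z, map_zero, Ideal.Quotient.eq_zero_iff_mem,
        Ideal.mem_span_singleton]
      exact x_dvd_z R a hm
    · rw [RingHom.comp_apply, evalInfty, lift_x, map_zero, Ideal.Quotient.eq_zero_iff_mem,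
        Ideal.mem_span_singleton]
  rw [← Ideal.mem_span_singleton, ← Ideal.Quotient.eq_zero_iff_mem, map_sub, sub_eq_zero]
  exact congr($h y)

/-- The quotient by `x` is the reduced ring `R`. This is the radicality needed in
`mem_range_of_isIntegralElem_away`. -/
lemma x_dvd_of_dvd_pow [IsReduced R] (hm : m ≠ 0) (hn : n ≠ 0) (y : CurveChart R m n a true) (N : ℕ)
    (h : x R m (chartH n a true) (chartG n true) ∣ y ^ N) :
    x R m (chartH n a true) (chartG n true) ∣ y := by
  have h1 : evalInfty R a hm hn y ^ N = 0 := by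
    rw [← map_pow]
    obtain ⟨c, hc⟩ := h
    rw [hc, map_mul, evalInfty, lift_x, zero_mul]
  have h2 : evalInfty R a hm hn y = 0 := IsReduced.eq_zero _ ⟨N, h1⟩
  have h3 := x_dvd_sub_evalInfty R a hm hn y
  rwa [h2, map_zero, sub_zero] at h3

/-- `x` is a factor of `x ^ m = h(z)`, and `h` is monic, hence regular in the flat `R[z]`-algebra.
-/
lemma x_mem_nonZeroDivisors (hm : m ≠ 0) (hn : n ≠ 0) :
    x R m (chartH n a true) (chartG n true) ∈ nonZeroDivisors (CurveChart R m n a true) := by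
  have h1 : (X * (X ^ n + C 1) ^ a : R[X]).Monic :=
    monic_X.mul ((monic_X_pow_add_C 1 hn).pow a)
  have h2 := ofPoly_mem_nonZeroDivisors (S := R) (h := chartH n a true) (g := chartG n true) hm
    h1.mem_nonZeroDivisors
  have h3 : (X * (X ^ n + C 1) ^ a : R[X]) = (chartH n a true).map (Int.castRingHom R) := by
    simp [chartH]
  rw [h3, ofPoly_map, ← x_pow] at h2
  obtain ⟨k, rfl⟩ := Nat.exists_eq_succ_of_ne_zero hm
  rw [pow_succ] at h2
  exact (mul_mem_nonZeroDivisors.mp h2).2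

end ChartRing

end IntegrallyClosed

/-! ### The change of coordinates at infinity -/

section Overlap

section Identities

variable {A : Type} [CommRing A] {m n a b : ℕ}

/-- The substitutions are `z = t⁻¹`, `x = y ^ a * z ^ b` and, backwards, `y = (z ^ n + 1) ^ b * x⁻¹
^ n`. This identity and the next three say that they carry the two equations into each other and are
mutually inverse; all rest on `m * b = n * a + 1`. -/
lemma overlap_pow_eq (hb : m * b = n * a + 1) {z zi x xi : A} (hz : z * zi = 1) (hx : x * xi = 1)
    (h : x ^ m = z * (z ^ n + 1) ^ a) : ((z ^ n + 1) ^ b * xi ^ n) ^ m = zi ^ n + 1 := by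
  have hxu : IsUnit (x ^ (n * m)) := (IsUnit.of_mul_eq_one _ hx).pow _
  refine hxu.mul_left_cancel ?_
  have h1 : x ^ (n * m) * ((z ^ n + 1) ^ b * xi ^ n) ^ m =
      (x * xi) ^ (n * m) * (z ^ n + 1) ^ (m * b) := by ring
  have h2 : x ^ (n * m) = z ^ n * (z ^ n + 1) ^ (n * a) := by
    rw [mul_comm n m, pow_mul, h]
    ring
  rw [h1, hx, one_pow, one_mul, hb, h2]
  have h3 : z ^ n * zi ^ n = 1 := by rw [← mul_pow, hz, one_pow]
  linear_combination -(z ^ n + 1) ^ (n * a) * h3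

lemma overlap_mul_eq (hb : m * b = n * a + 1) {z x xi : A} (hx : x * xi = 1)
    (h : x ^ m = z * (z ^ n + 1) ^ a) : ((z ^ n + 1) ^ b * xi ^ n) ^ a * z ^ b = x := by
  have hxu : IsUnit (x ^ (n * a)) := (IsUnit.of_mul_eq_one _ hx).pow _
  refine hxu.mul_left_cancel ?_
  have h1 : x ^ (n * a) * (((z ^ n + 1) ^ b * xi ^ n) ^ a * z ^ b) =
      (x * xi) ^ (n * a) * (z * (z ^ n + 1) ^ a) ^ b := by ring
  rw [h1, hx, one_pow, one_mul, ← h, ← pow_mul, hb, pow_succ]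

lemma overlap_mul_pow_eq (hb : m * b = n * a + 1) {t ti y : A} (ht : t * ti = 1)
    (h : y ^ m = t ^ n + 1) : (y ^ a * ti ^ b) ^ m = ti * (ti ^ n + 1) ^ a := by
  have h1 : (y ^ a * ti ^ b) ^ m = (y ^ m) ^ a * ti ^ (m * b) := by ring
  have h2 : ti ^ n + 1 = (t ^ n + 1) * ti ^ n := by
    have h3 : t ^ n * ti ^ n = 1 := by rw [← mul_pow, ht, one_pow]
    linear_combination -h3
  rw [h1, h, hb, h2, mul_pow, pow_succ, ← pow_mul]
  ring

lemma overlap_inv_eq (hb : m * b = n * a + 1) {t ti y w wi : A} (ht : t * ti = 1)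
    (h : y ^ m = t ^ n + 1) (hw : w = y ^ a * ti ^ b) (hwi : w * wi = 1) :
    (ti ^ n + 1) ^ b * wi ^ n = y := by
  have hwu : IsUnit (w ^ n) := (IsUnit.of_mul_eq_one _ hwi).pow _
  refine hwu.mul_left_cancel ?_
  have h1 : w ^ n * ((ti ^ n + 1) ^ b * wi ^ n) = (w * wi) ^ n * (ti ^ n + 1) ^ b := by ring
  have h2 : ti ^ n + 1 = (t ^ n + 1) * ti ^ n := by
    have h3 : t ^ n * ti ^ n = 1 := by rw [← mul_pow, ht, one_pow]
    linear_combination -h3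
  have h4 : w ^ n * y = y ^ (n * a + 1) * ti ^ (b * n) := by
    rw [hw]
    ring
  rw [h1, hwi, one_pow, one_mul, h2, h4, pow_succ, mul_pow, mul_assoc]
  have h5 : (t ^ n + 1) ^ b = y ^ (n * a) * y := by rw [← h, ← pow_mul, hb, pow_succ]
  rw [h5, ← pow_mul]
  ring

end Identities

variable (R : Type) [CommRing R] (m n a : ℕ)

/-- The coordinate `t` on the affine curve. -/
def coordT : CoordRing R m n := AdjoinRoot.of _ X

/-- The coordinate `y` on the affine curve. -/
def coordY : CoordRing R m n := AdjoinRoot.root _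

/-- The coefficients of the coordinate ring. -/
def coordBase : R →+* CoordRing R m n := (AdjoinRoot.of _).comp C

lemma coordY_pow : coordY R m n ^ m = coordT R m n ^ n + 1 := by
  have := AdjoinRoot.eval₂_root (X ^ m - C (X ^ n + 1) : R[X][X])
  rw [eval₂_sub, eval₂_pow, eval₂_X, eval₂_C, sub_eq_zero] at this
  rw [coordY, this, coordT]
  simp

variable {R m n a}

lemma coordRing_hom_ext {A : Type} [CommRing A] {φ ψ : CoordRing R m n →+* A}
    (hb : φ.comp (coordBase R m n) = ψ.comp (coordBase R m n))
    (ht : φ (coordT R m n) = ψ (coordT R m n)) (hy : φ (coordY R m n) = ψ (coordY R m n)) :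
    φ = ψ :=
  Ideal.Quotient.ringHom_ext (Polynomial.ringHom_ext' (Polynomial.ringHom_ext' hb ht) hy)

/-- The universal property of the coordinate ring of the affine curve. -/
def coordLift {A : Type} [CommRing A] (φ : R →+* A) (t y : A) (h : y ^ m = t ^ n + 1) :
    CoordRing R m n →+* A :=
  AdjoinRoot.lift (eval₂RingHom φ t) y (by
    rw [eval₂_sub, eval₂_pow, eval₂_X, eval₂_C, h]
    simp)

section

variable {A : Type} [CommRing A] (φ : R →+* A) (t y : A) (h : y ^ m = t ^ n + 1)

@[simp] lemma coordLift_coordBase (r : R) : coordLift φ t y h (coordBase R m n r) = φ r := by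
  rw [coordLift, coordBase, RingHom.comp_apply, AdjoinRoot.lift_of]
  simp

@[simp] lemma coordLift_comp_coordBase : (coordLift φ t y h).comp (coordBase R m n) = φ :=
  RingHom.ext (coordLift_coordBase φ t y h)

@[simp] lemma coordLift_coordT : coordLift φ t y h (coordT R m n) = t := by
  rw [coordLift, coordT, AdjoinRoot.lift_of]
  simp

@[simp] lemma coordLift_coordY : coordLift φ t y h (coordY R m n) = y := by
  rw [coordLift, coordY, AdjoinRoot.lift_root]

end

variable (R m n a)

/-- The affine coordinate ring maps to the first chart ring. -/
def coordToChart : CoordRing R m n →+* CurveChart R m n a false :=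
  coordLift (ChartRing.base _ _ _ _) (ChartRing.z _ _ _ _) (ChartRing.x _ _ _ _) (by
    rw [ChartRing.x_pow, intEval_chartH_false])

/-- The first chart ring maps to the affine coordinate ring. -/
def chartToCoord : CurveChart R m n a false →+* CoordRing R m n :=
  ChartRing.lift (coordBase R m n) (coordT R m n) (coordY R m n)
    (by rw [intEval_chartG_false]; exact isUnit_one)
    (by rw [intEval_chartH_false, coordY_pow])

lemma chartToCoord_comp : (chartToCoord R m n a).comp (coordToChart R m n a) = RingHom.id _ := by
  refine coordRing_hom_ext ?_ ?_ ?_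
  · rw [RingHom.comp_assoc, coordToChart, coordLift_comp_coordBase, chartToCoord,
      ChartRing.lift_comp_base]
    rfl
  · simp [coordToChart, chartToCoord]
  · simp [coordToChart, chartToCoord]

lemma coordToChart_comp : (coordToChart R m n a).comp (chartToCoord R m n a) = RingHom.id _ := by
  refine ChartRing.hom_ext ?_ ?_ ?_
  · rw [RingHom.comp_assoc, chartToCoord, ChartRing.lift_comp_base, coordToChart,
      coordLift_comp_coordBase]
    rfl
  · simp [coordToChart, chartToCoord]
  · simp [coordToChart, chartToCoord]

/-- The first chart ring is the coordinate ring of the affine curve. -/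
def coordEquiv : CurveChart R m n a false ≃+* CoordRing R m n :=
  RingEquiv.ofRingHom (chartToCoord R m n a) (coordToChart R m n a) (chartToCoord_comp R m n a)
    (coordToChart_comp R m n a)

/-- The coordinate ring of the intersection of the two charts. -/
abbrev OverlapRing : Type :=
  Localization.Away (ChartRing.x R m (chartH n a true) (chartG n true))

namespace OverlapRing

/-- The restriction map from the chart at infinity. -/
def ofChart : CurveChart R m n a true →+* OverlapRing R m n a := algebraMap _ _

lemma exists_x_mul : ∃ xi, ofChart R m n a (ChartRing.x _ _ _ _) * xi = 1 :=
  (IsLocalization.Away.algebraMap_isUnit (S := OverlapRing R m n a)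
    (ChartRing.x R m (chartH n a true) (chartG n true))).exists_right_inv

/-- The inverse of `x` on the overlap. -/
def xInv : OverlapRing R m n a := (exists_x_mul R m n a).choose

lemma x_mul_xInv : ofChart R m n a (ChartRing.x _ _ _ _) * xInv R m n a = 1 :=
  (exists_x_mul R m n a).choose_spec

lemma x_pow : ofChart R m n a (ChartRing.x _ _ _ _) ^ m =
    ofChart R m n a (ChartRing.z _ _ _ _) * (ofChart R m n a (ChartRing.z _ _ _ _) ^ n + 1) ^ a := by
  rw [← map_pow, ChartRing.x_pow, map_intEval, intEval_chartH_true]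

lemma exists_z_mul : ∃ zi, ofChart R m n a (ChartRing.z _ _ _ _) * zi = 1 := by
  have h : IsUnit (ofChart R m n a (ChartRing.x _ _ _ _) ^ m) :=
    (IsUnit.of_mul_eq_one _ (x_mul_xInv R m n a)).pow m
  rw [x_pow] at h
  exact (isUnit_of_mul_isUnit_left h).exists_right_inv

/-- The inverse of `z` on the overlap. -/
def zInv : OverlapRing R m n a := (exists_z_mul R m n a).choose

lemma z_mul_zInv : ofChart R m n a (ChartRing.z _ _ _ _) * zInv R m n a = 1 :=
  (exists_z_mul R m n a).choose_spec

lemma isUnit_z_pow_add_one : IsUnit (ofChart R m n a (ChartRing.z _ _ _ _) ^ n + 1) := by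
  have := (ChartRing.isUnit_g R m (chartH n a true) (chartG n true)).map (ofChart R m n a)
  rwa [map_intEval, intEval_chartG_true] at this

variable {m n a} {b : ℕ} (hb : m * b = n * a + 1)

/-- The restriction map from the affine curve. -/
def ofCoord : CoordRing R m n →+* OverlapRing R m n a :=
  coordLift ((ofChart R m n a).comp (ChartRing.base _ _ _ _)) (zInv R m n a)
    ((ofChart R m n a (ChartRing.z _ _ _ _) ^ n + 1) ^ b * xInv R m n a ^ n)
    (overlap_pow_eq hb (z_mul_zInv R m n a) (x_mul_xInv R m n a) (x_pow R m n a))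

lemma ofCoord_coordT_mul :
    ofCoord R hb (coordT R m n) * ofChart R m n a (ChartRing.z _ _ _ _) = 1 := by
  rw [ofCoord, coordLift_coordT, mul_comm, z_mul_zInv]

lemma ofCoord_coordY_mul : ofCoord R hb (coordY R m n) ^ a *
    ofChart R m n a (ChartRing.z _ _ _ _) ^ b = ofChart R m n a (ChartRing.x _ _ _ _) := by
  rw [ofCoord, coordLift_coordY]
  exact overlap_mul_eq hb (x_mul_xInv R m n a) (x_pow R m n a)

lemma ofCoord_comp_coordBase :
    (ofCoord R hb).comp (coordBase R m n) = (ofChart R m n a).comp (ChartRing.base _ _ _ _) :=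
  coordLift_comp_coordBase ..

/-- The function on the affine curve whose nonvanishing locus is the overlap. -/
def locus (R : Type) [CommRing R] (m n : ℕ) : CoordRing R m n :=
  coordT R m n * (coordT R m n ^ n + 1)

lemma isUnit_ofCoord_locus : IsUnit (ofCoord R hb (locus R m n)) := by
  rw [locus, map_mul]
  refine (IsUnit.of_mul_eq_one _ (ofCoord_coordT_mul R hb)).mul ?_
  rw [← coordY_pow, map_pow, ofCoord, coordLift_coordY]
  exact (((isUnit_z_pow_add_one R m n a).pow b).mul
    ((IsUnit.of_mul_eq_one _ ((mul_comm _ _).trans (x_mul_xInv R m n a))).pow n)).pow m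

/-- Inverting `t * (t ^ n + 1) = t * y ^ m` makes `t` and `y` units, hence also `x = y ^ a * t⁻¹ ^
b` and `z ^ n + 1`. The change of coordinates then gives mutually inverse maps `θ` and `χ` between
the two localizations. -/
lemma isLocalization_ofCoord :
    @IsLocalization.Away _ _ (locus R m n) (OverlapRing R m n a) _ (ofCoord R hb).toAlgebra := by
  let _ := (ofCoord R hb).toAlgebra
  let L₀ := Localization.Away (locus R m n)
  let r : CoordRing R m n →+* L₀ := algebraMap _ _
  have hloc₀ : IsUnit (r (locus R m n)) := IsLocalization.Away.algebraMap_isUnit _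
  have hloc : IsUnit (r (coordT R m n)) ∧ IsUnit (r (coordT R m n ^ n + 1)) := by
    rw [← IsUnit.mul_iff, ← map_mul]
    exact hloc₀
  obtain ⟨ti, hti⟩ := hloc.1.exists_right_inv
  have hy : IsUnit (r (coordY R m n)) := by
    have h := hloc.2
    rw [← coordY_pow, map_pow] at h
    refine (isUnit_pow_iff ?_).mp h
    -- For `m = 0` the relation `hb` would read `0 = n * a + 1`.
    rintro rfl
    simp at hb
  have hyt : r (coordY R m n) ^ m = r (coordT R m n) ^ n + 1 := by
    rw [← map_pow, coordY_pow]
    simp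
  have hx := overlap_mul_pow_eq hb hti hyt
  have htin : IsUnit (ti ^ n + 1) := by
    have h1 : ti ^ n + 1 = r (coordT R m n ^ n + 1) * ti ^ n := by
      have h3 : r (coordT R m n) ^ n * ti ^ n = 1 := by rw [← mul_pow, hti, one_pow]
      rw [map_add r, map_one r, map_pow r]
      linear_combination -h3
    rw [h1]
    exact hloc.2.mul ((IsUnit.of_mul_eq_one _ ((mul_comm _ _).trans hti)).pow n)
  let χ₀ : CurveChart R m n a true →+* L₀ :=
    ChartRing.lift (r.comp (coordBase R m n)) ti (r (coordY R m n) ^ a * ti ^ b)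
      (by rwa [intEval_chartG_true]) (by rwa [intEval_chartH_true])
  have hu : IsUnit (χ₀ (ChartRing.x _ _ _ _)) := by
    simp only [χ₀, ChartRing.lift_x]
    exact (hy.pow a).mul ((IsUnit.of_mul_eq_one _ ((mul_comm _ _).trans hti)).pow b)
  let χ : OverlapRing R m n a →+* L₀ := IsLocalization.Away.lift (ChartRing.x _ _ _ _) hu
  have hχ : ∀ c, χ (ofChart R m n a c) = χ₀ c := IsLocalization.Away.lift_eq _ hu
  let θ : L₀ →+* OverlapRing R m n a :=
    IsLocalization.Away.lift (locus R m n) (isUnit_ofCoord_locus R hb)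
  have hθ : ∀ c, θ (r c) = ofCoord R hb c :=
    IsLocalization.Away.lift_eq _ (isUnit_ofCoord_locus R hb)
  have hχt : χ (ofCoord R hb (coordT R m n)) = r (coordT R m n) := by
    have h1 := congrArg χ (ofCoord_coordT_mul R hb)
    rw [map_mul, map_one, hχ] at h1
    simp only [χ₀, ChartRing.lift_z] at h1
    linear_combination r (coordT R m n) * h1 - χ (ofCoord R hb (coordT R m n)) * hti
  have hθti : θ ti = ofChart R m n a (ChartRing.z _ _ _ _) := by
    have h1 := congrArg θ hti
    rw [map_mul, map_one, hθ] at h1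
    have h2 := ofCoord_coordT_mul R hb
    linear_combination (ofChart R m n a (ChartRing.z _ _ _ _)) * h1 - θ ti * h2
  have h₁ : θ.comp χ = RingHom.id _ := by
    refine IsLocalization.ringHom_ext
      (Submonoid.powers (ChartRing.x R m (chartH n a true) (chartG n true))) ?_
    refine ChartRing.hom_ext ?_ ?_ ?_
    · ext c
      change θ (χ (ofChart R m n a _)) = ofChart R m n a _
      rw [hχ]
      simp only [χ₀, ChartRing.lift_base]
      rw [RingHom.comp_apply, hθ]
      exact congr($(ofCoord_comp_coordBase R hb) c)
    · change θ (χ (ofChart R m n a _)) = ofChart R m n a _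
      rw [hχ]
      simp only [χ₀, ChartRing.lift_z]
      exact hθti
    · change θ (χ (ofChart R m n a _)) = ofChart R m n a _
      rw [hχ]
      simp only [χ₀, ChartRing.lift_x]
      rw [map_mul, map_pow, map_pow, hθ, hθti, ofCoord_coordY_mul]
  have h₂ : χ.comp θ = RingHom.id _ := by
    refine IsLocalization.ringHom_ext (Submonoid.powers (locus R m n)) ?_
    refine coordRing_hom_ext ?_ ?_ ?_
    · ext c
      change χ (θ (r _)) = r _
      rw [hθ]
      have := congr($(ofCoord_comp_coordBase R hb) c)
      rw [RingHom.comp_apply] at this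
      rw [this, RingHom.comp_apply, hχ]
      simp only [χ₀, ChartRing.lift_base]
      rfl
    · change χ (θ (r _)) = r _
      rw [hθ, hχt]
    · change χ (θ (r _)) = r _
      rw [hθ, ofCoord, coordLift_coordY, map_mul χ, map_pow χ, map_pow χ, map_add χ, map_pow χ,
        map_one χ, hχ]
      simp only [χ₀, ChartRing.lift_z]
      refine overlap_inv_eq hb hti hyt rfl ?_
      have h1 := congrArg χ (x_mul_xInv R m n a)
      rw [map_mul, map_one, hχ] at h1
      simpa only [χ₀, ChartRing.lift_x] using h1
  let e : L₀ ≃ₐ[CoordRing R m n] OverlapRing R m n a :=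
    { RingEquiv.ofRingHom θ χ h₁ h₂ with
      commutes' := hθ }
  exact IsLocalization.isLocalization_of_algEquiv _ e

end OverlapRing

end Overlap

/-! ### The two charts of the complete curve -/

section CurveCharts

lemma IsIntegralElem.map_comp {A B C : Type*} [CommRing A] [CommRing B] [CommRing C]
    {φ : A →+* B} (ψ : B →+* C) {b : B} (h : φ.IsIntegralElem b) :
    (ψ.comp φ).IsIntegralElem (ψ b) := by
  obtain ⟨P, hP, hb⟩ := h
  exact ⟨P, hP, by rw [← hom_eval₂, hb, map_zero]⟩

lemma IsIntegralElem.of_comp {A B C : Type*} [CommRing A] [CommRing B] [CommRing C]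
    {φ : A →+* B} (ψ : B →+* C) {c : C} (h : (ψ.comp φ).IsIntegralElem c) :
    ψ.IsIntegralElem c := by
  obtain ⟨P, hP, hb⟩ := h
  exact ⟨P.map φ, hP.map φ, by rwa [eval₂_map]⟩

variable (R : Type) [CommRing R] {m n a b : ℕ}

lemma chartToCoord_comp_ofPoly :
    (chartToCoord R m n a).comp (ChartRing.ofPoly R m (chartH n a false) (chartG n false)) =
      AdjoinRoot.of _ := by
  refine Polynomial.ringHom_ext' ?_ ?_
  · have := ChartRing.lift_comp_base (coordBase R m n) (coordT R m n) (coordY R m n)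
      (h := chartH n a false) (g := chartG n false)
      (by rw [intEval_chartG_false]; exact isUnit_one) (by rw [intEval_chartH_false, coordY_pow])
    exact this
  · have := ChartRing.lift_z (coordBase R m n) (coordT R m n) (coordY R m n)
      (h := chartH n a false) (g := chartG n false)
      (by rw [intEval_chartG_false]; exact isUnit_one) (by rw [intEval_chartH_false, coordY_pow])
    exact this

/-- The coordinate ring is already integral over `R[t]`, so over the finite part of the line the
normalization is the affine curve itself. -/
lemma exists_affine_chart [IsNoetherianRing R] (hm : m ≠ 0) :
    ∃ (i : Spec (.of (CurveChart R m n a false)) ⟶ (affineToProjLine R m n).normalization)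
      (_ : IsOpenImmersion i), i ≫ (affineToProjLine R m n).fromNormalization =
        Spec.map (CommRingCat.ofHom (ChartRing.ofPoly _ _ _ _)) ≫ chartZero R ∧
      Spec.map (CommRingCat.ofHom (chartToCoord R m n a)) ≫ i =
        (affineToProjLine R m n).toNormalization ∧
      i.opensRange = (affineToProjLine R m n).fromNormalization ⁻¹ᵁ chartZero R ''ᵁ ⊤ := by
  have h := exists_normalization_chart (affineToProjLine R m n) (𝟙 _) (chartZero R)
    (CommRingCat.ofHom (ChartRing.ofPoly R m (chartH n a false) (chartG n false)))
    (CommRingCat.ofHom (chartToCoord R m n a)) ?_ ?_ ?_ ?_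
  · obtain ⟨i, hi, h1, h2, h3⟩ := h
    exact ⟨i, hi, h1, by rw [h2, Category.id_comp], h3⟩
  · rw [Category.id_comp, ← CommRingCat.ofHom_comp, chartToCoord_comp_ofPoly]
    rfl
  · ext y
    refine iff_of_true ⟨Spec.map (CommRingCat.ofHom (AdjoinRoot.of _)) y, trivial, ?_⟩
      ⟨y, trivial, rfl⟩
    exact (Scheme.Hom.comp_apply ..).symm
  · exact (coordEquiv R m n a).injective
  · intro y
    obtain ⟨y, rfl⟩ := (coordEquiv R m n a).surjective y
    refine iff_of_true (IsIntegralElem.map_comp (chartToCoord R m n a)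
      (ChartRing.ofPoly_isIntegral R m _ _ hm _ le_rfl ⟨1, ?_⟩ y)) ⟨y, rfl⟩
    rw [intEval_chartG_false, map_one, one_mul]

/-- The localization map from `R[X]` to the base of the chart at infinity. -/
def toAway (n : ℕ) : R[X] →+* Localization.Away (X ^ n + 1 : R[X]) := algebraMap _ _

lemma isUnit_ofPoly : IsUnit (ChartRing.ofPoly R m (chartH n a true) (chartG n true)
    (X ^ n + 1)) := by
  have := ChartRing.isUnit_g R m (chartH n a true) (chartG n true)
  rw [intEval_chartG_true] at this
  rwa [map_add, map_pow, map_one]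

/-- The map from the base of the chart at infinity. -/
def awayToChart (m n a : ℕ) :
    Localization.Away (X ^ n + 1 : R[X]) →+* CurveChart R m n a true :=
  IsLocalization.Away.lift _ (isUnit_ofPoly R)

lemma awayToChart_comp : (awayToChart R m n a).comp (toAway R n) = ChartRing.ofPoly _ _ _ _ :=
  IsLocalization.Away.lift_comp _ (isUnit_ofPoly R)

instance : IsOpenImmersion (Spec.map (CommRingCat.ofHom (toAway R n))) :=
  IsOpenImmersion.of_isLocalization (X ^ n + 1 : R[X])

lemma mem_range_toAway_iff (q : Spec (.of R[X])) :
    q ∈ Set.range (Spec.map (CommRingCat.ofHom (toAway R n))) ↔ X ^ n + 1 ∉ q.asIdeal :=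
  Set.ext_iff.mp (PrimeSpectrum.localization_away_comap_range
    (Localization.Away (X ^ n + 1 : R[X])) (X ^ n + 1 : R[X])) q

lemma mem_range_ofCoord_iff (hb : m * b = n * a + 1) (q : Spec (.of (CoordRing R m n))) :
    q ∈ Set.range (Spec.map (CommRingCat.ofHom (OverlapRing.ofCoord R hb))) ↔
      OverlapRing.locus R m n ∉ q.asIdeal := by
  let _ := (OverlapRing.ofCoord R hb).toAlgebra
  have := OverlapRing.isLocalization_ofCoord R hb
  exact Set.ext_iff.mp (PrimeSpectrum.localization_away_comap_range
    (OverlapRing R m n a) (OverlapRing.locus R m n)) q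

lemma isOpenImmersion_ofCoord (hb : m * b = n * a + 1) :
    IsOpenImmersion (Spec.map (CommRingCat.ofHom (OverlapRing.ofCoord R hb))) := by
  let _ := (OverlapRing.ofCoord R hb).toAlgebra
  have := OverlapRing.isLocalization_ofCoord R hb
  exact IsOpenImmersion.of_isLocalization (OverlapRing.locus R m n)

/-- The normalization criterion is applied over the open set `s ^ n + 1 ≠ 0` of the chart at
infinity. Its preimage in the affine curve is the locus `t * (t ^ n + 1) ≠ 0`, the spectrum of the
overlap ring, and the chart ring is the integral closure in that ring. -/
lemma exists_infinite_chart [IsNoetherianRing R] [IsReduced R] (hm : m ≠ 0)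
    (hn : n ≠ 0) (hb : m * b = n * a + 1) :
    ∃ (i : Spec (.of (CurveChart R m n a true)) ⟶ (affineToProjLine R m n).normalization)
      (_ : IsOpenImmersion i), i ≫ (affineToProjLine R m n).fromNormalization =
        Spec.map (CommRingCat.ofHom (ChartRing.ofPoly _ _ _ _)) ≫ chartInfty R ∧
      Spec.map (CommRingCat.ofHom (OverlapRing.ofChart R m n a)) ≫ i =
        Spec.map (CommRingCat.ofHom (OverlapRing.ofCoord R hb)) ≫
          (affineToProjLine R m n).toNormalization ∧
      i.opensRange = (affineToProjLine R m n).fromNormalization ⁻¹ᵁ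
        (Spec.map (CommRingCat.ofHom (toAway R n)) ≫ chartInfty R) ''ᵁ ⊤ := by
  have := isOpenImmersion_ofCoord R hb
  have hx := ChartRing.x_mem_nonZeroDivisors R a hm hn
  have hw : Spec.map (CommRingCat.ofHom (OverlapRing.ofCoord R hb)) ≫ affineToProjLine R m n =
      Spec.map (CommRingCat.ofHom ((OverlapRing.ofChart R m n a).comp (awayToChart R m n a))) ≫
        Spec.map (CommRingCat.ofHom (toAway R n)) ≫ chartInfty R := by
    rw [affineToProjLine, ← Category.assoc, ← Category.assoc,
      ← Spec.map_comp, ← Spec.map_comp, ← CommRingCat.ofHom_comp, ← CommRingCat.ofHom_comp,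
      RingHom.comp_assoc _ (awayToChart R m n a), awayToChart_comp]
    refine (chart_overlap_iff (A := .of (OverlapRing R m n a)) _ _).mpr ?_
    exact ⟨OverlapRing.ofCoord_comp_coordBase R hb, OverlapRing.ofCoord_coordT_mul R hb⟩
  have h := exists_normalization_chart (affineToProjLine R m n)
    (Spec.map (CommRingCat.ofHom (OverlapRing.ofCoord R hb)))
    (Spec.map (CommRingCat.ofHom (toAway R n)) ≫ chartInfty R)
    (CommRingCat.ofHom (awayToChart R m n a))
    (CommRingCat.ofHom (OverlapRing.ofChart R m n a)) ?_ ?_ ?_ ?_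
  · obtain ⟨i, hi, h1, h2, h3⟩ := h
    refine ⟨i, hi, ?_, h2, h3⟩
    rw [h1, ← Category.assoc, ← Spec.map_comp, ← CommRingCat.ofHom_comp, awayToChart_comp]
  · rw [hw, ← CommRingCat.ofHom_comp]
  · ext y
    have hy : y.asIdeal.IsPrime := y.isPrime
    have hf : affineToProjLine R m n y =
      chartZero R (Spec.map (CommRingCat.ofHom (AdjoinRoot.of _)) y) := Scheme.Hom.comp_apply ..
    constructor
    · rintro ⟨q, -, hq⟩
      replace hq := (Scheme.Hom.comp_apply ..).symm.trans (hq.trans hf)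
      obtain ⟨r, h0, h1⟩ := (chartZero_eq_chartInfty_iff R _ _).mp hq.symm
      obtain ⟨y', rfl⟩ := (mem_range_ofCoord_iff R hb y).mpr (by
        have hr : r.asIdeal.IsPrime := r.isPrime
        have hX := toLaurentZero_X_mul R
        have h2 : X ^ n + 1 ∉ (Spec.map (CommRingCat.ofHom (toLaurentInfty R)) r).asIdeal :=
          (mem_range_toAway_iff R _).mp ⟨q, h1.symm⟩
        have h3 : X * (X ^ n + 1) ∉
            (Spec.map (CommRingCat.ofHom (AdjoinRoot.of _)) y).asIdeal := by
          rw [← h0]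
          intro h4
          apply h2
          change toLaurentZero R (X * (X ^ n + 1)) ∈ r.asIdeal at h4
          change toLaurentInfty R (X ^ n + 1) ∈ r.asIdeal
          rw [map_mul, map_add, map_pow, map_one] at h4
          rw [map_add, map_pow, map_one]
          -- With `s = t⁻¹`, the factor `s ^ (n + 1)` turns `t * (t ^ n + 1)` into `s ^ n + 1`.
          have h5 := r.asIdeal.mul_mem_left (toLaurentInfty R X ^ (n + 1)) h4
          have h6 : toLaurentZero R X ^ n * toLaurentInfty R X ^ n = 1 := by
            rw [← mul_pow, hX, one_pow]
          have h7 : toLaurentInfty R X ^ (n + 1) * (toLaurentZero R X *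
              (toLaurentZero R X ^ n + 1)) = toLaurentInfty R X ^ n + 1 := by
            linear_combination (toLaurentInfty R X ^ n + toLaurentZero R X ^ n *
              toLaurentInfty R X ^ n) * hX + h6
          rwa [h7] at h5
        intro h4
        apply h3
        change AdjoinRoot.of _ (X * (X ^ n + 1)) ∈ y.asIdeal
        convert h4 using 1
        rw [OverlapRing.locus, coordT, map_mul]
        simp)
      exact ⟨y', trivial, rfl⟩
    · rintro ⟨y', -, rfl⟩
      refine ⟨Spec.map (CommRingCat.ofHom ((OverlapRing.ofChart R m n a).comp
        (awayToChart R m n a))) y', trivial, ?_⟩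
      refine (Scheme.Hom.comp_apply ..).symm.trans (Eq.trans ?_ (Scheme.Hom.comp_apply ..))
      exact congr($hw.symm y')
  · exact IsLocalization.injective (OverlapRing R m n a) (Submonoid.powers_le.mpr hx)
  · intro y
    constructor
    · intro hy
      exact mem_range_of_isIntegralElem_away _ hx (ChartRing.x_dvd_of_dvd_pow R a hm hn) y
        (IsIntegralElem.of_comp _ hy)
    · rintro ⟨y, rfl⟩
      refine IsIntegralElem.map_comp (OverlapRing.ofChart R m n a)
        (ChartRing.ofPoly_isIntegral R m _ _ hm _ ?_ ?_ y)
      · rintro _ ⟨c, rfl⟩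
        exact ⟨toAway R n c, congr($(awayToChart_comp R) c)⟩
      · obtain ⟨c, hc⟩ := (IsLocalization.Away.algebraMap_isUnit
          (S := Localization.Away (X ^ n + 1 : R[X])) (X ^ n + 1 : R[X])).exists_left_inv
        refine ⟨c, ?_⟩
        rw [← map_one (awayToChart R m n a), ← hc, map_mul, intEval_chartG_true]
        have : awayToChart R m n a (algebraMap _ _ (X ^ n + 1)) = ChartRing.ofPoly _ _ _ _ _ :=
          congr($(awayToChart_comp R) (X ^ n + 1))
        rw [this, map_add, map_pow, map_one]
        rfl

end CurveCharts

/-! ### Atlases of the curve and of its base changes -/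

section Atlas

namespace OverlapRing

variable {R : Type} [CommRing R] {m n a b : ℕ} {A : Type} [CommRing A]

lemma exists_comp_ofCoord_eq (hb : m * b = n * a + 1) (φ : CoordRing R m n →+* A) (s : A)
    (hs : φ (coordT R m n) * s = 1) (hu : IsUnit (s ^ n + 1)) :
    ∃ χ : OverlapRing R m n a →+* A, χ.comp (ofCoord R hb) = φ := by
  let _ := (ofCoord R hb).toAlgebra
  have := isLocalization_ofCoord R hb
  have h1 : φ (coordT R m n) ^ n * s ^ n = 1 := by rw [← mul_pow, hs, one_pow]
  have h2 : IsUnit (φ (locus R m n)) := by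
    have h3 : φ (locus R m n) = φ (coordT R m n) * (φ (coordT R m n) ^ n * (s ^ n + 1)) := by
      rw [locus, map_mul φ, map_add φ, map_pow φ, map_one φ]
      linear_combination -φ (coordT R m n) * h1
    rw [h3]
    exact (IsUnit.of_mul_eq_one _ hs).mul ((IsUnit.of_mul_eq_one _ h1).mul hu)
  exact ⟨IsLocalization.Away.lift (locus R m n) h2, IsLocalization.Away.lift_comp _ h2⟩

end OverlapRing

/-- The map `R[X] → S[z][x]_g / (x ^ m - h(z))` sending `X` to `z`. -/
def lineToChart {R S : Type} [CommRing R] [CommRing S] (ρ : R →+* S) (m n a : ℕ) (k : Bool) :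
    R[X] →+* CurveChart S m n a k :=
  eval₂RingHom ((ChartRing.base _ _ _ _).comp ρ) (ChartRing.z _ _ _ _)

/-- A description by two charts of an `S`-scheme `E` over the projective line over `R`, which is
satisfied by the complete curve and its base changes. -/
structure CurveAtlas {R S : Type} [CommRing R] [CommRing S] (ρ : R →+* S) (m n a b : ℕ)
    (E : Over (Spec (.of S))) (π : E.left ⟶ projLine R) where
  chart (k : Bool) : Spec (.of (CurveChart S m n a k)) ⟶ E.left
  isOpenImmersion (k : Bool) : IsOpenImmersion (chart k)
  chart_hom (k : Bool) :
    chart k ≫ E.hom = Spec.map (CommRingCat.ofHom (ChartRing.base S m (chartH n a k) (chartG n k)))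
  chart_comp (k : Bool) :
    chart k ≫ π = Spec.map (CommRingCat.ofHom (lineToChart ρ m n a k)) ≫ lineChart R k
  exists_chart_eq (y : E.left) : ∃ k q, chart k q = y
  mem_range_iff (y : E.left) : y ∈ Set.range (chart false) ↔ π y ∈ Set.range (chartZero R)
  overlap_iff {A : Type} [CommRing A] (φ₀ : CurveChart S m n a false →+* A)
    (φ₁ : CurveChart S m n a true →+* A) :
    Spec.map (CommRingCat.ofHom φ₀) ≫ chart false = Spec.map (CommRingCat.ofHom φ₁) ≫ chart true ↔
      φ₀.comp (ChartRing.base _ _ _ _) = φ₁.comp (ChartRing.base _ _ _ _) ∧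
      φ₀ (ChartRing.z _ _ _ _) * φ₁ (ChartRing.z _ _ _ _) = 1 ∧
      φ₁ (ChartRing.x _ _ _ _) = φ₀ (ChartRing.x _ _ _ _) ^ a * φ₁ (ChartRing.z _ _ _ _) ^ b

attribute [instance] CurveAtlas.isOpenImmersion

lemma lineToChart_id (R : Type) [CommRing R] (m n a : ℕ) (k : Bool) :
    lineToChart (RingHom.id R) m n a k = ChartRing.ofPoly _ _ _ _ :=
  Polynomial.ringHom_ext' (by ext; simp [lineToChart, ChartRing.base])
    (by simp [lineToChart, ChartRing.z])

lemma isUnit_chart_z_pow_add_one {S : Type} [CommRing S] {m n a : ℕ} {A : Type} [CommRing A]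
    (φ : CurveChart S m n a true →+* A) : IsUnit (φ (ChartRing.z _ _ _ _) ^ n + 1) := by
  have := (ChartRing.isUnit_g S m (chartH n a true) (chartG n true)).map φ
  rwa [map_intEval, intEval_chartG_true] at this

lemma exists_curveAtlas (R : Type) [CommRing R] [IsNoetherianRing R] [IsReduced R] {m n a b : ℕ}
    (hm : m ≠ 0) (hn : n ≠ 0) (hb : m * b = n * a + 1) :
    ∃ 𝔸 : CurveAtlas (RingHom.id R) m n a b (curve R m n)
        (affineToProjLine R m n).fromNormalization,
      Spec.map (CommRingCat.ofHom (chartToCoord R m n a)) ≫ 𝔸.chart false =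
        (affineToProjLine R m n).toNormalization := by
  obtain ⟨i₀, hi₀, hp₀, ht₀, hr₀⟩ := exists_affine_chart R (n := n) (a := a) hm
  obtain ⟨i₁, hi₁, hp₁, ht₁, hr₁⟩ := exists_infinite_chart R hm hn hb
  have hz : ∀ y, y ∈ Set.range i₀ ↔
      (affineToProjLine R m n).fromNormalization y ∈ Set.range (chartZero R) := by
    intro y
    have : y ∈ i₀.opensRange ↔
        y ∈ (affineToProjLine R m n).fromNormalization ⁻¹ᵁ chartZero R ''ᵁ ⊤ := by rw [hr₀]
    refine this.trans ⟨?_, ?_⟩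
    · rintro ⟨q, -, hq⟩
      exact ⟨q, hq⟩
    · rintro ⟨q, hq⟩
      exact ⟨q, trivial, hq⟩
  refine ⟨⟨fun | false => i₀ | true => i₁, ?_, ?_, ?_, ?_, hz, ?_⟩, ht₀⟩
  · rintro (_ | _)
    exacts [hi₀, hi₁]
  · rintro (_ | _)
    · change i₀ ≫ (affineToProjLine R m n).fromNormalization ≫ projLineStr R = _
      rw [← Category.assoc, hp₀, Category.assoc]
      erw [lineChart_str R false]
      rw [← Spec.map_comp]
      rfl
    · change i₁ ≫ (affineToProjLine R m n).fromNormalization ≫ projLineStr R = _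
      rw [← Category.assoc, hp₁, Category.assoc]
      erw [lineChart_str R true]
      rw [← Spec.map_comp]
      rfl
  · rintro (_ | _)
    · rw [lineToChart_id]
      exact hp₀
    · rw [lineToChart_id]
      exact hp₁
  · intro (y : (affineToProjLine R m n).normalization)
    by_cases hy : y ∈ Set.range i₀
    · exact ⟨false, hy⟩
    · refine ⟨true, ?_⟩
      rcases exists_chart_eq R ((affineToProjLine R m n).fromNormalization y) with h | ⟨q, h⟩
      · exact absurd ((hz y).mpr h) hy
      -- The point lies over infinity, where `s = 0`; hence `s ^ n + 1` does not vanish there and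
      -- the point is in the second chart.
      · rw [hz, ← h, chartInfty_mem_range_iff, not_not] at hy
        have hq := q.isPrime
        obtain ⟨q', rfl⟩ := (mem_range_toAway_iff R (n := n) q).mpr fun h1 => hq.ne_top (by
          rw [Ideal.eq_top_iff_one]
          exact (Ideal.add_mem_iff_right _ (Ideal.pow_mem_of_mem _ hy n
            (Nat.pos_of_ne_zero hn))).mp h1)
        change y ∈ i₁.opensRange
        rw [hr₁]
        exact ⟨q', trivial, (Scheme.Hom.comp_apply ..).trans h⟩
  · intro A _ φ₀ φ₁
    change Spec.map (CommRingCat.ofHom φ₀) ≫ i₀ = Spec.map (CommRingCat.ofHom φ₁) ≫ i₁ ↔ _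
    -- If the two `z`-coordinates are inverse to each other, the point of the affine curve factors
    -- through the overlap ring, and so becomes a point of the chart at infinity. It remains to
    -- compare coordinates there.
    have hχ : φ₀ (ChartRing.z _ _ _ _) * φ₁ (ChartRing.z _ _ _ _) = 1 →
        ∃ χ : OverlapRing R m n a →+* A,
          χ.comp (OverlapRing.ofCoord R hb) = φ₀.comp (coordToChart R m n a) ∧
          Spec.map (CommRingCat.ofHom φ₀) ≫ i₀ =
            Spec.map (CommRingCat.ofHom (χ.comp (OverlapRing.ofChart R m n a))) ≫ i₁ := by
      intro h
      obtain ⟨χ, hχ⟩ := OverlapRing.exists_comp_ofCoord_eq hb (φ₀.comp (coordToChart R m n a))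
        (φ₁ (ChartRing.z _ _ _ _)) (by
          rw [RingHom.comp_apply, coordToChart, coordLift_coordT, h])
        (isUnit_chart_z_pow_add_one φ₁)
      refine ⟨χ, hχ, ?_⟩
      rw [CommRingCat.ofHom_comp, Spec.map_comp, Category.assoc, ht₁, ← ht₀, ← Category.assoc,
        ← Category.assoc, ← Spec.map_comp, ← Spec.map_comp, ← CommRingCat.ofHom_comp,
        ← CommRingCat.ofHom_comp, hχ, RingHom.comp_assoc, coordToChart_comp, RingHom.comp_id]
    have hx : ∀ χ : OverlapRing R m n a →+* A,
        χ.comp (OverlapRing.ofCoord R hb) = φ₀.comp (coordToChart R m n a) →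
        χ (OverlapRing.ofChart R m n a (ChartRing.x _ _ _ _)) = φ₀ (ChartRing.x _ _ _ _) ^ a *
          χ (OverlapRing.ofChart R m n a (ChartRing.z _ _ _ _)) ^ b := by
      intro χ hχ
      rw [← OverlapRing.ofCoord_coordY_mul R hb, map_mul, map_pow, map_pow]
      have := congr($hχ (coordY R m n))
      rw [RingHom.comp_apply, RingHom.comp_apply, coordToChart, coordLift_coordY] at this
      rw [this]
    constructor
    · intro h
      have h1 := congr($h ≫ (affineToProjLine R m n).fromNormalization)
      rw [Category.assoc, Category.assoc, hp₀, hp₁, ← Category.assoc, ← Category.assoc,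
        ← Spec.map_comp, ← Spec.map_comp, ← CommRingCat.ofHom_comp, ← CommRingCat.ofHom_comp] at h1
      obtain ⟨hc, hz⟩ := (chart_overlap_iff (A := .of A) _ _).mp h1
      obtain ⟨χ, h2, h3⟩ := hχ hz
      rw [h3] at h
      have h4 : χ.comp (OverlapRing.ofChart R m n a) = φ₁ :=
        congrArg CommRingCat.Hom.hom (Spec.map_injective ((cancel_mono i₁).mp h))
      refine ⟨hc, hz, ?_⟩
      rw [← h4]
      exact hx χ h2
    · rintro ⟨hc, hz, hx'⟩
      obtain ⟨χ, h2, h3⟩ := hχ hz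
      rw [h3]
      have h5 : φ₀ (ChartRing.z _ _ _ _) *
          χ (OverlapRing.ofChart R m n a (ChartRing.z _ _ _ _)) = 1 := by
        have h6 := congrArg χ (OverlapRing.ofCoord_coordT_mul R hb)
        have h7 := congr($h2 (coordT R m n))
        rw [RingHom.comp_apply, RingHom.comp_apply, coordToChart, coordLift_coordT] at h7
        rwa [map_mul, h7, map_one] at h6
      have h8 : χ (OverlapRing.ofChart R m n a (ChartRing.z _ _ _ _)) =
          φ₁ (ChartRing.z _ _ _ _) := by
        linear_combination φ₁ (ChartRing.z _ _ _ _) * h5 -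
          χ (OverlapRing.ofChart R m n a (ChartRing.z _ _ _ _)) * hz
      have h4 : χ.comp (OverlapRing.ofChart R m n a) = φ₁ := by
        refine ChartRing.hom_ext ?_ h8 ?_
        · rw [RingHom.comp_assoc, ← OverlapRing.ofCoord_comp_coordBase R hb, ← RingHom.comp_assoc,
            h2, ← hc, RingHom.comp_assoc, coordToChart, coordLift_comp_coordBase]
        · rw [RingHom.comp_apply, hx χ h2, hx', h8]
      rw [h4]

namespace CurveAtlas

variable {R S S' : Type} [CommRing R] [CommRing S] [CommRing S'] {ρ : R →+* S} {m n a b : ℕ}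
  {E : Over (Spec (.of S))} {π : E.left ⟶ projLine R} (𝔸 : CurveAtlas ρ m n a b E π)
  (ψ : S →+* S')

lemma baseChange_condition (k : Bool) :
    (Spec.map (CommRingCat.ofHom (ChartRing.map ψ m (chartH n a k) (chartG n k))) ≫ 𝔸.chart k) ≫
        E.hom = Spec.map (CommRingCat.ofHom (ChartRing.base S' m (chartH n a k) (chartG n k))) ≫
      Spec.map (CommRingCat.ofHom ψ) := by
  rw [Category.assoc, chart_hom, ← Spec.map_comp, ← Spec.map_comp, ← CommRingCat.ofHom_comp,
    ← CommRingCat.ofHom_comp, ChartRing.map_comp_base]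

/-- The charts of the base change. -/
def baseChangeChart (k : Bool) : Spec (.of (CurveChart S' m n a k)) ⟶
    pullback E.hom (Spec.map (CommRingCat.ofHom ψ)) :=
  pullback.lift (Spec.map (CommRingCat.ofHom (ChartRing.map ψ m (chartH n a k) (chartG n k))) ≫
    𝔸.chart k) (Spec.map (CommRingCat.ofHom (ChartRing.base S' m (chartH n a k) (chartG n k))))
    (𝔸.baseChange_condition ψ k)

lemma baseChangeChart_fst (k : Bool) : 𝔸.baseChangeChart ψ k ≫ pullback.fst _ _ =
    Spec.map (CommRingCat.ofHom (ChartRing.map ψ m (chartH n a k) (chartG n k))) ≫ 𝔸.chart k :=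
  pullback.lift_fst _ _ _

lemma baseChangeChart_snd (k : Bool) : 𝔸.baseChangeChart ψ k ≫ pullback.snd _ _ =
    Spec.map (CommRingCat.ofHom (ChartRing.base S' m (chartH n a k) (chartG n k))) :=
  pullback.lift_snd _ _ _

/-- Pasting: the outer square is the pushout of chart rings, the right one is the base change of
`E`. Open immersion and range of the new chart follow from it. -/
lemma isPullback_baseChangeChart (k : Bool) :
    IsPullback (𝔸.baseChangeChart ψ k)
      (Spec.map (CommRingCat.ofHom (ChartRing.map ψ m (chartH n a k) (chartG n k))))
      (pullback.fst E.hom (Spec.map (CommRingCat.ofHom ψ))) (𝔸.chart k) := by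
  refine IsPullback.of_right (h₁₂ := pullback.snd _ _) (h₂₂ := E.hom)
    (v₁₃ := Spec.map (CommRingCat.ofHom ψ)) ?_ (𝔸.baseChangeChart_fst ψ k)
    (IsPullback.of_hasPullback _ _).flip
  rw [baseChangeChart_snd, chart_hom]
  exact (isPullback_SpecMap_of_isPushout _ _ _ _ (ChartRing.isPushout_map ψ)).flip

lemma range_baseChangeChart (k : Bool) : Set.range (𝔸.baseChangeChart ψ k) =
    pullback.fst E.hom (Spec.map (CommRingCat.ofHom ψ)) ⁻¹' Set.range (𝔸.chart k) := by
  rw [← Scheme.Pullback.range_fst, ← (𝔸.isPullback_baseChangeChart ψ k).isoPullback_hom_fst]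
  ext y
  constructor
  · rintro ⟨q, rfl⟩
    exact ⟨_, (Scheme.Hom.comp_apply ..).symm⟩
  · rintro ⟨q, rfl⟩
    obtain ⟨q, rfl⟩ := (𝔸.isPullback_baseChangeChart ψ k).isoPullback.hom.surjective q
    exact ⟨q, Scheme.Hom.comp_apply ..⟩

/-- The atlas of the base change. -/
def baseChange : CurveAtlas (ψ.comp ρ) m n a b
    ((Over.pullback (Spec.map (CommRingCat.ofHom ψ))).obj E)
    (pullback.fst E.hom (Spec.map (CommRingCat.ofHom ψ)) ≫ π) where
  chart := 𝔸.baseChangeChart ψ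
  isOpenImmersion k := MorphismProperty.of_isPullback (P := @IsOpenImmersion)
    (𝔸.isPullback_baseChangeChart ψ k).flip (𝔸.isOpenImmersion k)
  chart_hom k := 𝔸.baseChangeChart_snd ψ k
  chart_comp k := by
    rw [← Category.assoc, baseChangeChart_fst, Category.assoc, chart_comp, ← Category.assoc,
      ← Spec.map_comp, ← CommRingCat.ofHom_comp]
    congr 3
    refine Polynomial.ringHom_ext' ?_ ?_
    · ext r
      simp [lineToChart]
    · simp [lineToChart]
  exists_chart_eq y := by
    obtain ⟨k, q, h⟩ := 𝔸.exists_chart_eq (pullback.fst E.hom (Spec.map (CommRingCat.ofHom ψ)) y)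
    have : y ∈ Set.range (𝔸.baseChangeChart ψ k) := by
      rw [range_baseChangeChart]
      exact ⟨q, h⟩
    exact ⟨k, this⟩
  mem_range_iff y := by
    rw [range_baseChangeChart, Set.mem_preimage, 𝔸.mem_range_iff, Scheme.Hom.comp_apply]
  overlap_iff {A} _ φ₀ φ₁ := by
    have h₀ := 𝔸.baseChangeChart_fst ψ false
    have h₁ := 𝔸.baseChangeChart_fst ψ true
    have h₀' := 𝔸.baseChangeChart_snd ψ false
    have h₁' := 𝔸.baseChangeChart_snd ψ true
    have key := 𝔸.overlap_iff (φ₀.comp (ChartRing.map ψ m (chartH n a false) (chartG n false)))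
      (φ₁.comp (ChartRing.map ψ m (chartH n a true) (chartG n true)))
    simp only [RingHom.comp_apply, ChartRing.map_z, ChartRing.map_x] at key
    constructor
    · intro h
      have e₁ := congr($h ≫ pullback.fst _ _)
      have e₂ := congr($h ≫ pullback.snd _ _)
      rw [Category.assoc, Category.assoc, h₀, h₁, ← Category.assoc, ← Category.assoc,
        ← Spec.map_comp, ← Spec.map_comp, ← CommRingCat.ofHom_comp, ← CommRingCat.ofHom_comp] at e₁
      rw [Category.assoc, Category.assoc, h₀', h₁', ← Spec.map_comp, ← Spec.map_comp] at e₂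
      exact ⟨congrArg CommRingCat.Hom.hom (Spec.map_injective e₂), (key.mp e₁).2⟩
    · rintro ⟨hc, hr⟩
      apply pullback.hom_ext
      · rw [Category.assoc, Category.assoc, h₀, h₁, ← Category.assoc, ← Category.assoc,
          ← Spec.map_comp, ← Spec.map_comp, ← CommRingCat.ofHom_comp, ← CommRingCat.ofHom_comp,
          key]
        refine ⟨?_, hr⟩
        rw [RingHom.comp_assoc, RingHom.comp_assoc, ChartRing.map_comp_base,
          ChartRing.map_comp_base, ← RingHom.comp_assoc, ← RingHom.comp_assoc, hc]
      · rw [Category.assoc, Category.assoc, h₀', h₁', ← Spec.map_comp, ← Spec.map_comp,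
          ← CommRingCat.ofHom_comp, ← CommRingCat.ofHom_comp, hc]

end CurveAtlas

end Atlas

/-! ### Gluing endomorphisms; rotations and the Frobenius -/

section Endomorphisms

namespace CurveAtlas

variable {R S : Type} [CommRing R] [CommRing S] {ρ : R →+* S} {m n a b : ℕ}
  {E : Over (Spec (.of S))} {π : E.left ⟶ projLine R} (𝔸 : CurveAtlas ρ m n a b E π)

/-- The cover by the two charts. -/
def cover : E.left.OpenCover :=
  Scheme.Cover.mkOfCovers Bool (fun k => Spec (.of (CurveChart S m n a k))) 𝔸.chart
    𝔸.exists_chart_eq 𝔸.isOpenImmersion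

lemma hom_ext {Z : Scheme.{0}} {f g : E.left ⟶ Z} (h : ∀ k, 𝔸.chart k ≫ f = 𝔸.chart k ≫ g) :
    f = g :=
  Scheme.Cover.hom_ext 𝔸.cover f g h

/-- With two charts only one overlap has to be checked, and it is covered by affines, so ring-valued
points detect equality on it. -/
lemma exists_glue {Z : Scheme.{0}} (F : ∀ k, Spec (.of (CurveChart S m n a k)) ⟶ Z)
    (hF : ∀ (A : Type) [CommRing A] (φ₀ : CurveChart S m n a false →+* A)
      (φ₁ : CurveChart S m n a true →+* A), Spec.map (CommRingCat.ofHom φ₀) ≫ 𝔸.chart false =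
        Spec.map (CommRingCat.ofHom φ₁) ≫ 𝔸.chart true →
      Spec.map (CommRingCat.ofHom φ₀) ≫ F false = Spec.map (CommRingCat.ofHom φ₁) ≫ F true) :
    ∃ f : E.left ⟶ Z, ∀ k, 𝔸.chart k ≫ f = F k := by
  have hdiag : ∀ k, pullback.fst (𝔸.chart k) (𝔸.chart k) ≫ F k =
      pullback.snd (𝔸.chart k) (𝔸.chart k) ≫ F k := fun k => by
    rw [(cancel_mono (𝔸.chart k)).mp pullback.condition]
  have hoff : pullback.fst (𝔸.chart false) (𝔸.chart true) ≫ F false =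
      pullback.snd (𝔸.chart false) (𝔸.chart true) ≫ F true := by
    have key : ∀ (A : CommRingCat.{0}) (u : Spec A ⟶ pullback (𝔸.chart false) (𝔸.chart true)),
        u ≫ pullback.fst _ _ ≫ F false = u ≫ pullback.snd _ _ ≫ F true := fun A u => by
      obtain ⟨φ₀, h₀⟩ := Spec.map_surjective (u ≫ pullback.fst _ _)
      obtain ⟨φ₁, h₁⟩ := Spec.map_surjective (u ≫ pullback.snd _ _)
      rw [← Category.assoc, ← Category.assoc, ← h₀, ← h₁]
      refine hF _ φ₀.hom φ₁.hom ?_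
      change Spec.map φ₀ ≫ _ = Spec.map φ₁ ≫ _
      rw [h₀, h₁, Category.assoc, Category.assoc, pullback.condition]
    exact Scheme.Cover.hom_ext (pullback (𝔸.chart false) (𝔸.chart true)).affineCover _ _
      fun i => key _ _
  refine ⟨Scheme.Cover.glueMorphisms 𝔸.cover F ?_,
    Scheme.Cover.ι_glueMorphisms 𝔸.cover F _⟩
  rintro (_ | _) (_ | _)
  · exact hdiag false
  · exact hoff
  · have := congr((pullbackSymmetry (𝔸.chart false) (𝔸.chart true)).inv ≫ $hoff)
    rw [← Category.assoc, ← Category.assoc, pullbackSymmetry_inv_comp_fst,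
      pullbackSymmetry_inv_comp_snd] at this
    exact this.symm
  · exact hdiag true

end CurveAtlas

/-- The exponents with which the rotation acts on the coordinate `x` of the two charts. -/
def rotExponent (a : ℕ) : Bool → ℕ
  | false => 1
  | true => a

/-- The action of a rotation on the charts. -/
def rotChart {S : Type} [CommRing S] {m : ℕ} (n a : ℕ) {ζ : S} (hζ : ζ ^ m = 1) (k : Bool) :
    CurveChart S m n a k →+* CurveChart S m n a k :=
  ChartRing.lift (ChartRing.base _ _ _ _) (ChartRing.z _ _ _ _)
    (ChartRing.base _ _ _ _ (ζ ^ rotExponent a k) * ChartRing.x _ _ _ _)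
    (ChartRing.isUnit_g ..) (by
      rw [mul_pow, ← map_pow, ← pow_mul, mul_comm (rotExponent a k), pow_mul, hζ, one_pow, map_one,
        one_mul, ChartRing.x_pow])

section

variable {S : Type} [CommRing S] {m : ℕ} (n a : ℕ) {ζ : S} (hζ : ζ ^ m = 1) (k : Bool)

lemma rotChart_comp_base : (rotChart n a hζ k).comp (ChartRing.base _ _ _ _) =
    ChartRing.base _ _ _ _ := ChartRing.lift_comp_base ..

lemma rotChart_base (s : S) : rotChart n a hζ k (ChartRing.base _ _ _ _ s) =
    ChartRing.base _ _ _ _ s := ChartRing.lift_base ..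

lemma rotChart_z : rotChart n a hζ k (ChartRing.z _ _ _ _) = ChartRing.z _ _ _ _ :=
  ChartRing.lift_z ..

lemma rotChart_x : rotChart n a hζ k (ChartRing.x _ _ _ _) =
    ChartRing.base _ _ _ _ (ζ ^ rotExponent a k) * ChartRing.x _ _ _ _ := ChartRing.lift_x ..

lemma rotChart_comp {ζ' : S} (hζ' : ζ' ^ m = 1) (h : (ζ * ζ') ^ m = 1) :
    (rotChart n a hζ k).comp (rotChart n a hζ' k) = rotChart n a h k := by
  refine ChartRing.hom_ext ?_ ?_ ?_
  · rw [RingHom.comp_assoc, rotChart_comp_base, rotChart_comp_base, rotChart_comp_base]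
  · rw [RingHom.comp_apply, rotChart_z, rotChart_z, rotChart_z]
  · rw [RingHom.comp_apply, rotChart_x, rotChart_x, map_mul, rotChart_base, rotChart_x, mul_pow,
      map_mul]
    ring

lemma rotChart_one (h : (1 : S) ^ m = 1) : rotChart n a h k = RingHom.id _ := by
  refine ChartRing.hom_ext ?_ ?_ ?_
  · rw [rotChart_comp_base]
    rfl
  · rw [rotChart_z]
    rfl
  · rw [rotChart_x, one_pow, map_one, one_mul]
    rfl

end

namespace CurveAtlas

variable {R S : Type} [CommRing R] [CommRing S] {ρ : R →+* S} {m n a b : ℕ}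
  {E : Over (Spec (.of S))} {π : E.left ⟶ projLine R} (𝔸 : CurveAtlas ρ m n a b E π)

/-- Since `x = y ^ a * z ^ b` at infinity, multiplying `y` by `ζ` multiplies `x` by `ζ ^ a` there.
-/
lemma exists_rotation {ζ : S} (hζ : ζ ^ m = 1) :
    ∃ f : E ⟶ E, ∀ k, 𝔸.chart k ≫ f.left =
      Spec.map (CommRingCat.ofHom (rotChart n a hζ k)) ≫ 𝔸.chart k := by
  obtain ⟨f, hf⟩ := 𝔸.exists_glue
    (fun k => Spec.map (CommRingCat.ofHom (rotChart n a hζ k)) ≫ 𝔸.chart k) (by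
      intro A _ φ₀ φ₁ h
      obtain ⟨h1, h2, h3⟩ := (𝔸.overlap_iff φ₀ φ₁).mp h
      rw [← Category.assoc, ← Category.assoc, ← Spec.map_comp, ← Spec.map_comp,
        ← CommRingCat.ofHom_comp, ← CommRingCat.ofHom_comp, 𝔸.overlap_iff]
      refine ⟨?_, ?_, ?_⟩
      · rw [RingHom.comp_assoc, RingHom.comp_assoc, rotChart_comp_base, rotChart_comp_base, h1]
      · rw [RingHom.comp_apply, RingHom.comp_apply, rotChart_z, rotChart_z, h2]
      · rw [RingHom.comp_apply, RingHom.comp_apply, RingHom.comp_apply, rotChart_z, rotChart_x,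
          rotChart_x, map_mul, map_mul, h3]
        have := congr($h1 (ζ ^ a))
        rw [RingHom.comp_apply, RingHom.comp_apply] at this
        change φ₁ (ChartRing.base _ _ _ _ (ζ ^ a)) * _ =
          (φ₀ (ChartRing.base _ _ _ _ (ζ ^ 1)) * _) ^ a * _
        rw [← this, mul_pow, pow_one, map_pow (ChartRing.base _ _ _ _), map_pow φ₀]
        ring)
  refine ⟨Over.homMk f (𝔸.hom_ext fun k => ?_), hf⟩
  rw [← Category.assoc, hf, Category.assoc, 𝔸.chart_hom, ← Spec.map_comp, ← CommRingCat.ofHom_comp,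
    rotChart_comp_base]

lemma exists_aut (hm : m ≠ 0) {ζ : S} (hζ : ζ ^ m = 1) :
    ∃ σ : Aut E, ∀ j k, 𝔸.chart k ≫ (σ ^ j).hom.left =
      Spec.map (CommRingCat.ofHom (rotChart n a (ζ := ζ ^ j)
        (by rw [← pow_mul, mul_comm, pow_mul, hζ, one_pow]) k)) ≫ 𝔸.chart k := by
  have hpow : ∀ j, (ζ ^ j) ^ m = 1 := fun j => by rw [← pow_mul, mul_comm, pow_mul, hζ, one_pow]
  obtain ⟨f, hf⟩ := 𝔸.exists_rotation hζ
  -- The inverse is the rotation by `ζ ^ (m - 1) = ζ⁻¹`.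
  obtain ⟨g, hg⟩ := 𝔸.exists_rotation (hpow (m - 1))
  have hmul : ζ * ζ ^ (m - 1) = 1 := by
    rw [← pow_succ', Nat.sub_add_cancel (Nat.pos_of_ne_zero hm), hζ]
  have hfg : ∀ k, 𝔸.chart k ≫ (f ≫ g).left = 𝔸.chart k ≫ (𝟙 E : E ⟶ E).left := fun k => by
    rw [Over.comp_left, ← Category.assoc, hf, Category.assoc, hg, ← Category.assoc,
      ← Spec.map_comp, ← CommRingCat.ofHom_comp,
      rotChart_comp n a hζ k (hpow (m - 1)) (by rw [hmul, one_pow])]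
    simp only [hmul]
    rw [rotChart_one]
    simp
  have hgf : ∀ k, 𝔸.chart k ≫ (g ≫ f).left = 𝔸.chart k ≫ (𝟙 E : E ⟶ E).left := fun k => by
    rw [Over.comp_left, ← Category.assoc, hg, Category.assoc, hf, ← Category.assoc,
      ← Spec.map_comp, ← CommRingCat.ofHom_comp,
      rotChart_comp n a (hpow (m - 1)) k hζ (by rw [mul_comm, hmul, one_pow])]
    simp only [mul_comm _ ζ, hmul]
    rw [rotChart_one]
    simp
  let σ : Aut E := ⟨f, g, Over.OverMorphism.ext (𝔸.hom_ext hfg),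
    Over.OverMorphism.ext (𝔸.hom_ext hgf)⟩
  refine ⟨σ, fun j k => ?_⟩
  induction j with
  | zero =>
    simp only [pow_zero]
    rw [rotChart_one]
    change _ ≫ 𝟙 _ = _
    simp
  | succ j ih =>
    have : (σ ^ (j + 1)).hom = f ≫ (σ ^ j).hom := by
      rw [pow_succ]
      rfl
    rw [this, Over.comp_left, ← Category.assoc, hf, Category.assoc, ih, ← Category.assoc,
      ← Spec.map_comp, ← CommRingCat.ofHom_comp,
      rotChart_comp n a hζ k (hpow j) (by rw [← pow_succ', hpow])]
    simp only [← pow_succ']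

end CurveAtlas

section Frobenius

variable (p : ℕ) [Fact p.Prime]

/-- Ring homomorphisms commute with `p`-th powers. Applied to a chart, this reduces the Frobenius of
the curve to that of a ring. -/
lemma comp_frobeniusHom {X Y : Over (Spec (.of (ZMod p)))} (f : X ⟶ Y) :
    f.left ≫ frobeniusHom p Y = frobeniusHom p X ≫ f.left := by
  refine Scheme.Hom.ext rfl fun U => ?_
  have h : X.left.presheaf.map (eqToHom (rfl : f.left ⁻¹ᵁ U = f.left ⁻¹ᵁ U)).op = 𝟙 _ :=
    X.left.presheaf.map_id _
  ext c
  refine congr($h _).trans ?_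
  exact map_pow (f.left.app U).hom c p

lemma frobeniusHom_spec {A : Type} [CommRing A] (s : Spec (.of A) ⟶ Spec (.of (ZMod p)))
    (h : (p : A) = 0) : frobeniusHom p (Over.mk s) =
      Spec.map (CommRingCat.ofHom (powRingHom p A h)) := by
  have : IsAffine (Over.mk s).left := inferInstanceAs (IsAffine (Spec _))
  refine ext_of_isAffine (Y := Spec (.of A)) ?_
  rw [← cancel_mono (Scheme.ΓSpecIso (.of A)).hom, Scheme.ΓSpecIso_naturality]
  ext c
  change (Scheme.ΓSpecIso (.of A)).hom.hom (c ^ p) = (Scheme.ΓSpecIso (.of A)).hom.hom c ^ p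
  rw [map_pow]

end Frobenius

end Endomorphisms

/-! ### The Frobenius in the coordinates of the charts -/

section FrobeniusChart

lemma intEval_frobenius (p : ℕ) [Fact p.Prime] {A : Type} [CommRing A] (h : (p : A) = 0) (q : ℤ[X])
    (c : A) : intEval q (c ^ p) = intEval q c ^ p :=
  (map_intEval (powRingHom p A h) q c).symm

lemma natCast_chart_eq_zero {p : ℕ} {S : Type} [CommRing S] (hS : (p : S) = 0) (m n a : ℕ)
    (k : Bool) : (p : CurveChart S m n a k) = 0 := by
  rw [← map_natCast (ChartRing.base S m (chartH n a k) (chartG n k)), hS, map_zero]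

/-- The action of the Frobenius on the charts. -/
def frobChart (p : ℕ) [Fact p.Prime] {S : Type} [CommRing S] (hS : (p : S) = 0) (m n a : ℕ)
    (k : Bool) : CurveChart S m n a k →+* CurveChart S m n a k :=
  ChartRing.lift (ChartRing.base _ _ _ _) (ChartRing.z _ _ _ _ ^ p) (ChartRing.x _ _ _ _ ^ p)
    (by
      rw [intEval_frobenius p (natCast_chart_eq_zero hS m n a k)]
      exact (ChartRing.isUnit_g ..).pow p)
    (by
      rw [intEval_frobenius p (natCast_chart_eq_zero hS m n a k), ← ChartRing.x_pow, ← pow_mul,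
        ← pow_mul, mul_comm])

variable (p : ℕ) [Fact p.Prime] {S S' : Type} [CommRing S] [CommRing S'] (hS : (p : S) = 0)
  (hS' : (p : S') = 0) (m n a : ℕ) (k : Bool)

lemma frobChart_comp_base : (frobChart p hS m n a k).comp (ChartRing.base _ _ _ _) =
    ChartRing.base _ _ _ _ := ChartRing.lift_comp_base ..

lemma frobChart_base (s : S) : frobChart p hS m n a k (ChartRing.base _ _ _ _ s) =
    ChartRing.base _ _ _ _ s := ChartRing.lift_base ..

lemma frobChart_z : frobChart p hS m n a k (ChartRing.z _ _ _ _) = ChartRing.z _ _ _ _ ^ p :=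
  ChartRing.lift_z ..

lemma frobChart_x : frobChart p hS m n a k (ChartRing.x _ _ _ _) = ChartRing.x _ _ _ _ ^ p :=
  ChartRing.lift_x ..

lemma map_comp_frobChart (ψ : S →+* S') :
    (ChartRing.map ψ _ _ _).comp (frobChart p hS m n a k) =
      (frobChart p hS' m n a k).comp (ChartRing.map ψ _ _ _) := by
  refine ChartRing.hom_ext ?_ ?_ ?_
  · rw [RingHom.comp_assoc, RingHom.comp_assoc, frobChart_comp_base, ChartRing.map_comp_base,
      ← RingHom.comp_assoc, frobChart_comp_base]
  · rw [RingHom.comp_apply, RingHom.comp_apply, frobChart_z, map_pow, ChartRing.map_z, frobChart_z]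
  · rw [RingHom.comp_apply, RingHom.comp_apply, frobChart_x, map_pow, ChartRing.map_x, frobChart_x]

/-- Over the prime field the `p`-th power map fixes the coefficients. Over a larger base this fails,
and the base change of the Frobenius is the linear map `frobChart`. -/
lemma powRingHom_eq_frobChart (hp : (p : ZMod p) = 0) :
    powRingHom p (CurveChart (ZMod p) m n a k) (natCast_chart_eq_zero hp m n a k) =
      frobChart p hp m n a k := by
  refine ChartRing.hom_ext ?_ ?_ ?_
  · rw [frobChart_comp_base]
    ext s
    change ChartRing.base _ _ _ _ s ^ p = _
    rw [← map_pow, ZMod.pow_card]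
  · rw [frobChart_z]
    rfl
  · rw [frobChart_x]
    rfl

namespace CurveAtlas

variable {m n a} {R : Type} [CommRing R] {b : ℕ}

lemma chart_frobenius {ρ : R →+* ZMod p} {E : Over (Spec (.of (ZMod p)))} {π : E.left ⟶ projLine R}
    (𝔸 : CurveAtlas ρ m n a b E π) (hp : (p : ZMod p) = 0) :
    𝔸.chart k ≫ (frobenius p E).left =
      Spec.map (CommRingCat.ofHom (frobChart p hp m n a k)) ≫ 𝔸.chart k := by
  have h := comp_frobeniusHom p (Over.homMk (𝔸.chart k) rfl : Over.mk (𝔸.chart k ≫ E.hom) ⟶ E)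
  rw [frobeniusHom_spec p _ (natCast_chart_eq_zero hp m n a k), powRingHom_eq_frobChart] at h
  exact h

lemma baseChange_chart_frobenius {ρ : R →+* S} {E : Over (Spec (.of S))} {π : E.left ⟶ projLine R}
    (𝔸 : CurveAtlas ρ m n a b E π) (ψ : S →+* S') (f : E ⟶ E)
    (h : 𝔸.chart k ≫ f.left =
      Spec.map (CommRingCat.ofHom (frobChart p hS m n a k)) ≫ 𝔸.chart k) :
    (𝔸.baseChange ψ).chart k ≫ ((Over.pullback (Spec.map (CommRingCat.ofHom ψ))).map f).left =
      Spec.map (CommRingCat.ofHom (frobChart p hS' m n a k)) ≫ (𝔸.baseChange ψ).chart k := by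
  have h₁ : ((Over.pullback (Spec.map (CommRingCat.ofHom ψ))).map f).left ≫
      pullback.fst E.hom (Spec.map (CommRingCat.ofHom ψ)) = pullback.fst _ _ ≫ f.left :=
    pullback.lift_fst _ _ _
  have h₂ : ((Over.pullback (Spec.map (CommRingCat.ofHom ψ))).map f).left ≫
      pullback.snd E.hom (Spec.map (CommRingCat.ofHom ψ)) = pullback.snd _ _ :=
    pullback.lift_snd _ _ _
  have h₃ : (𝔸.baseChange ψ).chart k ≫ pullback.fst E.hom (Spec.map (CommRingCat.ofHom ψ)) = _ :=
    𝔸.baseChangeChart_fst ψ k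
  have h₄ : (𝔸.baseChange ψ).chart k ≫ pullback.snd E.hom (Spec.map (CommRingCat.ofHom ψ)) = _ :=
    𝔸.baseChangeChart_snd ψ k
  apply pullback.hom_ext
  · rw [Category.assoc, Category.assoc, h₁, reassoc_of% h₃, h, h₃, ← Category.assoc,
      ← Category.assoc, ← Spec.map_comp, ← Spec.map_comp, ← CommRingCat.ofHom_comp,
      ← CommRingCat.ofHom_comp, map_comp_frobChart p hS hS']
  · rw [Category.assoc, Category.assoc, h₂, h₄, ← Spec.map_comp, ← CommRingCat.ofHom_comp,
      frobChart_comp_base]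

end CurveAtlas

end FrobeniusChart

/-! ### Equations of the divisor and the graphs on products of charts -/

section ProductChart

/-- The coordinate ring of the self-product of a chart. -/
abbrev ProdRing (S : Type) [CommRing S] (m n a : ℕ) (k : Bool) : Type :=
  CurveChart (CurveChart S m n a k) m n a k

namespace ProdRing

variable (S : Type) [CommRing S] (m n a : ℕ) (k : Bool)

/-- The inclusion of the first factor. -/
def inl : CurveChart S m n a k →+* ProdRing S m n a k := ChartRing.base _ _ _ _

/-- The inclusion of the second factor. -/
def inr : CurveChart S m n a k →+* ProdRing S m n a k :=
  ChartRing.map (ChartRing.base _ _ _ _) _ _ _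

lemma inr_comp_base : (inr S m n a k).comp (ChartRing.base _ _ _ _) =
    (inl S m n a k).comp (ChartRing.base _ _ _ _) := ChartRing.map_comp_base _

/-- The first `z`-coordinate. -/
def z₁ : ProdRing S m n a k := inl S m n a k (ChartRing.z _ _ _ _)

/-- The second `z`-coordinate. -/
def z₂ : ProdRing S m n a k := inr S m n a k (ChartRing.z _ _ _ _)

/-- The first `x`-coordinate. -/
def x₁ : ProdRing S m n a k := inl S m n a k (ChartRing.x _ _ _ _)

/-- The second `x`-coordinate. -/
def x₂ : ProdRing S m n a k := inr S m n a k (ChartRing.x _ _ _ _)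

/-- The structure map of the product. -/
def const : S →+* ProdRing S m n a k := (inl S m n a k).comp (ChartRing.base _ _ _ _)

lemma isPushout : IsPushout (CommRingCat.ofHom (ChartRing.base S m (chartH n a k) (chartG n k)))
    (CommRingCat.ofHom (ChartRing.base S m (chartH n a k) (chartG n k)))
    (CommRingCat.ofHom (inl S m n a k)) (CommRingCat.ofHom (inr S m n a k)) :=
  (ChartRing.isPushout_map _).flip

end ProdRing

namespace CurveAtlas

variable {R S : Type} [CommRing R] [CommRing S] {ρ : R →+* S} {m n a b : ℕ}
  {E : Over (Spec (.of S))} {π : E.left ⟶ projLine R} (𝔸 : CurveAtlas ρ m n a b E π) (k : Bool)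

/-- The product of a chart with itself. -/
def prodChart : Spec (.of (ProdRing S m n a k)) ⟶ pullback E.hom E.hom :=
  pullback.lift (Spec.map (CommRingCat.ofHom (ProdRing.inl S m n a k)) ≫ 𝔸.chart k)
    (Spec.map (CommRingCat.ofHom (ProdRing.inr S m n a k)) ≫ 𝔸.chart k) (by
      rw [Category.assoc, Category.assoc, 𝔸.chart_hom, ← Spec.map_comp, ← Spec.map_comp,
        ← CommRingCat.ofHom_comp, ← CommRingCat.ofHom_comp, ProdRing.inr_comp_base])

lemma prodChart_fst : 𝔸.prodChart k ≫ pullback.fst _ _ =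
    Spec.map (CommRingCat.ofHom (ProdRing.inl S m n a k)) ≫ 𝔸.chart k := pullback.lift_fst _ _ _

lemma prodChart_snd : 𝔸.prodChart k ≫ pullback.snd _ _ =
    Spec.map (CommRingCat.ofHom (ProdRing.inr S m n a k)) ≫ 𝔸.chart k := pullback.lift_snd _ _ _

lemma prodChart_eq_comp_map : ∃ e : Spec (.of (ProdRing S m n a k)) ≅
    pullback (𝔸.chart k ≫ E.hom) (𝔸.chart k ≫ E.hom), 𝔸.prodChart k = e.hom ≫
      pullback.map (𝔸.chart k ≫ E.hom) (𝔸.chart k ≫ E.hom) E.hom E.hom (𝔸.chart k) (𝔸.chart k)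
        (𝟙 _) (Category.comp_id _) (Category.comp_id _) := by
  have H : IsPullback (Spec.map (CommRingCat.ofHom (ProdRing.inl S m n a k)))
      (Spec.map (CommRingCat.ofHom (ProdRing.inr S m n a k))) (𝔸.chart k ≫ E.hom)
      (𝔸.chart k ≫ E.hom) := by
    rw [𝔸.chart_hom]
    exact isPullback_SpecMap_of_isPushout _ _ _ _ (ProdRing.isPushout S m n a k)
  have h₁ : pullback.map (𝔸.chart k ≫ E.hom) (𝔸.chart k ≫ E.hom) E.hom E.hom (𝔸.chart k)
      (𝔸.chart k) (𝟙 _) (Category.comp_id _) (Category.comp_id _) ≫ pullback.fst _ _ =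
      pullback.fst _ _ ≫ 𝔸.chart k := pullback.lift_fst _ _ _
  have h₂ : pullback.map (𝔸.chart k ≫ E.hom) (𝔸.chart k ≫ E.hom) E.hom E.hom (𝔸.chart k)
      (𝔸.chart k) (𝟙 _) (Category.comp_id _) (Category.comp_id _) ≫ pullback.snd _ _ =
      pullback.snd _ _ ≫ 𝔸.chart k := pullback.lift_snd _ _ _
  refine ⟨H.isoPullback, ?_⟩
  apply pullback.hom_ext
  · rw [Category.assoc, h₁, prodChart_fst, H.isoPullback_hom_fst_assoc]
  · rw [Category.assoc, h₂, prodChart_snd, H.isoPullback_hom_snd_assoc]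

instance : IsOpenImmersion (𝔸.prodChart k) := by
  obtain ⟨e, he⟩ := 𝔸.prodChart_eq_comp_map k
  rw [he]
  infer_instance

lemma range_prodChart : Set.range (𝔸.prodChart k) =
    pullback.fst E.hom E.hom ⁻¹' Set.range (𝔸.chart k) ∩
      pullback.snd E.hom E.hom ⁻¹' Set.range (𝔸.chart k) := by
  obtain ⟨e, he⟩ := 𝔸.prodChart_eq_comp_map k
  rw [he, ← Scheme.Pullback.range_map (𝔸.chart k ≫ E.hom) (𝔸.chart k ≫ E.hom) E.hom E.hom
    (𝔸.chart k) (𝔸.chart k) (𝟙 _) (Category.comp_id _) (Category.comp_id _)]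
  ext y
  constructor
  · rintro ⟨q, rfl⟩
    exact ⟨_, (Scheme.Hom.comp_apply ..).symm⟩
  · rintro ⟨q, rfl⟩
    obtain ⟨q, rfl⟩ := e.hom.surjective q
    exact ⟨q, Scheme.Hom.comp_apply ..⟩

/-- A ring-valued point of the product is a pair of maps out of the chart ring that agree on `S`; it
lies on the graph when the second is the first composed with `θ`, and this only has to be compared
on `z` and `x`. -/
lemma isChartIdeal_graph [IsSeparated E.hom] (f : E ⟶ E)
    (θ : CurveChart S m n a k →+* CurveChart S m n a k)
    (hf : 𝔸.chart k ≫ f.left = Spec.map (CommRingCat.ofHom θ) ≫ 𝔸.chart k) {p : ℕ} {c : S}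
    (hb : θ.comp (ChartRing.base _ _ _ _) = ChartRing.base _ _ _ _)
    (hz : θ (ChartRing.z _ _ _ _) = ChartRing.z _ _ _ _ ^ p)
    (hx : θ (ChartRing.x _ _ _ _) = ChartRing.base _ _ _ _ c * ChartRing.x _ _ _ _ ^ p) :
    IsChartIdeal (𝔸.prodChart k) (graphIdeal f)
      (Ideal.span {ProdRing.z₂ S m n a k - ProdRing.z₁ S m n a k ^ p,
        ProdRing.x₂ S m n a k - ProdRing.const S m n a k c * ProdRing.x₁ S m n a k ^ p}) := by
  intro K φ
  have h₁ := 𝔸.prodChart_fst k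
  have h₂ := 𝔸.prodChart_snd k
  rw [graphIdeal_le_ker_iff, Category.assoc, Category.assoc, h₂, reassoc_of% h₁, hf,
    ← Category.assoc, ← Category.assoc, ← Category.assoc, cancel_mono, ← Spec.map_comp,
    ← Spec.map_comp, ← Spec.map_comp, Spec.map_injective.eq_iff, Ideal.span_le]
  have e : CommRingCat.ofHom (ProdRing.inr S m n a k) ≫ φ =
      (CommRingCat.ofHom θ ≫ CommRingCat.ofHom (ProdRing.inl S m n a k)) ≫ φ ↔
      φ.hom.comp (ProdRing.inr S m n a k) = (φ.hom.comp (ProdRing.inl S m n a k)).comp θ :=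
    ⟨fun h => congrArg CommRingCat.Hom.hom h, fun h => CommRingCat.hom_ext h⟩
  have hz' : φ.hom (ProdRing.z₂ S m n a k - ProdRing.z₁ S m n a k ^ p) = 0 ↔
      φ.hom.comp (ProdRing.inr S m n a k) (ChartRing.z _ _ _ _) =
        (φ.hom.comp (ProdRing.inl S m n a k)).comp θ (ChartRing.z _ _ _ _) := by
    rw [map_sub, sub_eq_zero, RingHom.comp_apply _ θ, hz, map_pow, map_pow]
    rfl
  have hx' : φ.hom (ProdRing.x₂ S m n a k -
        ProdRing.const S m n a k c * ProdRing.x₁ S m n a k ^ p) = 0 ↔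
      φ.hom.comp (ProdRing.inr S m n a k) (ChartRing.x _ _ _ _) =
        (φ.hom.comp (ProdRing.inl S m n a k)).comp θ (ChartRing.x _ _ _ _) := by
    rw [map_sub, sub_eq_zero, RingHom.comp_apply _ θ, hx, map_mul, map_pow, map_mul, map_pow]
    rfl
  refine e.trans ⟨fun h => ?_, fun h => ?_⟩
  · rintro _ (rfl | rfl)
    · exact hz'.mpr congr($h _)
    · exact hx'.mpr congr($h _)
  · refine ChartRing.hom_ext ?_ (hz'.mp (h (.inl rfl))) (hx'.mp (h (.inr rfl)))
    rw [RingHom.comp_assoc, RingHom.comp_assoc, hb, RingHom.comp_assoc, ProdRing.inr_comp_base]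

/-- On either chart of the line `F` is the `p`-th power of the coordinate, so the condition `hD` on
points becomes the single equation `z₂ = z₁ ^ p`. -/
lemma isChartIdeal_of_le_ker_iff {p : ℕ} (D : (pullback E.hom E.hom).IdealSheafData)
    (hD : ∀ {T : Scheme.{0}} (f : T ⟶ pullback E.hom E.hom), D ≤ f.ker ↔
      f ≫ pullback.fst _ _ ≫ π ≫ powHom R p = f ≫ pullback.snd _ _ ≫ π) :
    IsChartIdeal (𝔸.prodChart k) D
      (Ideal.span {ProdRing.z₂ S m n a k - ProdRing.z₁ S m n a k ^ p}) := by
  intro K φ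
  have h₁ := 𝔸.prodChart_fst k
  have h₂ := 𝔸.prodChart_snd k
  have h₃ := 𝔸.chart_comp k
  have h₄ := lineChart_powHom R p k
  rw [hD, Category.assoc, Category.assoc, reassoc_of% h₁, reassoc_of% h₂, reassoc_of% h₃, h₃, h₄,
    ← Category.assoc, ← Category.assoc, ← Category.assoc, ← Category.assoc, ← Category.assoc,
    cancel_mono, ← Spec.map_comp,
    ← Spec.map_comp, ← Spec.map_comp, ← Spec.map_comp, ← Spec.map_comp, Spec.map_injective.eq_iff,
    Ideal.span_le,
    Set.singleton_subset_iff, SetLike.mem_coe, RingHom.mem_ker, map_sub, sub_eq_zero, map_pow]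
  let χ₁ := (φ.hom.comp (ProdRing.inl S m n a k)).comp (lineToChart ρ m n a k)
  let χ₂ := (φ.hom.comp (ProdRing.inr S m n a k)).comp (lineToChart ρ m n a k)
  have e : φ.hom (ProdRing.z₂ S m n a k) = φ.hom (ProdRing.z₁ S m n a k) ^ p ↔
      χ₁.comp (polyPow R p) = χ₂ := by
    have hX₁ : χ₁ (polyPow R p X) = φ.hom (ProdRing.z₁ S m n a k) ^ p := by
      simp [χ₁, polyPow, lineToChart, ProdRing.z₁]
    have hX₂ : χ₂ X = φ.hom (ProdRing.z₂ S m n a k) := by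
      simp [χ₂, lineToChart, ProdRing.z₂]
    rw [← hX₁, ← hX₂]
    refine ⟨fun h => Polynomial.ringHom_ext' ?_ h.symm, fun h => congr($h X).symm⟩
    ext r
    have h5 : χ₁ (C r) = φ.hom (ProdRing.inl _ _ _ _ _ (ChartRing.base _ _ _ _ (ρ r))) := by
      simp [χ₁, lineToChart]
    have h6 : χ₂ (C r) = φ.hom (ProdRing.inr _ _ _ _ _ (ChartRing.base _ _ _ _ (ρ r))) := by
      simp [χ₂, lineToChart]
    have h7 : polyPow R p (C r) = C r := by simp [polyPow]
    have h8 := congr($(ProdRing.inr_comp_base S m n a k) (ρ r))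
    rw [RingHom.comp_apply, RingHom.comp_apply] at h8
    change χ₁ (polyPow R p (C r)) = χ₂ (C r)
    rw [h7, h5, h6, h8]
  rw [e]
  exact ⟨fun h => congrArg CommRingCat.Hom.hom h, fun h => CommRingCat.hom_ext h⟩

end CurveAtlas

end ProductChart

/-! ### The local factorization -/

section LocalFactorization

section Principal

variable {P : Type} [CommRing P] {ι : Type} {s : Finset ι} {d u : P} {f : ι → P}

lemma dvd_of_prod_eq (hprod : ∏ i ∈ s, f i = d * u) (hu : IsUnit u) {i : ι} (hi : i ∈ s) :
    f i ∣ d := by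
  obtain ⟨c, hc⟩ := hu.exists_right_inv
  have h1 : f i ∣ d * u := hprod ▸ Finset.dvd_prod_of_mem f hi
  have h2 : d = d * u * c := by rw [mul_assoc, hc, mul_one]
  rw [h2]
  exact h1.mul_right c

lemma span_pair_eq_of_dvd {x y : P} (h : y ∣ x) : Ideal.span {x, y} = Ideal.span {y} := by
  refine le_antisymm ?_ (Ideal.span_mono (by simp))
  rw [Ideal.span_le]
  rintro _ (rfl | rfl)
  exacts [Ideal.mem_span_singleton.mpr h, Ideal.mem_span_singleton_self _]

lemma span_pair_principal_of_isUnit (hd : d ∈ nonZeroDivisors P) (hprod : ∏ i ∈ s, f i = d * u)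
    (hu : IsUnit u) : (∀ i ∈ s, ∃ v ∈ nonZeroDivisors P, Ideal.span {d, f i} = Ideal.span {v}) ∧
      ∏ i ∈ s, Ideal.span {d, f i} = Ideal.span {d} := by
  have h1 : ∀ i ∈ s, Ideal.span {d, f i} = Ideal.span {f i} := fun i hi =>
    span_pair_eq_of_dvd (dvd_of_prod_eq hprod hu hi)
  refine ⟨fun i hi => ⟨f i, ?_, h1 i hi⟩, ?_⟩
  · obtain ⟨c, rfl⟩ := dvd_of_prod_eq hprod hu hi
    exact (mul_mem_nonZeroDivisors.mp hd).1
  · rw [Finset.prod_congr rfl h1, Ideal.prod_span_singleton, hprod,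
      Ideal.span_singleton_mul_right_unit hu]

/-- The other factors being units, `f i` is a unit times `d * u`. So `d` divides `f i`, and that
ideal alone carries the product. -/
lemma span_pair_principal_of_forall_isUnit (hd : d ∈ nonZeroDivisors P)
    (hprod : ∏ i ∈ s, f i = d * u) {i : ι} (hi : i ∈ s) (hu : ∀ j ∈ s, j ≠ i → IsUnit (f j)) :
    (∀ i ∈ s, ∃ v ∈ nonZeroDivisors P, Ideal.span {d, f i} = Ideal.span {v}) ∧
      ∏ i ∈ s, Ideal.span {d, f i} = Ideal.span {d} := by
  classical
  have hne : ∀ j ∈ s, j ≠ i → Ideal.span {d, f j} = ⊤ := fun j hj hji =>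
    Ideal.eq_top_of_isUnit_mem _ (Ideal.subset_span (by simp)) (hu j hj hji)
  have hpu : IsUnit (∏ j ∈ s.erase i, f j) := by
    rw [IsUnit.prod_iff]
    exact fun j hj => hu j (Finset.mem_of_mem_erase hj) (Finset.ne_of_mem_erase hj)
  have heq : Ideal.span {d, f i} = Ideal.span {d} := by
    rw [Set.pair_comm]
    apply span_pair_eq_of_dvd
    rw [← Finset.mul_prod_erase s f hi] at hprod
    rw [← hpu.dvd_mul_right, hprod]
    exact dvd_mul_right _ _
  constructor
  · intro j hj
    by_cases hji : j = i
    · subst hji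
      exact ⟨d, hd, heq⟩
    · exact ⟨1, one_mem _, by rw [hne j hj hji, Ideal.span_singleton_one]⟩
  · rw [← Finset.mul_prod_erase s _ hi, heq, Finset.prod_eq_one, mul_one]
    exact fun j hj => (hne j (Finset.mem_of_mem_erase hj) (Finset.ne_of_mem_erase hj)).trans
      Ideal.one_eq_top.symm

/-- Three cases: `u` is invertible near `𝔭`, or `d` is, or both lie in `𝔭` and then `hsep` leaves
exactly one factor in `𝔭`. The element `t` to invert is accordingly `u`, `d`, or the product of the
remaining factors. -/
lemma exists_away_principal (hd : d ∈ nonZeroDivisors P) (hprod : ∏ i ∈ s, f i = d * u)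
    (𝔭 : Ideal P) [h𝔭 : 𝔭.IsPrime]
    (hsep : d ∈ 𝔭 → u ∈ 𝔭 → ∀ i ∈ s, ∀ j ∈ s, f i ∈ 𝔭 → f j ∈ 𝔭 → i = j) :
    ∃ t ∉ 𝔭, (∀ i ∈ s, ∃ v ∈ nonZeroDivisors (Localization.Away t),
        (Ideal.span {d, f i}).map (algebraMap P (Localization.Away t)) = Ideal.span {v}) ∧
      ∏ i ∈ s, (Ideal.span {d, f i}).map (algebraMap P (Localization.Away t)) =
        (Ideal.span {d}).map (algebraMap P (Localization.Away t)) := by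
  classical
  have hmap : ∀ (t : P) (x y : P), (Ideal.span {x, y}).map (algebraMap P (Localization.Away t)) =
      Ideal.span {algebraMap P (Localization.Away t) x, algebraMap P (Localization.Away t) y} :=
    fun t x y => by rw [Ideal.map_span, Set.image_pair]
  have hmap' : ∀ (t : P) (x : P), (Ideal.span {x}).map (algebraMap P (Localization.Away t)) =
      Ideal.span {algebraMap P (Localization.Away t) x} :=
    fun t x => by rw [Ideal.map_span, Set.image_singleton]
  have hd' : ∀ t : P, algebraMap P (Localization.Away t) d ∈
      nonZeroDivisors (Localization.Away t) := fun t =>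
    IsLocalization.nonZeroDivisors_le_comap (Submonoid.powers t) (Localization.Away t) hd
  have hprod' : ∀ t : P, ∏ i ∈ s, algebraMap P (Localization.Away t) (f i) =
      algebraMap P (Localization.Away t) d * algebraMap P (Localization.Away t) u := fun t => by
    rw [← map_prod, hprod, map_mul]
  have hunit : ∀ t : P, IsUnit (algebraMap P (Localization.Away t) t) := fun t =>
    IsLocalization.Away.algebraMap_isUnit t
  simp only [hmap, hmap']
  by_cases hu : u ∈ 𝔭
  · by_cases hdp : d ∈ 𝔭
    · have hmem : ∏ i ∈ s, f i ∈ 𝔭 := hprod ▸ 𝔭.mul_mem_left d hu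
      obtain ⟨i, hi, hfi⟩ := (Ideal.IsPrime.prod_mem_iff (p := 𝔭)).mp hmem
      refine ⟨∏ j ∈ s.erase i, f j, ?_, ?_⟩
      · rw [Ideal.IsPrime.prod_mem_iff]
        rintro ⟨j, hj, hfj⟩
        exact Finset.ne_of_mem_erase hj
          (hsep hdp hu j (Finset.mem_of_mem_erase hj) i hi hfj hfi)
      · refine span_pair_principal_of_forall_isUnit (hd' _) (hprod' _) hi fun j hj hji => ?_
        exact isUnit_of_dvd_unit (map_dvd (algebraMap P (Localization.Away _)) (Finset.dvd_prod_of_mem f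
          (Finset.mem_erase.mpr ⟨hji, hj⟩))) (hunit _)
    · refine ⟨d, hdp, fun i _ => ⟨1, one_mem _, ?_⟩, ?_⟩
      · rw [Ideal.span_singleton_one]
        exact Ideal.eq_top_of_isUnit_mem _ (Ideal.subset_span (by simp)) (hunit d)
      · rw [Ideal.span_singleton_eq_top.mpr (hunit d), ← Ideal.one_eq_top]
        refine Finset.prod_eq_one fun i _ => ?_
        rw [Ideal.one_eq_top]
        exact Ideal.eq_top_of_isUnit_mem _ (Ideal.subset_span (by simp)) (hunit d)
  · exact ⟨u, hu, span_pair_principal_of_isUnit (hd' u) (hprod' u) (hunit u)⟩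

end Principal

/-- The identity is proved for two indeterminates over `K`, in a domain where `η` stays primitive,
and then specialized; `P` need not be a domain. -/
lemma prod_sub_pow_mul {K : Type} [Field K] {m : ℕ} (hm : m ≠ 0) {η : K} (hη : IsPrimitiveRoot η m)
    {P : Type} [CommRing P] (φ : K →+* P) (x y : P) :
    ∏ j ∈ Finset.range m, (x - φ (η ^ j) * y) = x ^ m - y ^ m := by
  classical
  have hη' : IsPrimitiveRoot (C (C η) : K[X][X]) m :=
    hη.map_of_injective (f := (C : K[X] →+* K[X][X]).comp C)
      ((C_injective (R := K[X])).comp C_injective)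
  have key := hη'.pow_sub_pow_eq_prod_sub_mul (X : K[X][X]) (C X) (Nat.pos_of_ne_zero hm)
  have himg : Polynomial.nthRootsFinset m (1 : K[X][X]) =
      (Finset.range m).image fun j => (C (C η) : K[X][X]) ^ j := by
    symm
    apply Finset.eq_of_subset_of_card_le
    · intro c hc
      obtain ⟨j, -, rfl⟩ := Finset.mem_image.mp hc
      rw [mem_nthRootsFinset (Nat.pos_of_ne_zero hm), ← pow_mul, mul_comm, pow_mul, hη'.pow_eq_one,
        one_pow]
    · rw [hη'.card_nthRootsFinset, Finset.card_image_of_injOn, Finset.card_range]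
      simpa using hη'.injOn_pow
  rw [himg, Finset.prod_image (by simpa using hη'.injOn_pow)] at key
  have h2 := congrArg (eval₂RingHom (eval₂RingHom φ y) x) key
  simp only [map_prod, map_sub, map_mul, map_pow, coe_eval₂RingHom, eval₂_X, eval₂_C] at h2
  rw [h2]
  simp only [map_pow]

/-- Taylor expansion at `e`: modulo `c - e` the second factor is the derivative, which is all that
matters at a common zero. -/
lemma exists_intEval_sub_eq {P : Type} [CommRing P] (h : ℤ[X]) (c e : P) :
    ∃ k, intEval h c - intEval h e = (c - e) * (intEval (derivative h) e + k * (c - e)) := by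
  obtain ⟨k, hk⟩ := Polynomial.binomExpansion (h.map (Int.castRingHom P)) e (c - e)
  refine ⟨k, ?_⟩
  rw [add_sub_cancel, Polynomial.eval_map, Polynomial.eval_map,
    derivative_map, Polynomial.eval_map] at hk
  change intEval h c = intEval h e + intEval (derivative h) e * (c - e) + k * (c - e) ^ 2 at hk
  rw [hk]
  ring

/-- The zeros of `h` where `g ≠ 0` are simple. For `c ^ n + 1` the unit `n` is a combination of it
and its derivative. For `c * (c ^ n + 1) ^ a` the only such zero is `c = 0`, where the derivative is
`(c ^ n + 1) ^ a`. -/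
lemma isUnit_of_mem_chartH {P : Type} [CommRing P] {n a : ℕ} (hn : n ≠ 0) (hnu : IsUnit (n : P))
    (k : Bool) (c : P) (𝔭 : Ideal P) [h𝔭 : 𝔭.IsPrime] (hg : intEval (chartG n k) c ∉ 𝔭)
    (hh : intEval (chartH n a k) c ∈ 𝔭) : intEval (derivative (chartH n a k)) c ∉ 𝔭 := by
  intro hd
  cases k
  · rw [intEval_chartH_false] at hh
    have h1 : intEval (derivative (chartH n a false)) c = n * c ^ (n - 1) := by
      rw [chartH, derivative_add, derivative_one, add_zero, derivative_X_pow, intEval_mul,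
        intEval_pow, intEval_X]
      simp [intEval]
    rw [h1] at hd
    have h2 : (n : P) = n * (c ^ n + 1) - c * (n * c ^ (n - 1)) := by
      have : c ^ n = c * c ^ (n - 1) := by
        rw [← pow_succ', Nat.sub_add_cancel (Nat.pos_of_ne_zero hn)]
      rw [this]
      ring
    refine h𝔭.ne_top (Ideal.eq_top_of_isUnit_mem _ ?_ hnu)
    rw [h2]
    exact sub_mem (𝔭.mul_mem_left _ hh) (𝔭.mul_mem_left _ hd)
  · rw [intEval_chartH_true] at hh
    rw [intEval_chartG_true] at hg
    have hc : c ∈ 𝔭 := by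
      rcases h𝔭.mem_or_mem hh with h | h
      · exact h
      · exact absurd (h𝔭.mem_of_pow_mem _ h) hg
    have h1 : intEval (derivative (chartH n a true)) c = (c ^ n + 1) ^ a +
        c * intEval (derivative ((X ^ n + 1) ^ a)) c := by
      rw [chartH, derivative_mul, derivative_X, one_mul, intEval_add, intEval_mul, intEval_X,
        intEval_pow, intEval_add, intEval_pow, intEval_X, intEval_one]
    rw [h1, Ideal.add_mem_iff_left _ (𝔭.mul_mem_right _ hc)] at hd
    exact hg (h𝔭.mem_of_pow_mem _ hd)

section Chart

variable (p : ℕ) [Fact p.Prime] {K : Type} [Field K] {m n a : ℕ} (k : Bool)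

lemma ProdRing.z₂_sub_mem_nonZeroDivisors (S : Type) [CommRing S] (hm : m ≠ 0) (q : ℕ) :
    z₂ S m n a k - z₁ S m n a k ^ q ∈ nonZeroDivisors (ProdRing S m n a k) := by
  rw [z₂, z₁, inr, ChartRing.map_z, ← map_pow]
  exact ChartRing.z_sub_base_mem_nonZeroDivisors hm _

lemma ProdRing.x₂_pow (S : Type) [CommRing S] :
    x₂ S m n a k ^ m = intEval (chartH n a k) (z₂ S m n a k) := by
  rw [x₂, ← map_pow, ChartRing.x_pow, map_intEval, z₂]

lemma ProdRing.x₁_pow (S : Type) [CommRing S] :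
    x₁ S m n a k ^ m = intEval (chartH n a k) (z₁ S m n a k) := by
  rw [x₁, ← map_pow, ChartRing.x_pow, map_intEval, z₁]

/-- The local equations of the divisor and of the graphs on the self-product of a chart. -/
lemma exists_away_graph (hK : (p : K) = 0) (hm : m ≠ 0) (hn : n ≠ 0) (hnK : (n : K) ≠ 0) {η : K}
    (hη : IsPrimitiveRoot η m) (𝔭 : Ideal (ProdRing K m n a k)) [h𝔭 : 𝔭.IsPrime] :
    ∃ t ∉ 𝔭, (∀ j ∈ Finset.range m, ∃ v ∈ nonZeroDivisors (Localization.Away t),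
        (Ideal.span {ProdRing.z₂ K m n a k - ProdRing.z₁ K m n a k ^ p, ProdRing.x₂ K m n a k -
          ProdRing.const K m n a k (η ^ j) * ProdRing.x₁ K m n a k ^ p}).map
            (algebraMap _ (Localization.Away t)) = Ideal.span {v}) ∧
      ∏ j ∈ Finset.range m,
        (Ideal.span {ProdRing.z₂ K m n a k - ProdRing.z₁ K m n a k ^ p, ProdRing.x₂ K m n a k -
          ProdRing.const K m n a k (η ^ j) * ProdRing.x₁ K m n a k ^ p}).map
            (algebraMap _ (Localization.Away t)) =
        (Ideal.span {ProdRing.z₂ K m n a k - ProdRing.z₁ K m n a k ^ p}).map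
          (algebraMap _ (Localization.Away t)) := by
  have hp : (p : ProdRing K m n a k) = 0 := by
    rw [← map_natCast (ProdRing.const K m n a k), hK, map_zero]
  obtain ⟨w, hw⟩ := exists_intEval_sub_eq (chartH n a k) (ProdRing.z₂ K m n a k)
    (ProdRing.z₁ K m n a k ^ p)
  have hprod := prod_sub_pow_mul hm hη (ProdRing.const K m n a k) (ProdRing.x₂ K m n a k)
    (ProdRing.x₁ K m n a k ^ p)
  -- In characteristic `p`, `h(z₁) ^ p = h(z₁ ^ p)` because `h` has integer coefficients.
  have hx₁ : (ProdRing.x₁ K m n a k ^ p) ^ m =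
      intEval (chartH n a k) (ProdRing.z₁ K m n a k ^ p) := by
    rw [intEval_frobenius p hp, ← ProdRing.x₁_pow, ← pow_mul, ← pow_mul, mul_comm]
  rw [ProdRing.x₂_pow, hx₁, hw] at hprod
  refine exists_away_principal (ProdRing.z₂_sub_mem_nonZeroDivisors k K hm p) hprod 𝔭 ?_
  intro hd hu i hi j hj hfi hfj
  by_contra hij
  have hne : η ^ i - η ^ j ≠ 0 := sub_ne_zero.mpr fun h => hij
    (hη.pow_inj (Finset.mem_range.mp hi) (Finset.mem_range.mp hj) h)
  -- The difference of two factors is the unit `η ^ i - η ^ j` times `x₁ ^ p`.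
  have hx₁mem : ProdRing.x₁ K m n a k ^ p ∈ 𝔭 := by
    have h1 := sub_mem hfj hfi
    have h2 : ProdRing.x₂ K m n a k - ProdRing.const K m n a k (η ^ j) * ProdRing.x₁ K m n a k ^ p -
        (ProdRing.x₂ K m n a k - ProdRing.const K m n a k (η ^ i) * ProdRing.x₁ K m n a k ^ p) =
        ProdRing.const K m n a k (η ^ i - η ^ j) * ProdRing.x₁ K m n a k ^ p := by
      rw [map_sub]
      ring
    rw [h2] at h1
    exact (Ideal.unit_mul_mem_iff_mem _ ((isUnit_iff_ne_zero.mpr hne).map _)).mp h1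
  -- Modulo `d`, which lies in `𝔭`, the cofactor `u` is `h'(z₁ ^ p)`.
  have hder : intEval (derivative (chartH n a k)) (ProdRing.z₁ K m n a k ^ p) ∈ 𝔭 :=
    (Ideal.add_mem_iff_left _ (𝔭.mul_mem_left _ hd)).mp hu
  refine isUnit_of_mem_chartH hn ?_ k _ 𝔭 ?_ ?_ hder
  · rw [← map_natCast (ProdRing.const K m n a k)]
    exact (isUnit_iff_ne_zero.mpr hnK).map _
  · intro h
    refine h𝔭.ne_top (Ideal.eq_top_of_isUnit_mem _ h ?_)
    rw [intEval_frobenius p hp, ProdRing.z₁, ← map_intEval]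
    exact ((ChartRing.isUnit_g ..).map _).pow p
  · rw [← hx₁]
    exact Ideal.pow_mem_of_mem _ hx₁mem m (Nat.pos_of_ne_zero hm)

end Chart

end LocalFactorization

/-! ### From local equations to the product of ideal sheaves -/

section Factorization

lemma ideal_prod_apply {X : Scheme.{0}} {ι : Type} (s : Finset ι) (I : ι → X.IdealSheafData)
    (U : X.affineOpens) : (∏ i ∈ s, I i).ideal U = ∏ i ∈ s, (I i).ideal U := by
  classical
  induction s using Finset.induction_on with
  | empty => rw [Finset.prod_empty, Finset.prod_empty, Ideal.one_eq_top]; rfl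
  | insert i s hi ih => rw [Finset.prod_insert hi, Finset.prod_insert hi, ← ih]; rfl

lemma ideal_chartOpen_eq_top {X : Scheme.{0}} (I : X.IdealSheafData) {B : CommRingCat.{0}}
    (f : Spec B ⟶ X) [IsOpenImmersion f] (hf : ∀ q, f q ∉ I.support) :
    I.ideal (chartOpen f) = ⊤ := by
  have h1 : (I.comap f).support = ⊥ := by
    rw [Scheme.IdealSheafData.support_comap, eq_bot_iff]
    exact fun q hq => hf q hq
  have h2 := congr($((Scheme.IdealSheafData.support_eq_bot_iff (I := I.comap f)).mp h1).ideal
    ⟨⊤, isAffineOpen_top (Spec B)⟩)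
  rw [Scheme.IdealSheafData.ideal_comap_of_isOpenImmersion] at h2
  exact Ideal.comap_eq_top_iff.mp h2

lemma mem_chartOpen {X : Scheme.{0}} {B : CommRingCat.{0}} (f : Spec B ⟶ X) [IsOpenImmersion f]
    (q : Spec B) : f q ∈ (chartOpen f).1 := ⟨q, trivial, rfl⟩

/-- The ideal sheaf `I` is locally generated by nonzerodivisors which are products of generators
of the ideal sheaves `G i`. -/
def IsLocalProduct {X : Scheme.{0}} {ι : Type} (s : Finset ι) (I : X.IdealSheafData)
    (G : ι → X.IdealSheafData) (y : X) : Prop :=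
  ∃ U : X.affineOpens, y ∈ U.1 ∧
    (∀ i ∈ s, ∃ v ∈ nonZeroDivisors Γ(X, U.1), (G i).ideal U = Ideal.span {v}) ∧
    I.ideal U = ∏ i ∈ s, (G i).ideal U

lemma eq_prod_of_isLocalProduct {X : Scheme.{0}} {ι : Type} {s : Finset ι} {I : X.IdealSheafData}
    {G : ι → X.IdealSheafData} (h : ∀ y, IsLocalProduct s I G y) :
    (∀ i ∈ s, IsEffectiveCartier (G i)) ∧ I = ∏ i ∈ s, G i := by
  refine ⟨fun i hi y => ?_, ?_⟩
  · obtain ⟨U, hy, hU, -⟩ := h y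
    exact ⟨U, hy, hU i hi⟩
  · choose U hy _ hU using h
    refine Scheme.IdealSheafData.ext_of_iSup_eq_top U ?_ fun y => ?_
    · exact top_le_iff.mp fun y _ => TopologicalSpace.Opens.mem_iSup.mpr ⟨y, hy y⟩
    · rw [hU, ideal_prod_apply]

/-- Off the support of `I` all ideals in question contain `I`, so they are trivial on a small affine
neighbourhood. -/
lemma isLocalProduct_of_notMem_support {X : Scheme.{0}} {ι : Type} {s : Finset ι}
    {I : X.IdealSheafData} {G : ι → X.IdealSheafData} (hG : ∀ i ∈ s, I ≤ G i) {y : X}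
    (hy : y ∉ I.support) : IsLocalProduct s I G y := by
  obtain ⟨B, f, hf, ⟨q, rfl⟩, hr⟩ := Scheme.exists_affine_mem_range_and_range_subset
    (U := ⟨(I.support : Set X)ᶜ, I.support.isClosed.isOpen_compl⟩) hy
  have hI := ideal_chartOpen_eq_top I f fun q' => hr ⟨q', rfl⟩
  have hGU : ∀ i ∈ s, (G i).ideal (chartOpen f) = ⊤ := fun i hi =>
    top_le_iff.mp (hI ▸ hG i hi (chartOpen f))
  refine ⟨chartOpen f, mem_chartOpen f q, fun i hi => ⟨1, one_mem _, ?_⟩, ?_⟩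
  · rw [hGU i hi, Ideal.span_singleton_one]
  · rw [hI, ← Ideal.one_eq_top, Finset.prod_eq_one]
    exact fun i hi => (hGU i hi).trans Ideal.one_eq_top.symm

lemma isLocalProduct_of_isChartIdeal {X : Scheme.{0}} {ι : Type} {s : Finset ι}
    {I : X.IdealSheafData} {G : ι → X.IdealSheafData} {B : Type} [CommRing B]
    (f : Spec (.of B) ⟶ X) [IsOpenImmersion f] {J : Ideal B} {H : ι → Ideal B}
    (hI : IsChartIdeal f I J) (hG : ∀ i ∈ s, IsChartIdeal f (G i) (H i)) (q : Spec (.of B)) (t : B)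
    (ht : t ∉ q.asIdeal)
    (hH : ∀ i ∈ s, ∃ v ∈ nonZeroDivisors (Localization.Away t),
      (H i).map (algebraMap B (Localization.Away t)) = Ideal.span {v})
    (hprod : ∏ i ∈ s, (H i).map (algebraMap B (Localization.Away t)) =
      J.map (algebraMap B (Localization.Away t))) : IsLocalProduct s I G (f q) := by
  let ψ : CommRingCat.of B ⟶ .of (Localization.Away t) :=
    CommRingCat.ofHom (algebraMap B (Localization.Away t))
  have : IsOpenImmersion (Spec.map ψ) := IsOpenImmersion.of_isLocalization t
  obtain ⟨q', rfl⟩ : q ∈ Set.range (Spec.map ψ) :=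
    (Set.ext_iff.mp (PrimeSpectrum.localization_away_comap_range (Localization.Away t) t) q).mpr ht
  let e := chartIso (Spec.map ψ ≫ f)
  have hI' := (hI.localize ψ).ideal_eq
  have hG' : ∀ i ∈ s, (G i).ideal (chartOpen (Spec.map ψ ≫ f)) =
      ((H i).map ψ.hom).map e.hom.hom := fun i hi => ((hG i hi).localize ψ).ideal_eq
  refine ⟨chartOpen (Spec.map ψ ≫ f), mem_chartOpen (Spec.map ψ ≫ f) q', fun i hi => ?_, ?_⟩
  · obtain ⟨v, hv, hv'⟩ := hH i hi
    refine ⟨e.hom.hom v, ?_, ?_⟩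
    · have hbij := ConcreteCategory.bijective_of_isIso e.hom
      refine mem_nonZeroDivisors_iff_right.mpr fun c hc => ?_
      obtain ⟨c, rfl⟩ := hbij.2 c
      have h0 : e.hom.hom (c * v) = e.hom.hom 0 := by rw [map_mul, map_zero]; exact hc
      rw [mem_nonZeroDivisors_iff_right.mp hv c (hbij.1 h0)]
      exact map_zero _
    · rw [hG' i hi]
      erw [hv']
      rw [Ideal.map_span, Set.image_singleton]
  · rw [hI', Finset.prod_congr rfl hG']
    erw [← hprod]
    exact map_prod (Ideal.mapHom e.hom.hom) _ _

namespace CurveAtlas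

section

variable {R S : Type} [CommRing R] [CommRing S] {ρ : R →+* S} {m n a b : ℕ}
  {E : Over (Spec (.of S))} {π : E.left ⟶ projLine R} (𝔸 : CurveAtlas ρ m n a b E π)

/-- On the divisor the second `t`-coordinate is `F` of the first, so both components are finite or
both are infinite. The mixed products of charts are never needed. -/
lemma exists_prodChart_eq {p : ℕ} (hp : p ≠ 0) (D : (pullback E.hom E.hom).IdealSheafData)
    (hD : ∀ {T : Scheme.{0}} (f : T ⟶ pullback E.hom E.hom), D ≤ f.ker ↔
      f ≫ pullback.fst _ _ ≫ π ≫ powHom R p = f ≫ pullback.snd _ _ ≫ π)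
    {y : ↥(pullback E.hom E.hom)} (hy : y ∈ D.support) : ∃ k q, 𝔸.prodChart k q = y := by
  have hy' : y ∈ Set.range D.subschemeι := by
    rw [Scheme.IdealSheafData.range_subschemeι]
    exact hy
  obtain ⟨y', rfl⟩ := hy'
  have h1 := (hD D.subschemeι).mp (by
    have := le_ker_of_comp_subschemeι D (𝟙 _)
    rwa [Category.id_comp] at this)
  set y := D.subschemeι y'
  have h2 : powHom R p (π (pullback.fst E.hom E.hom y)) = π (pullback.snd E.hom E.hom y) := by
    have := congr($h1 y')
    simpa only [Scheme.Hom.comp_apply] using this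
  have h3 : pullback.fst E.hom E.hom y ∈ Set.range (𝔸.chart false) ↔
      pullback.snd E.hom E.hom y ∈ Set.range (𝔸.chart false) := by
    rw [𝔸.mem_range_iff, 𝔸.mem_range_iff, ← h2, powHom_mem_range_chartZero_iff R p hp]
  have h4 : ∃ k, y ∈ Set.range (𝔸.prodChart k) := by
    by_cases h : pullback.fst E.hom E.hom y ∈ Set.range (𝔸.chart false)
    · refine ⟨false, ?_⟩
      rw [range_prodChart]
      exact ⟨h, h3.mp h⟩
    · have hk : ∀ x, x ∉ Set.range (𝔸.chart false) → x ∈ Set.range (𝔸.chart true) := fun x hx => by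
        obtain ⟨_ | _, q, hq⟩ := 𝔸.exists_chart_eq x
        exacts [absurd ⟨q, hq⟩ hx, ⟨q, hq⟩]
      refine ⟨true, ?_⟩
      rw [range_prodChart]
      exact ⟨hk _ h, hk _ fun h' => h (h3.mpr h')⟩
  obtain ⟨k, q, hq⟩ := h4
  exact ⟨k, q, hq⟩

lemma comp_powHom_eq {p : ℕ} (f : E ⟶ E)
    (θ : ∀ k, CurveChart S m n a k →+* CurveChart S m n a k)
    (hf : ∀ k, 𝔸.chart k ≫ f.left = Spec.map (CommRingCat.ofHom (θ k)) ≫ 𝔸.chart k)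
    (hb : ∀ k, (θ k).comp (ChartRing.base _ _ _ _) = ChartRing.base _ _ _ _)
    (hz : ∀ k, θ k (ChartRing.z _ _ _ _) = ChartRing.z _ _ _ _ ^ p) :
    π ≫ powHom R p = f.left ≫ π := by
  refine 𝔸.hom_ext fun k => ?_
  have h3 := 𝔸.chart_comp k
  have h4 := lineChart_powHom R p k
  rw [reassoc_of% h3, h4, reassoc_of% (hf k), h3, ← Category.assoc, ← Category.assoc,
    ← Spec.map_comp, ← Spec.map_comp, ← CommRingCat.ofHom_comp, ← CommRingCat.ofHom_comp]
  congr 3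
  refine Polynomial.ringHom_ext' ?_ ?_
  · ext r
    have := congr($(hb k) (ρ r))
    rw [RingHom.comp_apply] at this
    simp [lineToChart, polyPow, this]
  · simp [lineToChart, polyPow, hz]

/-- The graph morphism itself satisfies the condition defining `D` once `f` lies over `F`. -/
lemma le_graphIdeal {p : ℕ} (D : (pullback E.hom E.hom).IdealSheafData)
    (hD : ∀ {T : Scheme.{0}} (f : T ⟶ pullback E.hom E.hom), D ≤ f.ker ↔
      f ≫ pullback.fst _ _ ≫ π ≫ powHom R p = f ≫ pullback.snd _ _ ≫ π) (f : E ⟶ E)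
    (hf : π ≫ powHom R p = f.left ≫ π) : D ≤ graphIdeal f := by
  refine (hD _).mpr ?_
  have h₁ : (pullback.lift (𝟙 E.left) f.left (by simp) : E.left ⟶ pullback E.hom E.hom) ≫
      pullback.fst _ _ = 𝟙 _ := pullback.lift_fst _ _ _
  have h₂ : (pullback.lift (𝟙 E.left) f.left (by simp) : E.left ⟶ pullback E.hom E.hom) ≫
      pullback.snd _ _ = f.left := pullback.lift_snd _ _ _
  rw [reassoc_of% h₁, reassoc_of% h₂, hf]

end

variable {R K : Type} [CommRing R] [Field K] {ρ : R →+* K} {m n a b : ℕ}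
  {E : Over (Spec (.of K))} {π : E.left ⟶ projLine R} (𝔸 : CurveAtlas ρ m n a b E π)

/-- The root `η` depends on the chart because a rotation multiplies `x` by different powers of `ξ`
on the two charts. -/
lemma isEffectiveCartier_and_eq_prod [IsSeparated E.hom] {p : ℕ} [Fact p.Prime]
    (hK : (p : K) = 0) (hm : m ≠ 0) (hn : n ≠ 0) (hnK : (n : K) ≠ 0) {η : Bool → K}
    (hη : ∀ k, IsPrimitiveRoot (η k) m) (D : (pullback E.hom E.hom).IdealSheafData)
    (hD : ∀ {T : Scheme.{0}} (f : T ⟶ pullback E.hom E.hom), D ≤ f.ker ↔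
      f ≫ pullback.fst _ _ ≫ π ≫ powHom R p = f ≫ pullback.snd _ _ ≫ π)
    (f : ℕ → (E ⟶ E)) (θ : ℕ → ∀ k, CurveChart K m n a k →+* CurveChart K m n a k)
    (hf : ∀ j k, 𝔸.chart k ≫ (f j).left = Spec.map (CommRingCat.ofHom (θ j k)) ≫ 𝔸.chart k)
    (hb : ∀ j k, (θ j k).comp (ChartRing.base _ _ _ _) = ChartRing.base _ _ _ _)
    (hz : ∀ j k, θ j k (ChartRing.z _ _ _ _) = ChartRing.z _ _ _ _ ^ p)
    (hx : ∀ j k, θ j k (ChartRing.x _ _ _ _) =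
      ChartRing.base _ _ _ _ (η k ^ j) * ChartRing.x _ _ _ _ ^ p) :
    (∀ j ∈ Finset.range m, IsEffectiveCartier (graphIdeal (f j))) ∧
      D = ∏ j ∈ Finset.range m, graphIdeal (f j) := by
  refine eq_prod_of_isLocalProduct fun y => ?_
  by_cases hy : y ∈ D.support
  · obtain ⟨k, q, rfl⟩ := 𝔸.exists_prodChart_eq (Fact.out : p.Prime).ne_zero D hD hy
    have : q.asIdeal.IsPrime := q.isPrime
    obtain ⟨t, ht, h1, h2⟩ := exists_away_graph p k hK hm hn hnK (hη k) q.asIdeal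
    exact isLocalProduct_of_isChartIdeal (𝔸.prodChart k) (𝔸.isChartIdeal_of_le_ker_iff k D hD)
      (fun j _ => 𝔸.isChartIdeal_graph k (f j) (θ j k) (hf j k) (hb j k) (hz j k) (hx j k)) q t ht
      h1 h2
  · exact isLocalProduct_of_notMem_support (fun j _ => le_graphIdeal D hD (f j)
      (𝔸.comp_powHom_eq (f j) (θ j) (hf j) (hb j) (hz j))) hy

end CurveAtlas

end Factorization

/-! ### Application to the special fibre and its extension to `κ` -/

section SettingAtlas

/-- The description of the divisor by its points survives base change as long as `π` keeps its
target, the projective line over the original ring `R`. Hence no base change of the line is needed.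
-/
lemma comap_le_ker_iff_of_prodProj {R : Type} [CommRing R] {S S' : Scheme.{0}} (h : S' ⟶ S)
    {E : Over S} {π : E.left ⟶ projLine R} {p : ℕ} (D : (pullback E.hom E.hom).IdealSheafData)
    (hD : ∀ {T : Scheme.{0}} (f : T ⟶ pullback E.hom E.hom), D ≤ f.ker ↔
      f ≫ pullback.fst _ _ ≫ π ≫ powHom R p = f ≫ pullback.snd _ _ ≫ π)
    {T : Scheme.{0}}
    (f : T ⟶ pullback ((Over.pullback h).obj E).hom ((Over.pullback h).obj E).hom) :
    D.comap (prodProj h E E) ≤ f.ker ↔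
      f ≫ pullback.fst _ _ ≫ (pullback.fst E.hom h ≫ π) ≫ powHom R p =
        f ≫ pullback.snd _ _ ≫ (pullback.fst E.hom h ≫ π) := by
  have h₁ : prodProj h E E ≫ pullback.fst _ _ = pullback.fst _ _ ≫ pullback.fst E.hom h :=
    pullback.lift_fst _ _ _
  have h₂ : prodProj h E E ≫ pullback.snd _ _ = pullback.snd _ _ ≫ pullback.fst E.hom h :=
    pullback.lift_snd _ _ _
  rw [← le_ker_comp_iff, hD, Category.assoc, Category.assoc, reassoc_of% h₁, reassoc_of% h₂,
    Category.assoc]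

variable (p m n : ℕ) [Fact p.Prime]

lemma modelDivisor_le_ker_iff {T : Scheme.{0}}
    (f : T ⟶ pullback (curve (ZLoc p) m n).hom (curve (ZLoc p) m n).hom) :
    modelDivisor p m n ≤ f.ker ↔
      f ≫ pullback.fst _ _ ≫ (affineToProjLine (ZLoc p) m n).fromNormalization ≫
        powHom (ZLoc p) p =
      f ≫ pullback.snd _ _ ≫ (affineToProjLine (ZLoc p) m n).fromNormalization := by
  have h₁ : idProd (curve (ZLoc p) m n) (curveToProjLine (ZLoc p) m n) ≫ pullback.fst _ _ =
    pullback.fst _ _ ≫ 𝟙 _ := pullback.lift_fst _ _ _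
  have h₂ : idProd (curve (ZLoc p) m n) (curveToProjLine (ZLoc p) m n) ≫ pullback.snd _ _ =
    pullback.snd _ _ ≫ (affineToProjLine (ZLoc p) m n).fromNormalization := pullback.lift_snd _ _ _
  have : IsSeparated (projLineOver (ZLoc p)).hom :=
    inferInstanceAs (IsSeparated (projLineStr (ZLoc p)))
  rw [modelDivisor, ← le_ker_comp_iff, graphIdeal_le_ker_iff, Category.assoc, Category.assoc,
    reassoc_of% h₁, h₂]
  exact eq_comm

/-- The projection of the special fibre to the projective line. -/
def specialProj : (specialFiber p m n).left ⟶ projLine (ZLoc p) :=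
  pullback.fst (curve (ZLoc p) m n).hom (closedPt p) ≫
    (affineToProjLine (ZLoc p) m n).fromNormalization

lemma specialDivisor_le_ker_iff {T : Scheme.{0}}
    (f : T ⟶ pullback (specialFiber p m n).hom (specialFiber p m n).hom) :
    specialDivisor p m n ≤ f.ker ↔
      f ≫ pullback.fst _ _ ≫ specialProj p m n ≫ powHom (ZLoc p) p =
        f ≫ pullback.snd _ _ ≫ specialProj p m n :=
  comap_le_ker_iff_of_prodProj (closedPt p) _ (modelDivisor_le_ker_iff p m n) f

variable (κ : Type) [Field κ] [Algebra (ZMod p) κ]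

/-- The projection of the geometric fibre to the projective line. -/
def geomProj : (geomFiber p m n κ).left ⟶ projLine (ZLoc p) :=
  pullback.fst (specialFiber p m n).hom (fieldExt p κ) ≫ specialProj p m n

lemma geomDivisor_le_ker_iff {T : Scheme.{0}}
    (f : T ⟶ pullback (geomFiber p m n κ).hom (geomFiber p m n κ).hom) :
    geomDivisor p m n κ ≤ f.ker ↔
      f ≫ pullback.fst _ _ ≫ geomProj p m n κ ≫ powHom (ZLoc p) p =
        f ≫ pullback.snd _ _ ≫ geomProj p m n κ :=
  comap_le_ker_iff_of_prodProj (fieldExt p κ) _ (specialDivisor_le_ker_iff p m n) f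

instance (R : Type) [CommRing R] [IsNoetherianRing R] : IsSeparated (curve R m n).hom := by
  change IsSeparated ((affineToProjLine R m n).fromNormalization ≫ projLineStr R)
  infer_instance

instance : IsSeparated (specialFiber p m n).hom :=
  inferInstanceAs (IsSeparated (pullback.snd (curve (ZLoc p) m n).hom (closedPt p)))

instance : IsSeparated (geomFiber p m n κ).hom :=
  inferInstanceAs (IsSeparated (pullback.snd (specialFiber p m n).hom (fieldExt p κ)))

section CoordRing

variable {R S : Type} [CommRing R] [CommRing S] (g : R →+* S)

lemma coordRingMap_comp_coordBase :
    (coordRingMap g m n).comp (coordBase R m n) = (coordBase S m n).comp g := by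
  ext r
  simp [coordRingMap, coordBase]

lemma coordRingMap_coordT : coordRingMap g m n (coordT R m n) = coordT S m n := by
  simp [coordRingMap, coordT]

lemma coordRingMap_coordY : coordRingMap g m n (coordY R m n) = coordY S m n := by
  simp [coordRingMap, coordY]

lemma coordRingMap_comp_chartToCoord (a : ℕ) :
    (coordRingMap g m n).comp (chartToCoord R m n a) =
      (chartToCoord S m n a).comp (ChartRing.map g _ _ _) := by
  refine ChartRing.hom_ext ?_ ?_ ?_
  · rw [RingHom.comp_assoc, RingHom.comp_assoc, ChartRing.map_comp_base, chartToCoord,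
      ChartRing.lift_comp_base, chartToCoord, ← RingHom.comp_assoc, ChartRing.lift_comp_base,
      coordRingMap_comp_coordBase]
  · rw [RingHom.comp_apply, RingHom.comp_apply, ChartRing.map_z, chartToCoord, ChartRing.lift_z,
      chartToCoord, ChartRing.lift_z, coordRingMap_coordT]
  · rw [RingHom.comp_apply, RingHom.comp_apply, ChartRing.map_x, chartToCoord, ChartRing.lift_x,
      chartToCoord, ChartRing.lift_x, coordRingMap_coordY]

variable {m} in
lemma coordRingRot_comp_chartToCoord {ζ : S} (hζ : ζ ^ m = 1) (a : ℕ) :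
    (coordRingRot n hζ).comp (chartToCoord S m n a) =
      (chartToCoord S m n a).comp (rotChart n a hζ false) := by
  refine ChartRing.hom_ext ?_ ?_ ?_
  · rw [RingHom.comp_assoc, RingHom.comp_assoc, rotChart_comp_base, chartToCoord,
      ChartRing.lift_comp_base]
    ext r
    simp [coordRingRot, coordBase]
  · rw [RingHom.comp_apply, RingHom.comp_apply, rotChart_z, chartToCoord, ChartRing.lift_z]
    simp [coordRingRot, coordT]
  · rw [RingHom.comp_apply, RingHom.comp_apply, rotChart_x, map_mul, chartToCoord,
      ChartRing.lift_x, ChartRing.lift_base, rotExponent, pow_one]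
    simp [coordRingRot, coordY, coordBase]

end CoordRing

lemma natCast_zmod_self : (p : ZMod p) = 0 := CharP.cast_eq_zero _ _

lemma exists_specialAtlas {a b : ℕ} (hm : m ≠ 0) (hn : n ≠ 0) (hb : m * b = n * a + 1) :
    Nonempty (CurveAtlas ((reduction p).comp (RingHom.id _)) m n a b (specialFiber p m n)
      (specialProj p m n)) := by
  obtain ⟨𝔸, -⟩ := exists_curveAtlas (ZLoc p) hm hn hb
  exact ⟨𝔸.baseChange (reduction p)⟩

lemma CurveAtlas.comp_baseChangeChart {R S S' : Type} [CommRing R] [CommRing S] [CommRing S']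
    {ρ : R →+* S} {m n a b : ℕ} {E : Over (Spec (.of S))} {π : E.left ⟶ projLine R}
    (𝔸 : CurveAtlas ρ m n a b E π) (ψ : S →+* S') {L : Type} [CommRing L] (k : Bool)
    (χ : CurveChart S' m n a k →+* L) {u : Spec (.of L) ⟶ E.left} {v : Spec (.of L) ⟶ Spec (.of S')}
    (hu : u = Spec.map (CommRingCat.ofHom (χ.comp (ChartRing.map ψ _ _ _))) ≫ 𝔸.chart k)
    (hv : v = Spec.map (CommRingCat.ofHom (χ.comp (ChartRing.base _ _ _ _))))
    (w : u ≫ E.hom = v ≫ Spec.map (CommRingCat.ofHom ψ)) :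
    pullback.lift u v w = Spec.map (CommRingCat.ofHom χ) ≫ 𝔸.baseChangeChart ψ k := by
  have h₁ : pullback.lift u v w ≫ pullback.fst _ _ = u := pullback.lift_fst _ _ _
  have h₂ : pullback.lift u v w ≫ pullback.snd _ _ = v := pullback.lift_snd _ _ _
  apply pullback.hom_ext
  · rw [h₁, Category.assoc, baseChangeChart_fst, hu, CommRingCat.ofHom_comp, Spec.map_comp,
      Category.assoc]
  · rw [h₂, Category.assoc, baseChangeChart_snd, hv, CommRingCat.ofHom_comp, Spec.map_comp]

variable {κ}

lemma exists_geomAtlas {a b : ℕ} (hm : m ≠ 0) (hn : n ≠ 0) (hb : m * b = n * a + 1)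
    (hκ : (p : κ) = 0) :
    ∃ 𝔸 : CurveAtlas ((algebraMap (ZMod p) κ).comp ((reduction p).comp (RingHom.id _))) m n a b
        (geomFiber p m n κ) (geomProj p m n κ),
      (∀ k, 𝔸.chart k ≫ (geomFrobenius p m n κ).left =
        Spec.map (CommRingCat.ofHom (frobChart p hκ m n a k)) ≫ 𝔸.chart k) ∧
      (affineToGeomFiber p m n κ).left =
        Spec.map (CommRingCat.ofHom (chartToCoord κ m n a)) ≫ 𝔸.chart false := by
  obtain ⟨𝔸₀, h𝔸₀⟩ := exists_curveAtlas (ZLoc p) hm hn hb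
  let 𝔸 : CurveAtlas ((reduction p).comp (RingHom.id _)) m n a b (specialFiber p m n)
    (specialProj p m n) := 𝔸₀.baseChange (reduction p)
  refine ⟨𝔸.baseChange (algebraMap (ZMod p) κ), fun k => ?_, ?_⟩
  · exact 𝔸.baseChange_chart_frobenius p (natCast_zmod_self p) hκ k (algebraMap (ZMod p) κ) _
      (𝔸.chart_frobenius p k _)
  · have hbase : (chartToCoord κ m n a).comp (ChartRing.base _ _ _ _) = coordBase κ m n :=
      ChartRing.lift_comp_base ..
    refine 𝔸.comp_baseChangeChart (algebraMap (ZMod p) κ) false (chartToCoord κ m n a)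
      (u := pullback.lift _ _ _) ?_ (by rw [hbase]; rfl) _
    refine 𝔸₀.comp_baseChangeChart (reduction p) false
      ((chartToCoord κ m n a).comp (ChartRing.map (algebraMap (ZMod p) κ) _ _ _)) ?_ ?_ _
    · have h : ∀ {Z : Scheme.{0}} (c : Spec (.of (CurveChart (ZLoc p) m n a false)) ⟶ Z),
          Spec.map (CommRingCat.ofHom (coordRingMap ((algebraMap (ZMod p) κ).comp (reduction p))
            m n)) ≫ Spec.map (CommRingCat.ofHom (chartToCoord (ZLoc p) m n a)) ≫ c =
          Spec.map (CommRingCat.ofHom (((chartToCoord κ m n a).comp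
            (ChartRing.map (algebraMap (ZMod p) κ) _ _ _)).comp
              (ChartRing.map (reduction p) _ _ _))) ≫ c := fun c => by
        rw [← Category.assoc, ← Spec.map_comp, ← CommRingCat.ofHom_comp,
          coordRingMap_comp_chartToCoord, RingHom.comp_assoc]
        congr 4
        refine ChartRing.hom_ext ?_ ?_ ?_
        · ext r
          simp
        · simp
        · simp
      exact (congrArg (fun f => Spec.map (CommRingCat.ofHom (coordRingMap
        ((algebraMap (ZMod p) κ).comp (reduction p)) m n)) ≫ f) h𝔸₀.symm).trans (h _)
    · rw [RingHom.comp_assoc, ChartRing.map_comp_base, ← RingHom.comp_assoc, hbase,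
        CommRingCat.ofHom_comp, Spec.map_comp]
      rfl

/-- The factorization of the divisor over the field `κ`. -/
lemma geomDivisor_eq_prod {a b : ℕ} (hm : m ≠ 0) (hn : n ≠ 0) (hb : m * b = n * a + 1)
    (hκ : (p : κ) = 0) (hnκ : (n : κ) ≠ 0) {ξ : κ} (hξ : IsPrimitiveRoot ξ m) :
    ∃ σ : Aut (geomFiber p m n κ), IsRotation p m n hξ.pow_eq_one σ ∧
      (∀ j < m, IsEffectiveCartier (graphIdeal (geomFrobenius p m n κ ≫ (σ ^ j).hom))) ∧
      geomDivisor p m n κ =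
        ∏ j ∈ Finset.range m, graphIdeal (geomFrobenius p m n κ ≫ (σ ^ j).hom) := by
  obtain ⟨𝔸, hfrob, haff⟩ := exists_geomAtlas p m n hm hn hb hκ
  obtain ⟨σ, hσ⟩ := 𝔸.exists_aut hm hξ.pow_eq_one
  have hpow : ∀ j, (ξ ^ j) ^ m = 1 := fun j => by
    rw [← pow_mul, mul_comm, pow_mul, hξ.pow_eq_one, one_pow]
  -- From `m * b - n * a = 1`. It makes `ξ ^ a`, the multiplier of `x` at infinity, again a
  -- primitive `m`-th root of unity.
  have hcop : a.Coprime m := by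
    refine Nat.Coprime.symm (Nat.isCoprime_iff_coprime.mp ⟨b, -n, ?_⟩)
    have : (m * b : ℤ) = n * a + 1 := by exact_mod_cast hb
    linear_combination this
  have hη : ∀ k, IsPrimitiveRoot (ξ ^ rotExponent a k) m := by
    rintro (_ | _)
    · rwa [rotExponent, pow_one]
    · exact hξ.pow_of_coprime a hcop
  have key := 𝔸.isEffectiveCartier_and_eq_prod hκ hm hn hnκ hη (geomDivisor p m n κ)
    (geomDivisor_le_ker_iff p m n κ) (fun j => geomFrobenius p m n κ ≫ (σ ^ j).hom)
    (fun j k => (frobChart p hκ m n a k).comp (rotChart n a (hpow j) k))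
    (fun j k => by
      rw [Over.comp_left, reassoc_of% (hfrob k), hσ, ← Category.assoc, ← Spec.map_comp,
        ← CommRingCat.ofHom_comp])
    (fun j k => by rw [RingHom.comp_assoc, rotChart_comp_base, frobChart_comp_base])
    (fun j k => by rw [RingHom.comp_apply, rotChart_z, frobChart_z])
    (fun j k => by
      rw [RingHom.comp_apply, rotChart_x, map_mul, frobChart_base, frobChart_x, ← pow_mul,
        ← pow_mul, mul_comm j])
  refine ⟨σ, ?_, fun j hj => key.1 j (Finset.mem_range.mpr hj), key.2⟩
  refine Over.OverMorphism.ext ?_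
  have h1 := hσ 1 false
  simp only [pow_one] at h1
  have h2 : ∀ {Z : Scheme.{0}} (c : Spec (.of (CurveChart κ m n a false)) ⟶ Z) (s : Z ⟶ Z),
      c ≫ s = Spec.map (CommRingCat.ofHom (rotChart n a hξ.pow_eq_one false)) ≫ c →
      (Spec.map (CommRingCat.ofHom (chartToCoord κ m n a)) ≫ c) ≫ s =
        Spec.map (CommRingCat.ofHom (coordRingRot n hξ.pow_eq_one)) ≫
          Spec.map (CommRingCat.ofHom (chartToCoord κ m n a)) ≫ c := fun c s h => by
    rw [Category.assoc, h, ← Category.assoc, ← Category.assoc, ← Spec.map_comp, ← Spec.map_comp,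
      ← CommRingCat.ofHom_comp, ← CommRingCat.ofHom_comp, coordRingRot_comp_chartToCoord]
  rw [Over.comp_left, Over.comp_left, haff]
  exact h2 _ _ h1

lemma specialDivisor_le_graphIdeal {a b : ℕ} (hm : m ≠ 0) (hn : n ≠ 0) (hb : m * b = n * a + 1) :
    specialDivisor p m n ≤ graphIdeal (frobenius p (specialFiber p m n)) := by
  obtain ⟨𝔸⟩ := exists_specialAtlas p m n hm hn hb
  have hp := natCast_zmod_self p
  exact CurveAtlas.le_graphIdeal _ (specialDivisor_le_ker_iff p m n) _
    (𝔸.comp_powHom_eq _ (frobChart p hp m n a) (fun k => 𝔸.chart_frobenius p k hp)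
      (frobChart_comp_base p hp m n a) (frobChart_z p hp m n a))

end SettingAtlas

/-! ### Irreducibility of the curve and of graphs -/

section Irreducibility

variable {K : Type} [Field K]

/-- Eisenstein's criterion over `K[t]` at an irreducible factor of `t ^ n + 1`, which divides it
only once because `n` is invertible in `K`. -/
lemma isDomain_coordRing {m n : ℕ} (hm : m ≠ 0) (hn : n ≠ 0) (hnK : (n : K) ≠ 0) :
    IsDomain (CoordRing K m n) := by
  have hsep : (X ^ n + 1 : K[X]).Separable := by
    have := separable_X_pow_sub_C (-1 : K) hnK (neg_ne_zero.mpr one_ne_zero)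
    rwa [C_neg, sub_neg_eq_add, C_1] at this
  have hdeg : (X ^ n + 1 : K[X]).natDegree = n := natDegree_X_pow_add_C (r := (1 : K))
  have hne : (X ^ n + 1 : K[X]) ≠ 0 := hsep.ne_zero
  obtain ⟨q, hq, hdvd⟩ := WfDvdMonoid.exists_irreducible_factor
    (not_isUnit_of_natDegree_pos (X ^ n + 1 : K[X]) (by omega)) hne
  have hmonic : (X ^ m - C (X ^ n + 1) : K[X][X]).Monic := monic_X_pow_sub_C _ hm
  have hdegf : (X ^ m - C (X ^ n + 1) : K[X][X]).degree = m :=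
    degree_X_pow_sub_C (Nat.pos_of_ne_zero hm) _
  have hP : (Ideal.span {q}).IsPrime := (Ideal.span_singleton_prime hq.ne_zero).mpr hq.prime
  refine AdjoinRoot.isDomain_of_prime (Irreducible.prime ?_)
  refine irreducible_of_eisenstein_criterion hP ?_ (fun k hk => ?_) ?_ ?_ hmonic.isPrimitive
  · rw [hmonic.leadingCoeff]
    exact fun h => hP.ne_top ((Ideal.eq_top_iff_one _).mpr h)
  · rw [hdegf, Nat.cast_lt] at hk
    rw [coeff_sub, coeff_X_pow, if_neg hk.ne, zero_sub, coeff_C]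
    split_ifs
    · exact neg_mem (Ideal.mem_span_singleton.mpr hdvd)
    · simp
  · rw [hdegf]
    exact_mod_cast Nat.pos_of_ne_zero hm
  · rw [coeff_sub, coeff_X_pow, if_neg hm.symm, zero_sub, coeff_C_zero, neg_mem_iff,
      Ideal.span_singleton_pow, Ideal.mem_span_singleton, sq]
    exact fun h => hq.not_isUnit (hsep.squarefree q h)

lemma isDomain_chart {m n a : ℕ} (hm : m ≠ 0) (hn : n ≠ 0) (hnK : (n : K) ≠ 0) :
    IsDomain (CurveChart K m n a false) :=
  have := isDomain_coordRing hm hn hnK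
  (coordEquiv K m n a).toMulEquiv.isDomain (CoordRing K m n)

namespace CurveAtlas

variable {R S : Type} [CommRing R] [CommRing S] {ρ : R →+* S} {m n a b : ℕ}
  {E : Over (Spec (.of S))} {π : E.left ⟶ projLine R} (𝔸 : CurveAtlas ρ m n a b E π)

lemma chart_true_mem_range_iff (q : Spec (.of (CurveChart S m n a true))) :
    𝔸.chart true q ∈ Set.range (𝔸.chart false) ↔
      ChartRing.z S m (chartH n a true) (chartG n true) ∉ q.asIdeal := by
  have h : π (𝔸.chart true q) =
      chartInfty R (Spec.map (CommRingCat.ofHom (lineToChart ρ m n a true)) q) :=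
    (Scheme.Hom.comp_apply ..).symm.trans
      (congr($(𝔸.chart_comp true) q).trans (Scheme.Hom.comp_apply ..))
  rw [𝔸.mem_range_iff, h, chartInfty_mem_range_iff]
  have hX : lineToChart ρ m n a true X = ChartRing.z _ _ _ _ := by simp [lineToChart]
  rw [← hX]
  rfl

/-- In the chart at infinity a minimal prime consists of zero divisors, so it misses `x`, hence also
`z`, which divides `x ^ m`. Every point there thus specializes from a point of the finite chart. -/
lemma dense_range_chart_false (hm : m ≠ 0) (hn : n ≠ 0) :
    Dense (Set.range (𝔸.chart false)) := by
  intro y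
  obtain ⟨k, q, rfl⟩ := 𝔸.exists_chart_eq y
  cases k with
  | false => exact subset_closure ⟨q, rfl⟩
  | true =>
    have hq : q.asIdeal.IsPrime := q.2
    obtain ⟨𝔭, h𝔭, hle⟩ := Ideal.exists_minimalPrimes_le (I := ⊥) (J := q.asIdeal) bot_le
    have hprime : 𝔭.IsPrime := h𝔭.1.1
    have hx : ChartRing.x S m (chartH n a true) (chartG n true) ∉ 𝔭 := fun h =>
      notMem_nonZeroDivisors_of_mem_mem_minimalPrimes h h𝔭
        (ChartRing.x_mem_nonZeroDivisors S a hm hn)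
    have hz : ChartRing.z S m (chartH n a true) (chartG n true) ∉ 𝔭 := fun h => hx <| by
      refine hprime.mem_of_pow_mem m ?_
      rw [ChartRing.x_pow, intEval_chartH_true]
      exact 𝔭.mul_mem_right _ h
    let q' : Spec (.of (CurveChart S m n a true)) := (⟨𝔭, hprime⟩ : PrimeSpectrum _)
    have hspec : q' ⤳ q := (PrimeSpectrum.le_iff_specializes _ _).mp hle
    exact (hspec.map (𝔸.chart true).continuous).mem_closed isClosed_closure
      (subset_closure ((𝔸.chart_true_mem_range_iff q').mpr hz))

lemma irreducibleSpace {R S : Type} [CommRing R] [CommRing S] {ρ : R →+* S} {m n a b : ℕ}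
    {E : Over (Spec (.of S))} {π : E.left ⟶ projLine R} (𝔸 : CurveAtlas ρ m n a b E π)
    [IsDomain (CurveChart S m n a false)] (hm : m ≠ 0) (hn : n ≠ 0) :
    IrreducibleSpace E.left := by
  have h : IsIrreducible (Set.range (𝔸.chart false)) := by
    rw [← Set.image_univ]
    have : IrreducibleSpace (Spec (.of (CurveChart S m n a false))) :=
      PrimeSpectrum.irreducibleSpace
    exact IrreducibleSpace.isIrreducible_univ _ |>.image _ (𝔸.chart false).continuous.continuousOn
  rw [irreducibleSpace_def]
  change IsIrreducible Set.univ
  rw [← (𝔸.dense_range_chart_false hm hn).closure_eq]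
  exact h.closure

end CurveAtlas

lemma isIrreducible_support_graphIdeal {S : Scheme.{0}} {X Y : Over S} [IsSeparated Y.hom]
    [IrreducibleSpace X.left] (g : X ⟶ Y) :
    IsIrreducible (X := ↥(pullback X.hom Y.hom)) (graphIdeal g).support := by
  let γ : X.left ⟶ pullback X.hom Y.hom := pullback.lift (𝟙 X.left) g.left (by simp)
  have hγ₁ : γ ≫ pullback.fst X.hom Y.hom = 𝟙 _ := pullback.lift_fst _ _ _
  have : IsClosedImmersion γ := by
    have : IsClosedImmersion (γ ≫ pullback.fst X.hom Y.hom) := by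
      rw [hγ₁]
      infer_instance
    exact .of_comp γ (pullback.fst X.hom Y.hom)
  change IsIrreducible (X := ↥(pullback X.hom Y.hom)) γ.ker.support
  rw [Scheme.Hom.support_ker, ← Set.image_univ]
  exact ((IrreducibleSpace.isIrreducible_univ _).image _ γ.continuous.continuousOn).closure

end Irreducibility

/-! ### The graph of the Frobenius is a component -/

section Component

/-- An irreducible `Z` between `A` and `B` meets `U`, so it is contained in the closure of `Z ∩ U`,
a subset of the closed set `A`. -/
lemma maximal_isIrreducible_of_subset {X : Type*} [TopologicalSpace X] {A B U : Set X}
    (hA : IsIrreducible A) (hAc : IsClosed A) (hAB : A ⊆ B) (hU : IsOpen U)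
    (hne : (A ∩ U).Nonempty) (hBU : B ∩ U ⊆ A) :
    Maximal (fun Z => IsIrreducible Z ∧ Z ⊆ B) A := by
  refine ⟨⟨hA, hAB⟩, fun Z hZ hAZ => ?_⟩
  have h := subset_closure_inter_of_isPreirreducible_of_isOpen hZ.1.2 hU
    (hne.mono (Set.inter_subset_inter_left U hAZ))
  exact h.trans (hAc.closure_subset_iff.mpr
    ((Set.inter_subset_inter_left U hZ.2).trans hBU))

namespace ProdRing

variable (S : Type) [CommRing S] (m n a p : ℕ)

/-- The cofactor of `x₂ - x₁ ^ p` in `x₂ ^ m - x₁ ^ (p * m)`. -/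
def cofactor : ProdRing S m n a false :=
  ∑ i ∈ Finset.range m, x₂ S m n a false ^ i * (x₁ S m n a false ^ p) ^ (m - 1 - i)

/-- The right-hand product is `x₂ ^ m - x₁ ^ (p * m) = h(z₂) - h(z₁ ^ p)`. -/
lemma z_sub_dvd_cofactor_mul [Fact p.Prime] (hp : (p : S) = 0) :
    z₂ S m n a false - z₁ S m n a false ^ p ∣
      cofactor S m n a p * (x₂ S m n a false - x₁ S m n a false ^ p) := by
  have h0 : (p : ProdRing S m n a false) = 0 :=
    natCast_chart_eq_zero (natCast_chart_eq_zero hp m n a false) m n a false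
  obtain ⟨c, hc⟩ := exists_intEval_sub_eq (chartH n a false) (z₂ S m n a false)
    (z₁ S m n a false ^ p)
  refine ⟨_, .trans ?_ hc⟩
  rw [ cofactor, geom_sum₂_mul, x₂_pow, ← pow_mul, mul_comm p, pow_mul, x₁_pow,
    intEval_frobenius p h0]

/-- The point is `(t, y) = (0, 1)` in both factors. It lies on the graph, and each of the `m` terms
of the cofactor equals `1` there. -/
lemma exists_point (hn : n ≠ 0) (hp : p ≠ 0) : ∃ φ : ProdRing S m n a false →+* S,
    φ (z₂ S m n a false - z₁ S m n a false ^ p) = 0 ∧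
    φ (x₂ S m n a false - x₁ S m n a false ^ p) = 0 ∧
    φ (cofactor S m n a p) = m := by
  have hg : ∀ {A : Type} [CommRing A], IsUnit (intEval (chartG n false) (0 : A)) := by
    intro A _
    rw [intEval_chartG_false]
    exact isUnit_one
  have hr : ∀ {A : Type} [CommRing A], (1 : A) ^ m = intEval (chartH n a false) 0 := by
    intro A _
    rw [intEval_chartH_false, zero_pow hn, zero_add, one_pow]
  let ψ : CurveChart S m n a false →+* S := ChartRing.lift (RingHom.id S) 0 1 hg hr
  let φ : ProdRing S m n a false →+* S := ChartRing.lift ψ 0 1 hg hr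
  have hz₁ : φ (z₁ S m n a false) = 0 := (ChartRing.lift_base ..).trans (ChartRing.lift_z ..)
  have hx₁ : φ (x₁ S m n a false) = 1 := (ChartRing.lift_base ..).trans (ChartRing.lift_x ..)
  have hz₂ : φ (z₂ S m n a false) = 0 :=
    (congrArg φ (ChartRing.map_z _)).trans (ChartRing.lift_z ..)
  have hx₂ : φ (x₂ S m n a false) = 1 :=
    (congrArg φ (ChartRing.map_x _)).trans (ChartRing.lift_x ..)
  refine ⟨φ, ?_, ?_, ?_⟩
  · rw [map_sub, map_pow, hz₁, hz₂, zero_pow hp, sub_zero]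
  · rw [map_sub, map_pow, hx₁, hx₂, one_pow, sub_self]
  · simp [cofactor, hx₁, hx₂]

end ProdRing

namespace CurveAtlas

variable {R K : Type} [CommRing R] [Field K] {ρ : R →+* K} {m n a b : ℕ}
  {E : Over (Spec (.of K))} {π : E.left ⟶ projLine R} (𝔸 : CurveAtlas ρ m n a b E π)

/-- At a prime that contains `z₂ - z₁ ^ p` but not the cofactor, `x₂ - x₁ ^ p` must vanish. So on
that open set the divisor lies in the graph, and `exists_point` shows that the two meet there. -/
lemma maximal_support_graphIdeal [IsSeparated E.hom] {p : ℕ} [Fact p.Prime] (hp : (p : K) = 0)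
    (hm : m ≠ 0) (hn : n ≠ 0) (hmK : (m : K) ≠ 0) (hnK : (n : K) ≠ 0)
    (D : (pullback E.hom E.hom).IdealSheafData)
    (hD : ∀ {T : Scheme.{0}} (f : T ⟶ pullback E.hom E.hom), D ≤ f.ker ↔
      f ≫ pullback.fst _ _ ≫ π ≫ powHom R p = f ≫ pullback.snd _ _ ≫ π)
    (f : E ⟶ E)
    (hf : 𝔸.chart false ≫ f.left =
      Spec.map (CommRingCat.ofHom (frobChart p hp m n a false)) ≫ 𝔸.chart false)
    (hle : D ≤ graphIdeal f) :
    Maximal (fun Z : Set ↥(pullback E.hom E.hom) => IsIrreducible Z ∧ Z ⊆ D.support)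
      (graphIdeal f).support := by
  have := isDomain_chart (a := a) hm hn hnK
  have := 𝔸.irreducibleSpace hm hn
  have hG := 𝔸.isChartIdeal_graph false f (frobChart p hp m n a false) hf (p := p) (c := 1)
    (frobChart_comp_base ..) (frobChart_z ..)
    (by rw [map_one, one_mul, frobChart_x])
  rw [map_one, one_mul] at hG
  have hI := 𝔸.isChartIdeal_of_le_ker_iff false D hD
  let V : Set (Spec (.of (ProdRing K m n a false))) :=
    {y | ProdRing.cofactor K m n a p ∉ y.asIdeal}
  have hV : IsOpen V :=
    (PrimeSpectrum.basicOpen (ProdRing.cofactor K m n a p)).isOpen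
  refine maximal_isIrreducible_of_subset (U := 𝔸.prodChart false '' V)
    (isIrreducible_support_graphIdeal f) (graphIdeal f).support.isClosed
    (Scheme.IdealSheafData.support_antitone hle)
    ((𝔸.prodChart false).isOpenEmbedding.isOpenMap V hV) ?_ ?_
  · obtain ⟨φ, h₁, h₂, h₃⟩ := ProdRing.exists_point K m n a p hn (Fact.out : p.Prime).ne_zero
    let y : Spec (.of (ProdRing K m n a false)) :=
      (⟨RingHom.ker φ, RingHom.ker_isPrime φ⟩ : PrimeSpectrum _)
    refine ⟨𝔸.prodChart false y, (hG.mem_support_iff y).mpr ?_, y, ?_, rfl⟩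
    · rw [Ideal.span_le]
      rintro _ (rfl | rfl)
      exacts [h₁, h₂]
    · exact fun h => hmK (h₃.symm.trans h)
  · rintro _ ⟨hy, y, hyV, rfl⟩
    have hyD := (hI.mem_support_iff y).mp hy
    rw [Ideal.span_singleton_le_iff_mem] at hyD
    refine (hG.mem_support_iff y).mpr ?_
    rw [Ideal.span_le]
    rintro _ (rfl | rfl)
    · exact hyD
    · exact (y.2.mem_or_mem (Ideal.mem_of_dvd _
        (ProdRing.z_sub_dvd_cofactor_mul K m n a p hp) hyD)).resolve_left hyV

end CurveAtlas

end Component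

lemma maximal_support_graphIdeal_frobenius (p m n : ℕ) [Fact p.Prime] {a b : ℕ}
    (hm : m ≠ 0) (hn : n ≠ 0) (hb : m * b = n * a + 1) (hmp : (m : ZMod p) ≠ 0)
    (hnp : (n : ZMod p) ≠ 0) :
    Maximal
      (fun Z : Set ↥(pullback (specialFiber p m n).hom (specialFiber p m n).hom) =>
        IsIrreducible Z ∧ Z ⊆ (specialDivisor p m n).support)
      (graphIdeal (frobenius p (specialFiber p m n))).support := by
  obtain ⟨𝔸⟩ := exists_specialAtlas p m n hm hn hb
  exact 𝔸.maximal_support_graphIdeal (natCast_zmod_self p) hm hn hmp hnp _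
    (specialDivisor_le_ker_iff p m n) _ (𝔸.chart_frobenius p false _)
    (specialDivisor_le_graphIdeal p m n hm hn hb)

lemma exists_mul_eq_mul_add_one {m n : ℕ} (hmn : m.Coprime n) (hn : 1 < n) :
    ∃ a b, m * b = n * a + 1 := by
  obtain ⟨b, hb⟩ := Nat.exists_mul_mod_eq_one_of_coprime hmn hn
  -- `b` inverts `m` modulo `n`, and `a` is the quotient of `m * b` by `n`.
  refine ⟨m * b / n, b, ?_⟩
  have := Nat.div_add_mod (m * b) n
  omega

end SuperellipticFrobenius

open SuperellipticFrobenius in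
theorem lemma2p2 (p m n : ℕ) [Fact p.Prime] (hn : 5 ≤ n) (hn6 : n.Coprime 6)
    (hm3 : m.Coprime 3) (hmn : m.Coprime n) (hp : ¬ p ∣ m * n)
    (κ : Type) [Field κ] [Algebra (ZMod p) κ] (ξ : κ) (hξ : IsPrimitiveRoot ξ m)
    (hκ : IntermediateField.adjoin (ZMod p) {ξ} = ⊤) :
    (∃ σ : Aut (geomFiber p m n κ), IsRotation p m n hξ.pow_eq_one σ ∧
      (∀ j < m, IsEffectiveCartier (graphIdeal (geomFrobenius p m n κ ≫ (σ ^ j).hom))) ∧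
      geomDivisor p m n κ =
        ∏ j ∈ Finset.range m, graphIdeal (geomFrobenius p m n κ ≫ (σ ^ j).hom)) ∧
    specialDivisor p m n ≤ graphIdeal (frobenius p (specialFiber p m n)) ∧
    Maximal
      (fun Z : Set ↥(pullback (specialFiber p m n).hom (specialFiber p m n).hom) =>
        IsIrreducible Z ∧ Z ⊆ (specialDivisor p m n).support)
      (graphIdeal (frobenius p (specialFiber p m n))).support := by
  have hm0 : m ≠ 0 := fun h => hp (by simp [h])
  have hn0 : n ≠ 0 := by omega
  obtain ⟨a, b, hb⟩ := exists_mul_eq_mul_add_one hmn (by omega)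
  have hmp : (m : ZMod p) ≠ 0 := fun h =>
    hp (((ZMod.natCast_eq_zero_iff m p).mp h).mul_right n)
  have hnp : (n : ZMod p) ≠ 0 := fun h =>
    hp (((ZMod.natCast_eq_zero_iff n p).mp h).mul_left m)
  have hpκ : (p : κ) = 0 := by
    rw [← map_natCast (algebraMap (ZMod p) κ), natCast_zmod_self, map_zero]
  have hnκ : (n : κ) ≠ 0 := by
    rw [← map_natCast (algebraMap (ZMod p) κ)]
    exact (_root_.map_ne_zero _).mpr hnp
  exact ⟨geomDivisor_eq_prod p m n hm0 hn0 hb hpκ hnκ hξ,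
    specialDivisor_le_graphIdeal p m n hm0 hn0 hb,
    maximal_support_graphIdeal_frobenius p m n hm0 hn0 hb hmp hnp⟩
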